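/- **Setting.** Let $n\ge 2$ and $m\ge 1$ be integers and write $m=2k-1+\varepsilon$ with $k\ge 1$, $\varepsilon\in\{0,1\}$. For $a,b\in\{0,1\}$ let $P_i^{a,b}$ be the Jacobi polynomial $P_i^{(a+(n-3)/2,\;b+(n-3)/2)}$ normalized by $P_i^{a,b}(1)=1$, and let $P_i^{(n)}=P_i^{0,0}$ be the Gegenbauer polynomials. For a real polynomial $p$ let $p_i$ denote the coefficients of its expansion $p=\sum_i p_iP_i^{(n)}$. Let $t_i^{a,b}$ be the largest zero of $P_i^{a,b}$ for $i\ge1$, and $t_0^{1,1}:=-1$. Put $$D(n,m)=\binom{n+k-2+\varepsilon}{n-1}+\binom{n+k-2}{n-1},$$ $$L_m(n,s)=\binom{k+n-3+\varepsilon}{n-2}\left[\frac{2k+n-3+2\varepsilon}{n-1}-\frac{(1+s)^{\varepsilon}\bigl(P^{(n)}_{k-1+\varepsilon}(s)-P^{(n)}_{k+\varepsilon}(s)\bigr)}{(1-s)\bigl(\varepsilon P^{(n)}_{k}(s)+P^{(n)}_{k+\varepsilon}(s)\bigr)}\right],$$ the Levenshtein bound, which applies for $s\in[t_{k-1+\varepsilon}^{1,1-\varepsilon},\,t_k^{1,\varepsilon}]$,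 and let $$f_m^{(n,s)}(t)=(t-s)(t+1)^{\varepsilon}\Bigl(\sum_{i=0}^{k-1} r_i\,P_i^{1,\varepsilon}(t)P_i^{1,\varepsilon}(s)\Bigr)^2=\sum_{i=0}^m f_iP_i^{(n)}(t)$$ be the Levenshtein polynomial, where $1/r_i$ is the squared norm of $P_i^{1,\varepsilon}$ in $L^2$ of the probability measure on $[-1,1]$ proportional to $(1-t)^{1+(n-3)/2}(1+t)^{\varepsilon+(n-3)/2}\,dt$. Let $W=(w_1,\dots,w_N)$ with $w_i>0$ and $\sum_i w_i=1$, and put $N_W=1/\sum_i w_i^2$. For $s\in[-1,1)$ and a potential $h$ let $$\mathcal U^h(s,W)=\sup\sum_{i\ne j}w_iw_j\,h(x_i\cdot x_j),$$ where the supremum (in the extended reals, equal to $-\infty$ if there is no such tuple) is over all $N$-tuples $(x_1,\dots,x_N)$ of distinct points of the unit sphere $\mathbb S^{n-1}\subset\mathbb R^n$ with $\max_{i\ne j}x_i\cdot x_j=s$. **Theorem 4.2 (UUB for weighted codes).** Let $s\in[-1,1)$ with $s\in[t_{k-1+\varepsilon}^{1,1-\varepsilon},\,t_k^{1,\varepsilon}]$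 be such that $N_1:=L_m(n,s)$ satisfies $D(n,m)<N_1\le D(n,m+1)$. Let $h$ be real-valued and continuous on $[-1,1)$ and $m$ times differentiable on $(-1,1)$ with $h^{(m)}\ge0$ there. Then the multiset $T$ of the real roots of $f_m^{(n,s)}$, counted with multiplicity, consists of $m$ points of $[-1,s]$, and $$\mathcal U^h(s,W)\le-\lambda^*f_0\Bigl(1-\frac{N_1}{N_W}\Bigr)+(g_T)_0-\frac{g_T(1)}{N_W}.$$ Here $g_T$ is the Hermite interpolant of $h$ at $T$, i.e. the unique polynomial of degree less than $m$ with $g_T^{(j)}(\alpha)=h^{(j)}(\alpha)$ for every $\alpha\in T$ and every $j$ less than the multiplicity of $\alpha$ in $T$, and $$\lambda^*=\max\Bigl\{\frac{(g_T)_i}{f_i}\;:\;1\le i\le m,\ (g_T)_i>0\Bigr\},$$ with $\lambda^*=0$ if no $(g_T)_i$ with $1\le i\le m$ is positive. -/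

import Mathlib

open Polynomial

namespace WeightedCodes

noncomputable section

/-! ### Weighted spherical codes and their energy -/

/-- A weight vector: positive weights with total mass one. -/
def IsWeight {N : ℕ} (w : Fin N → ℝ) : Prop :=
  (∀ i, 0 < w i) ∧ ∑ i, w i = 1

/-- `s` is the maximal inner product of pairs of distinct points of the tuple `x`. -/
def IsMaxInner {n N : ℕ} (x : Fin N → Metric.sphere (0 : EuclideanSpace ℝ (Fin n)) 1)
    (s : ℝ) : Prop :=
  IsGreatest {u : ℝ | ∃ i j : Fin N, i ≠ j ∧
    u = inner ℝ (x i : EuclideanSpace ℝ (Fin n)) (x j)} s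

/-- The weighted `h`-energy: the sum over all ordered pairs `i ≠ j` of
`w i * w j * h (x i ⬝ x j)`. -/
def energy {n N : ℕ} (h : ℝ → ℝ) (x : Fin N → Metric.sphere (0 : EuclideanSpace ℝ (Fin n)) 1)
    (w : Fin N → ℝ) : ℝ :=
  ∑ i, ∑ j ∈ Finset.univ.erase i,
    w i * w j * h (inner ℝ (x i : EuclideanSpace ℝ (Fin n)) (x j))

/-- The maximum weighted `h`-energy: the supremum, in the extended reals, of the energies of all
`N`-tuples of distinct points of the unit sphere of `ℝⁿ` whose maximal inner product is `s`. -/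
def maxEnergy (n : ℕ) {N : ℕ} (h : ℝ → ℝ) (s : ℝ) (w : Fin N → ℝ) : EReal :=
  sSup {E : EReal | ∃ x : Fin N → Metric.sphere (0 : EuclideanSpace ℝ (Fin n)) 1,
    Function.Injective x ∧ IsMaxInner x s ∧ E = ((energy h x w : ℝ) : EReal)}

/-- The effective size `N_W = 1 / ∑ w_i²` of a weight vector. -/
def effSize {N : ℕ} (w : Fin N → ℝ) : ℝ := 1 / ∑ i, w i ^ 2

/-! ### Jacobi and Gegenbauer polynomials -/

/-- The Jacobi polynomial `P_k^{(α,β)}`, normalized to take the value `1` at `1`: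
`₂F₁(-k, k + α + β + 1; α + 1; (1 - t) / 2)`, where the factors `(-k)_j / j!` have been written
as `(-1)^j * choose k j`. -/
def jacobi (α β : ℝ) (k : ℕ) : ℝ[X] :=
  ∑ j ∈ Finset.range (k + 1),
    C ((k.choose j : ℝ) * (ascPochhammer ℝ j).eval (k + α + β + 1) /
      (ascPochhammer ℝ j).eval (α + 1)) * (C (1 / 2) * (X - 1)) ^ j

/-- The Jacobi polynomial with parameters `(a + (n-3)/2, b + (n-3)/2)`. -/
def adjacent (n a b k : ℕ) : ℝ[X] :=
  jacobi (a + ((n : ℝ) - 3) / 2) (b + ((n : ℝ) - 3) / 2) k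

/-- The Gegenbauer polynomial `P_k^{(n)}`, normalized to take the value `1` at `1`. -/
def gegenbauer (n k : ℕ) : ℝ[X] := adjacent n 0 0 k

/-- The largest zero `t_k^{a,b}` of `adjacent n a b k`, with the convention `t_0 = -1`. -/
def largestZero (n a b k : ℕ) : ℝ :=
  if k = 0 then -1 else sSup {t : ℝ | (adjacent n a b k).IsRoot t}

lemma jacobi_degree {α β : ℝ} (hα : -1 < α) (hαβ : -1 ≤ α + β) (k : ℕ) :
    (jacobi α β k).degree = k := by
  have hd : ∀ j : ℕ, ((C (1 / 2 : ℝ) * (X - 1)) ^ j).degree = (j : WithBot ℕ) := fun j => by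
    have h1 : (X - 1 : ℝ[X]).degree = 1 := by simpa using degree_X_sub_C (1 : ℝ)
    rw [degree_pow, degree_C_mul (by norm_num), h1]; simp
  have hlead : (k.choose k : ℝ) * (ascPochhammer ℝ k).eval (k + α + β + 1) /
      (ascPochhammer ℝ k).eval (α + 1) ≠ 0 := by
    have h2 : 0 < (ascPochhammer ℝ k).eval (α + 1) := ascPochhammer_pos k _ (by linarith)
    have h3 : (ascPochhammer ℝ k).eval (k + α + β + 1) ≠ 0 := by
      rcases Nat.eq_zero_or_pos k with rfl | hk
      · simp
      · have : (1 : ℝ) ≤ k := by exact_mod_cast hk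
        exact (ascPochhammer_pos k _ (by linarith)).ne'
    rw [Nat.choose_self]
    exact div_ne_zero (mul_ne_zero (by norm_num) h3) h2.ne'
  rw [jacobi, Finset.sum_range_succ, degree_add_eq_right_of_degree_lt] <;>
    rw [degree_C_mul hlead, hd]
  refine lt_of_le_of_lt (degree_sum_le _ _) ?_
  rw [Finset.sup_lt_iff (WithBot.bot_lt_coe _)]
  intro j hj
  rw [← smul_eq_C_mul]
  refine lt_of_le_of_lt (degree_smul_le _ _) ?_
  rw [hd]
  exact_mod_cast Finset.mem_range.mp hj

lemma gegenbauer_degree {n : ℕ} (hn : 2 ≤ n) (k : ℕ) : (gegenbauer n k).degree = k := by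
  have : (2 : ℝ) ≤ n := by exact_mod_cast hn
  exact jacobi_degree (by push_cast; linarith) (by push_cast; linarith) k

/-- The Gegenbauer polynomials form a basis of `ℝ[X]`. -/
def gegenbauerBasis {n : ℕ} (hn : 2 ≤ n) : Module.Basis ℕ ℝ ℝ[X] :=
  Sequence.basis ⟨gegenbauer n, gegenbauer_degree hn⟩
    fun i => isUnit_iff_ne_zero.mpr (leadingCoeff_ne_zero.mpr (Sequence.ne_zero _ i))

lemma gegenbauerBasis_apply {n : ℕ} (hn : 2 ≤ n) (i : ℕ) :
    gegenbauerBasis hn i = gegenbauer n i := by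
  simp [gegenbauerBasis]

/-- The coefficient `p_i` in the Gegenbauer expansion `p = ∑ p_i P_i^{(n)}`. -/
def gegenbauerCoeff {n : ℕ} (hn : 2 ≤ n) (p : ℝ[X]) (i : ℕ) : ℝ :=
  (gegenbauerBasis hn).repr p i

/-! ### The Levenshtein bound and the Levenshtein polynomial

A positive integer `m` is written as `m = 2k - 1 + ε` with `k ≥ 1` and `ε ∈ {0, 1}`. -/

/-- The integer `k` in `m = 2k - 1 + ε`. -/
def halfIdx (m : ℕ) : ℕ := (m + 1) / 2

/-- The parity `ε` in `m = 2k - 1 + ε`. -/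
def parity (m : ℕ) : ℕ := (m + 1) % 2

lemma halfIdx_parity (m : ℕ) : 2 * halfIdx m + parity m = m + 1 ∧ parity m ≤ 1 := by
  unfold halfIdx parity; omega

/-- The Delsarte-Goethals-Seidel bound `D(n, m)`. -/
def dgs (n m : ℕ) : ℕ :=
  (n + halfIdx m - 2 + parity m).choose (n - 1) + (n + halfIdx m - 2).choose (n - 1)

/-- The Levenshtein bound `L_m(n, s)`. -/
def levenshteinBound (n m : ℕ) (s : ℝ) : ℝ :=
  let k := halfIdx m
  let ε := parity m
  ((k + n - 3 + ε).choose (n - 2) : ℝ) *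
    ((2 * k + n - 3 + 2 * ε) / (n - 1) -
      (1 + s) ^ ε * ((gegenbauer n (k - 1 + ε)).eval s - (gegenbauer n (k + ε)).eval s) /
        ((1 - s) * (ε * (gegenbauer n k).eval s + (gegenbauer n (k + ε)).eval s)))

/-- The interval of those `s` for which the Levenshtein bound of index `m` is in force. -/
def levenshteinInterval (n m : ℕ) : Set ℝ :=
  Set.Icc (largestZero n 1 (1 - parity m) (halfIdx m - 1 + parity m))
    (largestZero n 1 (parity m) (halfIdx m))

/-- The reciprocal of the squared norm of `jacobi α β i` in `L²` of the probability measure on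
`[-1, 1]` proportional to `(1 - t)^α (1 + t)^β dt` (for `α, β > -1`, `α + β > -1`). -/
def jacobiInvNormSq (α β : ℝ) (i : ℕ) : ℝ :=
  (2 * i + α + β + 1) / (α + β + 1) *
    ((ascPochhammer ℝ i).eval (α + 1) * (ascPochhammer ℝ i).eval (α + β + 1)) /
      ((ascPochhammer ℝ i).eval (β + 1) * (i.factorial : ℝ))

/-- The reproducing (Christoffel-Darboux) kernel
`T(t, s) = ∑_{i < k} r_i P_i(t) P_i(s)`, as a polynomial in `t`, where `P_i` is
`adjacent n 1 ε i` and `r_i` is the reciprocal of its squared norm. -/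
def levenshteinKernel (n ε k : ℕ) (s : ℝ) : ℝ[X] :=
  ∑ i ∈ Finset.range k,
    C (jacobiInvNormSq (1 + ((n : ℝ) - 3) / 2) (ε + ((n : ℝ) - 3) / 2) i *
      (adjacent n 1 ε i).eval s) * adjacent n 1 ε i

/-- The Levenshtein polynomial `f_m^{(n,s)}(t) = (t - s) (t + 1)^ε T(t, s)²`. -/
def levenshteinPoly (n m : ℕ) (s : ℝ) : ℝ[X] :=
  (X - C s) * (X + 1) ^ parity m * levenshteinKernel n (parity m) (halfIdx m) s ^ 2

/-! ### Hermite interpolation -/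

/-- `p` is the Hermite interpolant of `h` at the multiset `T` of nodes: it has degree less than the
size of `T`, and at each node `a` it agrees with `h` together with the derivatives of order less
than the multiplicity of `a`. -/
def IsHermiteInterpolant (h : ℝ → ℝ) (T : Multiset ℝ) (p : ℝ[X]) : Prop :=
  p.degree < (T.card : WithBot ℕ) ∧
    ∀ a ∈ T, ∀ j < T.count a, (derivative^[j] p).eval a = iteratedDeriv j h a

lemma eq_zero_of_hermite {T : Multiset ℝ} {p : ℝ[X]} (hp : p.degree < (T.card : WithBot ℕ))
    (h0 : ∀ a ∈ T, ∀ j < T.count a, (derivative^[j] p).eval a = 0) : p = 0 := by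
  by_contra hne
  have hle : T ≤ p.roots := by
    rw [Multiset.le_iff_count]
    intro a
    rw [count_roots]
    by_cases ha : a ∈ T
    · have hc : 0 < T.count a := Multiset.count_pos.mpr ha
      have := (lt_rootMultiplicity_iff_isRoot_iterate_derivative (n := T.count a - 1) hne).mpr
        (fun j hj => h0 a ha j (by omega))
      omega
    · simp [Multiset.count_eq_zero_of_notMem ha]
  have h1 := Multiset.card_le_card hle
  have h2 := card_roots' p
  rw [degree_eq_natDegree hne] at hp
  have : p.natDegree < T.card := by exact_mod_cast hp
  omega

theorem existsUnique_hermite (h : ℝ → ℝ) (T : Multiset ℝ) :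
    ∃! p : ℝ[X], IsHermiteInterpolant h T p := by
  let ev : degreeLT ℝ T.card →ₗ[ℝ] ((Σ a : T.toFinset, Fin (T.count (a : ℝ))) → ℝ) :=
    LinearMap.pi fun q => (Polynomial.leval (q.1 : ℝ)) ∘ₗ ((derivative : ℝ[X] →ₗ[ℝ] ℝ[X]) ^ (q.2 : ℕ))
      ∘ₗ (degreeLT ℝ T.card).subtype
  have hev : ∀ p q, ev p q = (derivative^[(q.2 : ℕ)] (p : ℝ[X])).eval (q.1 : ℝ) := fun p q => by
    simp [ev, Module.End.pow_apply]
  have hinj : Function.Injective ev := by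
    rw [← LinearMap.ker_eq_bot, LinearMap.ker_eq_bot']
    intro p hp
    refine Subtype.ext (eq_zero_of_hermite (T := T) (mem_degreeLT.mp p.2) ?_)
    intro a ha j hj
    rw [← hev p ⟨⟨a, Multiset.mem_toFinset.mpr ha⟩, ⟨j, hj⟩⟩, hp]; rfl
  have hfin : Module.finrank ℝ (degreeLT ℝ T.card) =
      Module.finrank ℝ ((Σ a : T.toFinset, Fin (T.count (a : ℝ))) → ℝ) := by
    rw [(degreeLTEquiv ℝ T.card).finrank_eq]
    simp only [Module.finrank_fintype_fun_eq_card, Fintype.card_fin, Fintype.card_sigma]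
    rw [Finset.sum_coe_sort T.toFinset (fun a => T.count a), Multiset.toFinset_sum_count_eq]
  have : FiniteDimensional ℝ (degreeLT ℝ T.card) :=
    (degreeLTEquiv ℝ T.card).symm.finiteDimensional
  obtain ⟨p, hp⟩ := (LinearMap.injective_iff_surjective_of_finrank_eq_finrank hfin).mp hinj
    (fun q => iteratedDeriv (q.2 : ℕ) h (q.1 : ℝ))
  have hpT : IsHermiteInterpolant h T p := by
    refine ⟨mem_degreeLT.mp p.2, fun a ha j hj => ?_⟩
    rw [← hev p ⟨⟨a, Multiset.mem_toFinset.mpr ha⟩, ⟨j, hj⟩⟩, hp]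
  refine ⟨p, hpT, fun q hq => sub_eq_zero.mp (eq_zero_of_hermite (T := T) ?_ ?_)⟩
  · exact lt_of_le_of_lt (degree_sub_le _ _) (max_lt hq.1 hpT.1)
  · intro a ha j hj
    rw [iterate_derivative_sub, eval_sub, hq.2 a ha j hj, hpT.2 a ha j hj, sub_self]

/-- The Hermite interpolation polynomial of `h` at the multiset `T` of nodes. -/
def hermiteInterp (h : ℝ → ℝ) (T : Multiset ℝ) : ℝ[X] := (existsUnique_hermite h T).choose

lemma hermiteInterp_spec (h : ℝ → ℝ) (T : Multiset ℝ) :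
    IsHermiteInterpolant h T (hermiteInterp h T) := (existsUnique_hermite h T).choose_spec.1

/-- The polynomial `g_T`: the Hermite interpolant of `h` at the roots of the Levenshtein polynomial,
taken with their multiplicities. -/
def gT (n m : ℕ) (s : ℝ) (h : ℝ → ℝ) : ℝ[X] := hermiteInterp h (levenshteinPoly n m s).roots

/-- The set of the indices in `{1, ..., m}` of the positive Gegenbauer coefficients of `p`. -/
def posIndices {n : ℕ} (hn : 2 ≤ n) (m : ℕ) (p : ℝ[X]) : Finset ℕ :=
  {i ∈ Finset.Icc 1 m | 0 < gegenbauerCoeff hn p i}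

/-- The constant `λ* = max {(g_T)_i / f_i : i ∈ I(g_T)}`, and `0` if `I(g_T)` is empty. -/
def lambdaStar {n : ℕ} (hn : 2 ≤ n) (m : ℕ) (s : ℝ) (h : ℝ → ℝ) : ℝ :=
  if hI : (posIndices hn m (gT n m s h)).Nonempty then
    (posIndices hn m (gT n m s h)).sup' hI fun i =>
      gegenbauerCoeff hn (gT n m s h) i / gegenbauerCoeff hn (levenshteinPoly n m s) i
  else 0

end

end WeightedCodes

open WeightedCodes

/-!
The polynomial `F = g_T - λ* f_m` is a test polynomial for the linear programming bound: its
Gegenbauer coefficients of positive index are nonpositive, `h ≤ F` on `[-1, s]`, and the Gegenbauer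
polynomials are positive definite on the sphere (reproducing property of zonal harmonics), so every
admissible code has energy at most `F_0 - F(1) / N_W`.

* The nodal polynomial of `T` is `(t - s) (t + 1)^ε` times a square, so it is nonpositive on
  `[-1, s]`, and the error term of Hermite interpolation gives `h ≤ g_T` there. At `-1` only the
  value of `h` may be used, so `-1` must not be a multiple node; this holds because `N₁ > D(n, m)`
  excludes the left end of the interval of `s`, where the bound equals `D(n, m)`.
* All `f_i` with `i ≤ m` are positive: by the Christoffel-Darboux formula one factor
  `(t - s) T(t, s)` of `f_m` is a combination of two adjacent polynomials, and products of
  Gegenbauer polynomials have nonnegative Gegenbauer coefficients.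
* The only instance of the Levenshtein quadrature that is needed is `f_m(1) = f_0 L_m(n, s)`, which
  turns `F_0 - F(1) / N_W` into the stated bound.
-/

namespace WeightedCodes

noncomputable section

/-! ### Contiguous relations between Jacobi polynomials -/

section Contiguous

lemma cast_choose_succ_right {K : Type*} [Field K] [CharZero K] (k j : ℕ) :
    (k.choose (j + 1) : K) = k.choose j * (k - j) / (j + 1) := by
  rw [eq_div_iff (Nat.cast_add_one_ne_zero j)]
  rcases le_or_gt j k with hle | hlt
  · rw [← Nat.cast_sub hle]
    exact_mod_cast congrArg (Nat.cast (R := K)) (Nat.choose_succ_right_eq k j)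
  · simp [Nat.choose_eq_zero_of_lt hlt, Nat.choose_eq_zero_of_lt (hlt.trans j.lt_succ_self)]

lemma cast_succ_choose_succ {K : Type*} [Field K] [CharZero K] (k j : ℕ) :
    ((k + 1).choose (j + 1) : K) = (k + 1) * k.choose j / (j + 1) := by
  rw [eq_div_iff (Nat.cast_add_one_ne_zero j)]
  exact_mod_cast congrArg (Nat.cast (R := K)) (Nat.add_one_mul_choose_eq k j).symm

lemma cast_mul_pred_choose {R : Type*} [CommRing R] (k j : ℕ) :
    (k : R) * (k - 1).choose j = (k - j) * k.choose j := by
  rcases k with _ | k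
  · rcases j with _ | j <;> simp
  · rw [Nat.add_sub_cancel, sub_mul, eq_sub_iff_add_eq]
    rcases j with _ | j
    · simp
    · have h := congrArg (Nat.cast (R := R)) (Nat.add_one_mul_choose_eq k j)
      rw [Nat.choose_succ_succ'] at h ⊢
      push_cast at h ⊢
      linear_combination -h

lemma ascPochhammer_eval_succ_left {R : Type*} [CommRing R] (x : R) (j : ℕ) :
    (ascPochhammer R (j + 1)).eval x = x * (ascPochhammer R j).eval (x + 1) := by
  simp [ascPochhammer_succ_left]

lemma ascPochhammer_eval_mul_add {R : Type*} [CommRing R] (x : R) (j : ℕ) :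
    (ascPochhammer R j).eval x * (x + j) = x * (ascPochhammer R j).eval (x + 1) := by
  rw [← ascPochhammer_succ_eval, ascPochhammer_eval_succ_left]

/-- The coefficient of `((X - 1) / 2) ^ j` in the Jacobi polynomial `jacobi α β k`. -/
def jacobiCoeff (α β : ℝ) (k j : ℕ) : ℝ :=
  (k.choose j : ℝ) * (ascPochhammer ℝ j).eval (k + α + β + 1) / (ascPochhammer ℝ j).eval (α + 1)

/-- The Jacobi polynomial in the variable `y = (t - 1) / 2`, in which its coefficients are
hypergeometric. -/
def jacobiShifted (α β : ℝ) (k : ℕ) : ℝ[X] :=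
  ∑ j ∈ Finset.range (k + 1), C (jacobiCoeff α β k j) * X ^ j

lemma eval_jacobiShifted (α β : ℝ) (k : ℕ) (t : ℝ) :
    (jacobiShifted α β k).eval ((t - 1) / 2) = (jacobi α β k).eval t := by
  simp [jacobi, jacobiShifted, jacobiCoeff, eval_finsetSum, div_eq_inv_mul]

lemma coeff_jacobiShifted (α β : ℝ) (k j : ℕ) :
    (jacobiShifted α β k).coeff j = jacobiCoeff α β k j := by
  simp only [jacobiShifted, finsetSum_coeff, coeff_C_mul, coeff_X_pow, mul_ite, mul_one, mul_zero,
    Finset.sum_ite_eq, Finset.mem_range]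
  split_ifs with h
  · rfl
  · simp [jacobiCoeff, Nat.choose_eq_zero_of_lt (by omega : k < j)]

lemma jacobiCoeff_zero_right (α β : ℝ) (k : ℕ) : jacobiCoeff α β k 0 = 1 := by
  simp [jacobiCoeff]

lemma jacobi_zero (α β : ℝ) : jacobi α β 0 = 1 := by simp [jacobi]

lemma jacobi_eval_one (α β : ℝ) (k : ℕ) : (jacobi α β k).eval 1 = 1 := by
  rw [← eval_jacobiShifted, sub_self, zero_div, ← coeff_zero_eq_eval_zero, coeff_jacobiShifted,
    jacobiCoeff_zero_right]

lemma cast_mul_jacobiCoeff_pred (α β : ℝ) (k j : ℕ) :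
    k * jacobiCoeff α β (k - 1) j = (k - j) * k.choose j *
      (ascPochhammer ℝ j).eval (k + α + β) / (ascPochhammer ℝ j).eval (α + 1) := by
  rw [← cast_mul_pred_choose, jacobiCoeff]
  rcases k with _ | k
  · simp
  · rw [Nat.add_sub_cancel, mul_div_assoc', ← mul_assoc]
    congr 3
    push_cast
    ring

lemma jacobi_lower_right_eval (α β : ℝ) (k : ℕ) (t : ℝ) :
    (2 * k + α + β + 1) * (jacobi α β k).eval t =
      (k + α + β + 1) * (jacobi α (β + 1) k).eval t +
        k * (jacobi α (β + 1) (k - 1)).eval t := by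
  have key : C (2 * k + α + β + 1) * jacobiShifted α β k = C (k + α + β + 1) *
      jacobiShifted α (β + 1) k + C (k : ℝ) * jacobiShifted α (β + 1) (k - 1) := by
    ext j
    simp only [coeff_add, coeff_C_mul, coeff_jacobiShifted]
    rw [cast_mul_jacobiCoeff_pred, jacobiCoeff, jacobiCoeff,
      show (k : ℝ) + α + (β + 1) + 1 = k + α + β + 1 + 1 by ring,
      show (k : ℝ) + α + (β + 1) = k + α + β + 1 by ring, mul_div_assoc', mul_div_assoc', ← add_div]
    congr 1
    linear_combination (k.choose j : ℝ) * ascPochhammer_eval_mul_add (k + α + β + 1) j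
  simpa [eval_jacobiShifted] using congrArg (eval ((t - 1) / 2)) key

lemma jacobi_lower_left_eval {α : ℝ} (hα : -1 < α) (β : ℝ) (k : ℕ) (t : ℝ) :
    (2 * k + α + β + 1) * (α + 1) * (jacobi α β k).eval t =
      (k + α + β + 1) * (k + α + 1) * (jacobi (α + 1) β k).eval t -
        (k + β) * k * (jacobi (α + 1) β (k - 1)).eval t := by
  have key : C ((2 * k + α + β + 1) * (α + 1)) * jacobiShifted α β k =
      C ((k + α + β + 1) * (k + α + 1)) * jacobiShifted (α + 1) β k -
        C ((k + β) * k) * jacobiShifted (α + 1) β (k - 1) := by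
    ext j
    simp only [coeff_sub, coeff_C_mul, coeff_jacobiShifted]
    have hpos : 0 < (ascPochhammer ℝ j).eval (α + 1) := ascPochhammer_pos j _ (by linarith)
    have hpos' : 0 < (ascPochhammer ℝ j).eval (α + 1 + 1) := ascPochhammer_pos j _ (by linarith)
    rw [mul_assoc (k + β), cast_mul_jacobiCoeff_pred, jacobiCoeff, jacobiCoeff,
      show (k : ℝ) + (α + 1) + β + 1 = k + α + β + 1 + 1 by ring,
      show (k : ℝ) + (α + 1) + β = k + α + β + 1 by ring]
    field_simp
    linear_combination
      (ascPochhammer ℝ j).eval (α + 1) * k.choose j * (k + α + 1) *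
          ascPochhammer_eval_mul_add (k + α + β + 1) j -
        (2 * k + α + β + 1) * (ascPochhammer ℝ j).eval (k + α + β + 1) * k.choose j *
          ascPochhammer_eval_mul_add (α + 1) j
  simpa [eval_jacobiShifted] using congrArg (eval ((t - 1) / 2)) key

lemma jacobi_raise_right_eval {α : ℝ} (hα : -1 < α) (β : ℝ) (k : ℕ) (t : ℝ) :
    (2 * k + α + β + 2) * ((t + 1) * (jacobi α (β + 1) k).eval t) =
      2 * (k + 1 + α) * (jacobi α β (k + 1)).eval t +
        2 * (k + β + 1) * (jacobi α β k).eval t := by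
  have key : C (2 * k + α + β + 2) * ((X + 1) * jacobiShifted α (β + 1) k) =
      C (k + 1 + α) * jacobiShifted α β (k + 1) + C (k + β + 1) * jacobiShifted α β k := by
    ext j
    simp only [add_mul X, one_mul, coeff_C_mul, coeff_add]
    rcases j with _ | j
    · simp only [coeff_X_mul_zero, coeff_jacobiShifted, jacobiCoeff_zero_right]
      ring
    · have hpos : 0 < (ascPochhammer ℝ j).eval (α + 1) := ascPochhammer_pos j _ (by linarith)
      have hj : α + 1 + j ≠ 0 := by linarith [j.cast_nonneg (α := ℝ)]
      simp only [coeff_X_mul, coeff_jacobiShifted, jacobiCoeff, cast_choose_succ_right k,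
        cast_succ_choose_succ, ascPochhammer_succ_eval _ (α + 1)]
      rw [show (k : ℝ) + α + (β + 1) + 1 = k + α + β + 1 + 1 by ring,
        show ((k + 1 : ℕ) : ℝ) + α + β + 1 = k + α + β + 1 + 1 by push_cast; ring,
        ascPochhammer_eval_succ_left (k + α + β + 1), ascPochhammer_succ_eval]
      field_simp
      ring
  have h := congrArg (eval ((t - 1) / 2)) key
  simp only [eval_mul, eval_add, eval_C, eval_X, eval_one, eval_jacobiShifted] at h
  linear_combination 2 * h

lemma jacobi_raise_left_eval {α : ℝ} (hα : -1 < α) (β : ℝ) (k : ℕ) (t : ℝ) :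
    (2 * k + α + β + 2) * ((1 - t) * (jacobi (α + 1) β k).eval t) =
      2 * (α + 1) * ((jacobi α β k).eval t - (jacobi α β (k + 1)).eval t) := by
  have key : C (2 * k + α + β + 2) * (X * jacobiShifted (α + 1) β k) =
      C (α + 1) * (jacobiShifted α β (k + 1) - jacobiShifted α β k) := by
    ext j
    simp only [coeff_C_mul, coeff_sub]
    rcases j with _ | j
    · simp [coeff_jacobiShifted, jacobiCoeff_zero_right]
    · have hpos : 0 < (ascPochhammer ℝ j).eval (α + 1 + 1) := ascPochhammer_pos j _ (by linarith)
      have hα' : α + 1 ≠ 0 := by linarith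
      simp only [coeff_X_mul, coeff_jacobiShifted, jacobiCoeff, cast_choose_succ_right k,
        cast_succ_choose_succ, ascPochhammer_eval_succ_left (α + 1)]
      rw [show (k : ℝ) + (α + 1) + β + 1 = k + α + β + 1 + 1 by ring,
        show ((k + 1 : ℕ) : ℝ) + α + β + 1 = k + α + β + 1 + 1 by push_cast; ring,
        ascPochhammer_eval_succ_left (k + α + β + 1), ascPochhammer_succ_eval]
      field_simp
      ring
  have h := congrArg (eval ((t - 1) / 2)) key
  simp only [eval_mul, eval_sub, eval_C, eval_X, eval_jacobiShifted] at h
  linear_combination -2 * h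

end Contiguous

/-! ### Symmetrizable three-term recurrences -/

section ThreeTerm

lemma eval_nonneg_of_forall_gt_pos {p : ℝ[X]} {s : ℝ} (h : ∀ t > s, 0 < p.eval t) :
    ∀ t ≥ s, 0 ≤ p.eval t := fun t ht =>
  ge_of_tendsto (p.continuous.continuousAt.tendsto.mono_left nhdsWithin_le_nhds)
    (eventually_nhdsWithin_of_forall (s := Set.Ioi t) fun x hx => (h x (ht.trans_lt hx)).le)

lemma exists_root_forall_gt_pos {p : ℝ[X]} (hp : 0 < p.leadingCoeff) {t : ℝ}
    (ht : p.eval t ≤ 0) : ∃ x ≥ t, p.eval x = 0 ∧ ∀ y > x, 0 < p.eval y := by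
  have hdeg : 0 < p.degree := by
    by_contra hdeg
    rw [eq_C_of_degree_le_zero (not_lt.mp hdeg)] at hp ht
    simp only [leadingCoeff_C, eval_C] at hp ht
    linarith
  obtain ⟨M, hM⟩ := Filter.eventually_atTop.mp
    ((p.tendsto_atTop_of_leadingCoeff_nonneg hdeg hp.le).eventually_gt_atTop 0)
  have hcompact : IsCompact ({y | p.eval y ≤ 0} ∩ Set.Icc t (max M t)) :=
    isCompact_Icc.inter_left (isClosed_le p.continuous continuous_const)
  obtain ⟨x, ⟨hx, htx, -⟩, hmax⟩ := hcompact.exists_isGreatest ⟨t, ht, le_rfl, le_max_right _ _⟩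
  have hpos : ∀ y > x, 0 < p.eval y := fun y hy => by
    by_contra hc
    have hyM : y ≤ M := le_of_not_gt fun hy' => hc (hM y hy'.le)
    exact hy.not_ge (hmax ⟨not_lt.mp hc, htx.trans hy.le, le_max_of_le_left hyM⟩)
  exact ⟨x, htx, hx.antisymm (eval_nonneg_of_forall_gt_pos hpos x le_rfl), hpos⟩

lemma splits_of_forall_im_eq_zero {p : ℝ[X]} (h : ∀ z : ℂ, aeval z p = 0 → z.im = 0) :
    p.Splits := by
  rcases eq_or_ne p 0 with rfl | hp
  · simp
  refine Splits.of_splits_map (algebraMap ℝ ℂ) (IsAlgClosed.splits _) fun z hz => ?_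
  rw [mem_roots_map hp] at hz
  exact ⟨z.re, Complex.ext rfl (by simp [h z hz])⟩

/-- The polynomials `p k` satisfy the three-term recurrence
`X p_k = u_k p_{k+1} + g_k p_k + d_k p_{k-1}` of a sequence of orthogonal polynomials, the `r k`
being the reciprocals of their squared norms. -/
structure ThreeTerm (p : ℕ → ℝ[X]) (u g d r : ℕ → ℝ) : Prop where
  zero : p 0 = 1
  recurrence (k : ℕ) : X * p k = C (u k) * p (k + 1) + C (g k) * p k + C (d k) * p (k - 1)
  up_pos (k : ℕ) : 0 < u k
  down_zero : d 0 = 0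
  weight_pos (k : ℕ) : 0 < r k
  symm (k : ℕ) : r k * u k = r (k + 1) * d (k + 1)

/-- The reproducing kernel `∑_{i < k} r_i p_i(s) p_i` of the first `k` polynomials of a sequence
with squared norms `1 / r_i`, as a polynomial in one of its variables. -/
def cdKernel (p : ℕ → ℝ[X]) (r : ℕ → ℝ) (k : ℕ) (s : ℝ) : ℝ[X] :=
  ∑ i ∈ Finset.range k, C (r i * (p i).eval s) * p i

lemma eval_cdKernel (p : ℕ → ℝ[X]) (r : ℕ → ℝ) (k : ℕ) (s t : ℝ) :
    (cdKernel p r k s).eval t = ∑ i ∈ Finset.range k, r i * (p i).eval t * (p i).eval s := by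
  simp only [cdKernel, eval_finsetSum, eval_mul, eval_C, mul_right_comm]

namespace ThreeTerm

variable {p : ℕ → ℝ[X]} {u g d r : ℕ → ℝ}

lemma down_succ_pos (h : ThreeTerm p u g d r) (k : ℕ) : 0 < d (k + 1) :=
  pos_of_mul_pos_right (h.symm k ▸ mul_pos (h.weight_pos k) (h.up_pos k)) (h.weight_pos _).le

lemma recurrence_aeval (h : ThreeTerm p u g d r) {K : Type*} [CommRing K] [Algebra ℝ K] (x : K)
    (k : ℕ) :
    x * aeval x (p k) = algebraMap ℝ K (u k) * aeval x (p (k + 1)) +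
      algebraMap ℝ K (g k) * aeval x (p k) + algebraMap ℝ K (d k) * aeval x (p (k - 1)) := by
  simpa only [map_add, map_mul, aeval_X, aeval_C] using congrArg (aeval x) (h.recurrence k)

lemma recurrence_eval (h : ThreeTerm p u g d r) (x : ℝ) (k : ℕ) :
    x * (p k).eval x =
      u k * (p (k + 1)).eval x + g k * (p k).eval x + d k * (p (k - 1)).eval x := by
  simpa using h.recurrence_aeval x k

lemma natDegree_le (h : ThreeTerm p u g d r) (k : ℕ) : (p k).natDegree ≤ k := by
  induction k using Nat.strong_induction_on with
  | _ k ih =>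
    rcases k with _ | k
    · simp [h.zero]
    have key : C (u k) * p (k + 1) = X * p k - C (g k) * p k - C (d k) * p (k - 1) := by
      linear_combination -h.recurrence k
    have hk : (p k).natDegree ≤ k := ih k k.lt_succ_self
    have hk' : (p (k - 1)).natDegree ≤ k - 1 := ih (k - 1) (by omega)
    rw [← natDegree_C_mul (h.up_pos k).ne', key]
    refine (natDegree_sub_le_of_le (natDegree_sub_le_of_le
      (natDegree_mul_le_of_le natDegree_X_le hk) ((natDegree_C_mul_le _ _).trans hk))
      ((natDegree_C_mul_le _ _).trans hk')).trans ?_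
    omega

lemma coeff_self_pos (h : ThreeTerm p u g d r) (k : ℕ) : 0 < (p k).coeff k := by
  induction k with
  | zero => simp [h.zero]
  | succ k ih =>
    have hrec := congrArg (coeff · (k + 1)) (h.recurrence k)
    simp only [coeff_X_mul, coeff_add, coeff_C_mul] at hrec
    have hk : (p k).natDegree ≤ k := h.natDegree_le k
    have hk' : (p (k - 1)).natDegree ≤ k - 1 := h.natDegree_le (k - 1)
    rw [coeff_eq_zero_of_natDegree_lt (p := p k) (n := k + 1) (by omega),
      coeff_eq_zero_of_natDegree_lt (p := p (k - 1)) (n := k + 1) (by omega), mul_zero, mul_zero,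
      add_zero, add_zero] at hrec
    exact pos_of_mul_pos_right (hrec ▸ ih) (h.up_pos k).le

lemma natDegree_eq (h : ThreeTerm p u g d r) (k : ℕ) : (p k).natDegree = k :=
  natDegree_eq_of_le_of_coeff_ne_zero (h.natDegree_le k) (h.coeff_self_pos k).ne'

lemma leadingCoeff_pos (h : ThreeTerm p u g d r) (k : ℕ) : 0 < (p k).leadingCoeff := by
  rw [leadingCoeff, h.natDegree_eq]
  exact h.coeff_self_pos k

lemma ne_zero (h : ThreeTerm p u g d r) (k : ℕ) : p k ≠ 0 :=
  leadingCoeff_ne_zero.mp (h.leadingCoeff_pos k).ne'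

theorem christoffel_darboux (h : ThreeTerm p u g d r) {K : Type*} [CommRing K] [Algebra ℝ K]
    (x y : K) (k : ℕ) :
    (x - y) * ∑ i ∈ Finset.range (k + 1),
        algebraMap ℝ K (r i) * aeval x (p i) * aeval y (p i) =
      algebraMap ℝ K (r k * u k) *
        (aeval x (p (k + 1)) * aeval y (p k) - aeval x (p k) * aeval y (p (k + 1))) := by
  induction k with
  | zero =>
    have hx := h.recurrence_aeval x 0
    have hy := h.recurrence_aeval y 0
    simp only [h.down_zero, map_zero, map_mul, zero_add, Finset.range_one,
      Finset.sum_singleton] at hx hy ⊢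
    linear_combination algebraMap ℝ K (r 0) * aeval y (p 0) * hx -
      algebraMap ℝ K (r 0) * aeval x (p 0) * hy
  | succ k ih =>
    have hx := h.recurrence_aeval x (k + 1)
    have hy := h.recurrence_aeval y (k + 1)
    rw [h.symm k, map_mul] at ih
    rw [Finset.sum_range_succ, mul_add, ih, map_mul]
    rw [Nat.add_sub_cancel] at hx hy
    linear_combination algebraMap ℝ K (r (k + 1)) * aeval y (p (k + 1)) * hx -
      algebraMap ℝ K (r (k + 1)) * aeval x (p (k + 1)) * hy

lemma sum_weight_mul_normSq_pos (h : ThreeTerm p u g d r) (z : ℂ) (k : ℕ) :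
    0 < ∑ i ∈ Finset.range (k + 1), r i * Complex.normSq (aeval z (p i)) := by
  refine Finset.sum_pos' (fun i _ => mul_nonneg (h.weight_pos i).le (Complex.normSq_nonneg _))
    ⟨0, by simp, ?_⟩
  simp [h.zero, h.weight_pos 0]

lemma pencil_splits (h : ThreeTerm p u g d r) (k : ℕ) {a : ℝ} (ha : a ≠ 0) (b : ℝ) :
    (C a * p (k + 1) + C b * p k).Splits := by
  refine splits_of_forall_im_eq_zero fun z hz => ?_
  have hz' := congrArg (starRingEnd ℂ) hz
  rw [map_zero, ← aeval_conj] at hz'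
  simp only [map_add, map_mul, aeval_C, Complex.coe_algebraMap] at hz hz'
  have hdet : aeval z (p (k + 1)) * aeval (starRingEnd ℂ z) (p k) -
      aeval z (p k) * aeval (starRingEnd ℂ z) (p (k + 1)) = 0 := by
    refine mul_left_cancel₀ (Complex.ofReal_ne_zero.mpr ha) ?_
    linear_combination aeval (starRingEnd ℂ z) (p k) * hz - aeval z (p k) * hz'
  have hcd := h.christoffel_darboux z (starRingEnd ℂ z) k
  have hsum : ∑ i ∈ Finset.range (k + 1),
      algebraMap ℝ ℂ (r i) * aeval z (p i) * aeval (starRingEnd ℂ z) (p i) =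
        (∑ i ∈ Finset.range (k + 1), r i * Complex.normSq (aeval z (p i)) : ℝ) := by
    push_cast
    exact Finset.sum_congr rfl fun i _ => by
      rw [aeval_conj, mul_assoc, Complex.mul_conj, Complex.coe_algebraMap]
  rw [hdet, mul_zero, hsum] at hcd
  have hsub := (mul_eq_zero.mp hcd).resolve_right
    (Complex.ofReal_ne_zero.mpr (h.sum_weight_mul_normSq_pos z k).ne')
  exact Complex.conj_eq_iff_im.mp (sub_eq_zero.mp hsub).symm

lemma exists_isRoot (h : ThreeTerm p u g d r) (k : ℕ) : ∃ x, (p (k + 1)).IsRoot x := by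
  have hsplits : (p (k + 1)).Splits := by simpa using h.pencil_splits k one_ne_zero 0
  refine hsplits.exists_eval_eq_zero ?_
  rw [degree_eq_natDegree (h.ne_zero _), h.natDegree_eq]
  exact_mod_cast k.succ_ne_zero

-- At the largest zero of `p (k + 1)` the recurrence gives `u p (k + 2) = -d p k`, so that
-- `p (k + 2)` is negative there.
lemma pos_of_succ_nonneg (h : ThreeTerm p u g d r) (k : ℕ) :
    ∀ {s : ℝ}, (∀ t ≥ s, 0 ≤ (p (k + 1)).eval t) → ∀ t ≥ s, 0 < (p k).eval t := by
  induction k with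
  | zero => simp [h.zero]
  | succ k ih =>
    intro s hs t ht
    by_contra hc
    obtain ⟨x, htx, hx, hpos⟩ := exists_root_forall_gt_pos (h.leadingCoeff_pos _) (not_lt.mp hc)
    have hk : 0 < (p k).eval x := ih (fun y hy => by
      rcases hy.eq_or_lt with rfl | hlt
      · exact hx.ge
      · exact (hpos y hlt).le) x le_rfl
    have hrec := h.recurrence_eval x (k + 1)
    rw [hx, Nat.add_sub_cancel] at hrec
    have hup := mul_nonneg (h.up_pos (k + 1)).le (hs x (ht.trans htx))
    have hdown := mul_pos (h.down_succ_pos k) hk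
    linarith

lemma pos_of_le (h : ThreeTerm p u g d r) {s : ℝ} {j k : ℕ} (hjk : j ≤ k)
    (hk : ∀ t ≥ s, 0 < (p k).eval t) : ∀ t ≥ s, 0 < (p j).eval t := by
  induction k, hjk using Nat.le_induction with
  | base => exact hk
  | succ k _ ih => exact ih (h.pos_of_succ_nonneg k fun t ht => (hk t ht).le)

lemma cdKernel_eval_pos (h : ThreeTerm p u g d r) {s t : ℝ} {k : ℕ}
    (hk : ∀ t ≥ s, 0 < (p k).eval t) (hst : s ≤ t) : 0 < (cdKernel p r (k + 1) s).eval t := by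
  rw [eval_cdKernel]
  refine Finset.sum_pos (fun i hi => ?_) (by simp)
  have hi' := h.pos_of_le (Nat.lt_succ_iff.mp (Finset.mem_range.mp hi)) hk
  exact mul_pos (mul_pos (h.weight_pos i) (hi' t hst)) (hi' s le_rfl)

lemma sub_mul_cdKernel_eval (h : ThreeTerm p u g d r) (k : ℕ) (s t : ℝ) :
    (t - s) * (cdKernel p r (k + 1) s).eval t = r k * u k *
      ((p (k + 1)).eval t * (p k).eval s - (p k).eval t * (p (k + 1)).eval s) := by
  simpa [eval_cdKernel] using h.christoffel_darboux t s k

lemma X_sub_C_mul_cdKernel (h : ThreeTerm p u g d r) (k : ℕ) (s : ℝ) :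
    (X - C s) * cdKernel p r (k + 1) s =
      C (r k * u k * (p k).eval s) * p (k + 1) +
        C (-(r k * u k * (p (k + 1)).eval s)) * p k := by
  refine Polynomial.funext fun t => ?_
  have hcd := h.sub_mul_cdKernel_eval k s t
  simp only [eval_mul, eval_sub, eval_add, eval_X, eval_C]
  linear_combination hcd

lemma succ_eval_nonpos (h : ThreeTerm p u g d r) {s x : ℝ} {k : ℕ}
    (hk : ∀ t ≥ s, 0 < (p k).eval t) (hx : (p (k + 1)).IsRoot x) (hsx : s ≤ x) :
    (p (k + 1)).eval s ≤ 0 := by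
  have hcd := h.sub_mul_cdKernel_eval k s x
  rw [hx, zero_mul, zero_sub, ← mul_neg, mul_comm (r k * u k)] at hcd
  have hneg := nonneg_of_mul_nonneg_left (hcd ▸ mul_nonneg (sub_nonneg.mpr hsx)
    (h.cdKernel_eval_pos hk hsx).le) (mul_pos (h.weight_pos k) (h.up_pos k))
  exact nonpos_of_mul_nonpos_right (neg_nonneg.mp (by rwa [← mul_neg])) (hk x hsx)

lemma cdKernel_ne_zero (h : ThreeTerm p u g d r) (k : ℕ) (s : ℝ) :
    cdKernel p r (k + 1) s ≠ 0 := by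
  intro h0
  have hpos := h.sum_weight_mul_normSq_pos (s : ℂ) k
  have hs : (cdKernel p r (k + 1) s).eval s = 0 := by rw [h0, eval_zero]
  have haeval : ∀ q : ℝ[X], aeval (s : ℂ) q = (q.eval s : ℝ) := fun q =>
    aeval_algebraMap_apply_eq_algebraMap_eval s q
  simp only [eval_cdKernel, haeval, Complex.normSq_ofReal] at hs hpos
  exact hpos.ne' (by simpa only [mul_assoc] using hs)

lemma cdKernel_splits (h : ThreeTerm p u g d r) {k : ℕ} {s : ℝ} (hk : (p k).eval s ≠ 0) :
    (cdKernel p r (k + 1) s).Splits := by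
  have hpencil := h.pencil_splits k
    (mul_ne_zero (mul_pos (h.weight_pos k) (h.up_pos k)).ne' hk)
    (-(r k * u k * (p (k + 1)).eval s))
  rw [← h.X_sub_C_mul_cdKernel] at hpencil
  exact hpencil.of_dvd (mul_ne_zero (X_sub_C_ne_zero s) (h.cdKernel_ne_zero k s))
    (dvd_mul_left _ _)

lemma natDegree_cdKernel (h : ThreeTerm p u g d r) {k : ℕ} {s : ℝ} (hk : (p k).eval s ≠ 0) :
    (cdKernel p r (k + 1) s).natDegree = k := by
  rw [cdKernel, Finset.sum_range_succ, natDegree_add_eq_right_of_degree_lt,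
    natDegree_C_mul (mul_ne_zero (h.weight_pos k).ne' hk), h.natDegree_eq]
  rw [degree_C_mul (mul_ne_zero (h.weight_pos k).ne' hk), degree_eq_natDegree (h.ne_zero k),
    h.natDegree_eq]
  refine (degree_sum_le _ _).trans_lt ((Finset.sup_lt_iff (WithBot.bot_lt_coe _)).mpr ?_)
  intro i hi
  refine degree_le_natDegree.trans_lt (Nat.cast_lt.mpr ?_)
  exact ((natDegree_C_mul_le _ _).trans (h.natDegree_le i)).trans_lt (Finset.mem_range.mp hi)

-- A zero `t` of the kernel makes `(p (k + 1), p k)` proportional at `s` and `t`.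
lemma pencil_eval_mul_of_cdKernel_eval_eq_zero (h : ThreeTerm p u g d r) {k : ℕ} {s t : ℝ}
    (h0 : (cdKernel p r (k + 1) s).eval t = 0) (a b : ℝ) :
    (a * (p (k + 1)).eval t + b * (p k).eval t) * (p k).eval s =
      (p k).eval t * (a * (p (k + 1)).eval s + b * (p k).eval s) := by
  have hcd := h.sub_mul_cdKernel_eval k s t
  rw [h0, mul_zero, zero_eq_mul] at hcd
  linear_combination a * hcd.resolve_left (mul_pos (h.weight_pos k) (h.up_pos k)).ne'

lemma pencil_eq_zero_of_cdKernel_eval_eq_zero (h : ThreeTerm p u g d r) {k : ℕ} {s t : ℝ}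
    (h0 : (cdKernel p r (k + 1) s).eval t = 0) {a b σ : ℝ} (hs : 0 < (p k).eval s)
    (ht : 0 < σ * (p k).eval t) (hws : 0 ≤ a * (p (k + 1)).eval s + b * (p k).eval s)
    (hwt : σ * (a * (p (k + 1)).eval t + b * (p k).eval t) ≤ 0) :
    a * (p (k + 1)).eval s + b * (p k).eval s = 0 ∧
      a * (p (k + 1)).eval t + b * (p k).eval t = 0 := by
  have hprop := h.pencil_eval_mul_of_cdKernel_eval_eq_zero h0 a b
  have hle := mul_nonpos_of_nonpos_of_nonneg hwt hs.le
  rw [mul_assoc, hprop, ← mul_assoc] at hle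
  have hs0 := le_antisymm (nonpos_of_mul_nonpos_right hle ht) hws
  rw [hs0, mul_zero, mul_eq_zero] at hprop
  exact ⟨hs0, hprop.resolve_right hs.ne'⟩

end ThreeTerm

end ThreeTerm

/-! ### The recurrences of the Jacobi and the ultraspherical polynomials -/

section Recurrences

lemma jacobi_recurrence_eval {α : ℝ} (hα : -1 < α) (β : ℝ) (k : ℕ) (t : ℝ) :
    (2 * k + α + β) * (2 * k + α + β + 1) * (2 * k + α + β + 2) *
        ((t + 1) * (jacobi α β k).eval t) =
      (k + α + β + 1) * (2 * k + α + β) * (2 * (k + 1 + α) * (jacobi α β (k + 1)).eval t +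
          2 * (k + β + 1) * (jacobi α β k).eval t) +
        k * (2 * k + α + β + 2) * (2 * (k + α) * (jacobi α β k).eval t +
          2 * (k + β) * (jacobi α β (k - 1)).eval t) := by
  have hlower := jacobi_lower_right_eval α β k t
  have hraise := jacobi_raise_right_eval hα β k t
  rcases k with _ | k
  · simp only [Nat.cast_zero] at hlower hraise ⊢
    linear_combination (α + β) * (α + β + 2) * (t + 1) * hlower +
      (α + β + 1) * (α + β) * hraise
  · have hraise' := jacobi_raise_right_eval hα β k t
    simp only [Nat.add_sub_cancel] at hlower ⊢
    push_cast at hlower hraise ⊢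
    linear_combination (2 * (k + 1) + α + β) * (2 * (k + 1) + α + β + 2) * (t + 1) * hlower +
      (k + 1 + α + β + 1) * (2 * (k + 1) + α + β) * hraise +
      (k + 1) * (2 * (k + 1) + α + β + 2) * hraise'

/-- The coefficient of `P_{k+1}` in `t P_k(t)` for the Jacobi polynomials `P_k`. -/
def jacobiUp (α β : ℝ) (k : ℕ) : ℝ :=
  2 * (k + α + β + 1) * (k + 1 + α) / ((2 * k + α + β + 1) * (2 * k + α + β + 2))

/-- The coefficient of `P_{k-1}` in `t P_k(t)` for the Jacobi polynomials `P_k`. -/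
def jacobiDown (α β : ℝ) (k : ℕ) : ℝ :=
  2 * k * (k + β) / ((2 * k + α + β + 1) * (2 * k + α + β))

section Jacobi

variable {α β : ℝ}

lemma jacobiUp_pos (hα : -1 < α) (hσ : -1 < α + β) (k : ℕ) : 0 < jacobiUp α β k := by
  have hk : 0 < 2 * (k : ℝ) + α + β + 1 := by linarith [k.cast_nonneg (α := ℝ)]
  refine div_pos (mul_pos ?_ ?_) (mul_pos hk ?_) <;> linarith [k.cast_nonneg (α := ℝ)]

lemma jacobiInvNormSq_pos (hα : -1 < α) (hβ : -1 < β) (hσ : -1 < α + β) (k : ℕ) :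
    0 < jacobiInvNormSq α β k := by
  have hlin : 0 < (2 * k + α + β + 1) / (α + β + 1) :=
    div_pos (by linarith [k.cast_nonneg (α := ℝ)]) (by linarith)
  have hα' := ascPochhammer_pos k (α + 1) (by linarith)
  have hσ' := ascPochhammer_pos k (α + β + 1) (by linarith)
  have hβ' := ascPochhammer_pos k (β + 1) (by linarith)
  unfold jacobiInvNormSq
  positivity

lemma jacobiInvNormSq_mul_up (hβ : -1 < β) (hσ : -1 < α + β) (k : ℕ) :
    jacobiInvNormSq α β k * jacobiUp α β k =
      jacobiInvNormSq α β (k + 1) * jacobiDown α β (k + 1) := by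
  have := k.cast_nonneg (α := ℝ)
  have hβk : β + 1 + k ≠ 0 := by linarith
  have hβ' := (ascPochhammer_pos k (β + 1) (by linarith)).ne'
  have hσ₀ : α + β + 1 ≠ 0 := by linarith
  have hσ₁ : 2 * (k : ℝ) + α + β + 1 ≠ 0 := by linarith
  have hσ₂ : 2 * (k : ℝ) + α + β + 2 ≠ 0 := by linarith
  have hσ₃ : 2 * (k : ℝ) + α + β + 3 ≠ 0 := by linarith
  unfold jacobiInvNormSq jacobiUp jacobiDown
  rw [Nat.factorial_succ, ascPochhammer_succ_eval, ascPochhammer_succ_eval,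
    ascPochhammer_succ_eval]
  push_cast
  rw [show 2 * ((k : ℝ) + 1) + α + β + 1 = 2 * k + α + β + 3 by ring,
    show 2 * ((k : ℝ) + 1) + α + β = 2 * k + α + β + 2 by ring,
    show (k : ℝ) + 1 + β = β + 1 + k by ring]
  field_simp
  ring

-- The three coefficients add up to `1` since `P_k(1) = 1` for all `k`.
lemma jacobi_threeTerm (hα : -1 < α) (hβ : -1 < β) (hσ : -1 < α + β) :
    ThreeTerm (jacobi α β) (jacobiUp α β) (fun k => 1 - jacobiUp α β k - jacobiDown α β k)
      (jacobiDown α β) (jacobiInvNormSq α β) where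
  zero := jacobi_zero α β
  up_pos := jacobiUp_pos hα hσ
  down_zero := by simp [jacobiDown]
  weight_pos := jacobiInvNormSq_pos hα hβ hσ
  symm := jacobiInvNormSq_mul_up hβ hσ
  recurrence k := Polynomial.funext fun t => by
    simp only [eval_add, eval_mul, eval_X, eval_C, jacobiUp, jacobiDown]
    have hσ₁ : 2 * (k : ℝ) + α + β + 1 ≠ 0 := by linarith [k.cast_nonneg (α := ℝ)]
    have hσ₂ : 2 * (k : ℝ) + α + β + 2 ≠ 0 := by linarith [k.cast_nonneg (α := ℝ)]
    rcases k with _ | k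
    · have h := jacobi_raise_right_eval hα β 0 t
      simp only [jacobi_zero, Nat.cast_zero, mul_zero, zero_add, zero_mul, zero_div, sub_zero,
        eval_one] at h hσ₁ hσ₂ ⊢
      field_simp
      linear_combination h
    · have hσ₀ : 2 * ((k + 1 : ℕ) : ℝ) + α + β ≠ 0 := by
        push_cast
        linarith [k.cast_nonneg (α := ℝ)]
      have h := jacobi_recurrence_eval hα β (k + 1) t
      field_simp
      linear_combination h

lemma jacobi_pos_of_one_le (hα : -1 < α) (hσ : -2 < α + β) (k : ℕ) {t : ℝ} (ht : 1 ≤ t) :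
    0 < (jacobi α β k).eval t := by
  rw [jacobi, eval_finsetSum, Finset.sum_range_succ']
  simp only [eval_mul, eval_C, eval_pow, eval_sub, eval_X, eval_one]
  refine add_pos_of_nonneg_of_pos (Finset.sum_nonneg fun j hj => ?_) (by simp)
  have hk : (1 : ℝ) ≤ k := by
    exact_mod_cast (Nat.succ_le_of_lt j.succ_pos).trans (Finset.mem_range.mp hj)
  have hσ' := ascPochhammer_pos (j + 1) (k + α + β + 1) (by linarith)
  have hα' := ascPochhammer_pos (j + 1) (α + 1) (by linarith)
  have : 0 ≤ 1 / 2 * (t - 1) := by linarith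
  positivity

end Jacobi

/-- The coefficient of `P_{k-1}` in `t P_k(t)` for the ultraspherical polynomials `P_k`. For
`ν = -1 / 2` and `k = 0` the quotient is `0 / 0 = 0`, which is the correct value. -/
def ultraDown (ν : ℝ) (k : ℕ) : ℝ := k / (2 * k + 2 * ν + 1)

/-- The reciprocal of the squared norm of the ultraspherical polynomial `P_k`. -/
def ultraWeight (ν : ℝ) (k : ℕ) : ℝ :=
  ∏ i ∈ Finset.range k, (1 - ultraDown ν i) / ultraDown ν (i + 1)

section Ultraspherical

variable {ν : ℝ}

lemma ultraDown_zero (ν : ℝ) : ultraDown ν 0 = 0 := by simp [ultraDown]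

lemma ultraDown_succ_pos (hν : -1 / 2 ≤ ν) (k : ℕ) : 0 < ultraDown ν (k + 1) :=
  div_pos (by positivity) (by push_cast; linarith [k.cast_nonneg (α := ℝ)])

lemma ultraDown_lt_one (hν : -1 / 2 ≤ ν) (k : ℕ) : ultraDown ν k < 1 := by
  rcases k with _ | k
  · simp [ultraDown]
  · have hk : 0 < 2 * ((k + 1 : ℕ) : ℝ) + 2 * ν + 1 := by
      push_cast
      linarith [k.cast_nonneg (α := ℝ)]
    rw [ultraDown, div_lt_one hk]
    push_cast
    linarith [k.cast_nonneg (α := ℝ)]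

lemma ultraspherical_threeTerm (hν : -1 / 2 ≤ ν) :
    ThreeTerm (jacobi ν ν) (fun k => 1 - ultraDown ν k) 0 (ultraDown ν) (ultraWeight ν) where
  zero := jacobi_zero ν ν
  up_pos k := sub_pos.mpr (ultraDown_lt_one hν k)
  down_zero := ultraDown_zero ν
  weight_pos k := Finset.prod_pos fun i _ =>
    div_pos (sub_pos.mpr (ultraDown_lt_one hν i)) (ultraDown_succ_pos hν i)
  symm k := by
    rw [ultraWeight, ultraWeight, Finset.prod_range_succ, mul_assoc,
      div_mul_cancel₀ _ (ultraDown_succ_pos hν k).ne']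
  recurrence k := Polynomial.funext fun t => by
    simp only [eval_add, eval_mul, eval_X, eval_C, Pi.zero_apply, zero_mul, add_zero, ultraDown]
    rcases k with _ | k
    · have h := jacobi_raise_right_eval (by linarith : -1 < ν) ν 0 t
      simp only [jacobi_zero, Nat.cast_zero, zero_add, mul_zero, zero_mul, add_zero, zero_div,
        sub_zero, one_mul, mul_one, eval_one] at h ⊢
      refine mul_left_cancel₀ (by linarith : 2 * (1 + ν) ≠ 0) ?_
      linear_combination h
    · have h := jacobi_recurrence_eval (by linarith : -1 < ν) ν (k + 1) t
      generalize hK : ((k + 1 : ℕ) : ℝ) = K at h ⊢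
      have hk : 1 ≤ K := by
        rw [← hK]
        push_cast
        linarith [k.cast_nonneg (α := ℝ)]
      have hk₁ : 2 * K + 2 * ν + 1 ≠ 0 := by linarith
      have hk₂ : 0 < (2 * K + 2 * ν) * (2 * K + 2 * ν + 2) := mul_pos (by linarith) (by linarith)
      rw [one_sub_div hk₁, div_mul_eq_mul_div, div_mul_eq_mul_div, ← add_div, eq_div_iff hk₁]
      refine mul_left_cancel₀ hk₂.ne' ?_
      linear_combination h

end Ultraspherical

lemma ThreeTerm.eval_neg {p : ℕ → ℝ[X]} {u d r : ℕ → ℝ} (h : ThreeTerm p u 0 d r) (k : ℕ)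
    (t : ℝ) : (p k).eval (-t) = (-1) ^ k * (p k).eval t := by
  induction k using Nat.strong_induction_on with
  | _ k ih =>
    rcases k with _ | k
    · simp [h.zero]
    have hpos := h.recurrence_eval t k
    have hneg := h.recurrence_eval (-t) k
    refine mul_left_cancel₀ (h.up_pos k).ne' ?_
    rw [ih k k.lt_succ_self] at hneg
    rcases k with _ | k
    · simp only [h.down_zero, Pi.zero_apply, zero_mul, add_zero, zero_add, pow_zero,
        pow_one] at hpos hneg ⊢
      linear_combination -hpos - hneg
    · rw [Nat.add_sub_cancel, ih k (by omega)] at hneg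
      simp only [Nat.add_sub_cancel, Pi.zero_apply, zero_mul, add_zero, pow_succ] at hpos hneg ⊢
      linear_combination (-1) ^ k * hpos - hneg

end Recurrences

section Signs

/-! ### Signs of the adjacent polynomials -/

lemma jacobi_succ_succ_sign {ν : ℝ} (hν : -3 / 2 ≤ ν) (k : ℕ) {t : ℝ} (ht : t ≤ -1) :
    0 < (-1) ^ k * (jacobi (ν + 1) (ν + 1) k).eval t := by
  rw [← (ultraspherical_threeTerm (by linarith)).eval_neg]
  exact jacobi_pos_of_one_le (by linarith) (by linarith) k (by linarith)

lemma jacobi_succ_self_sign {ν : ℝ} (hν : -1 < ν) (k : ℕ) {t : ℝ} (ht : t ≤ -1) :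
    0 < (-1) ^ k * (jacobi (ν + 1) ν k).eval t := by
  induction k with
  | zero => simp [jacobi_zero]
  | succ k ih =>
    have := k.cast_nonneg (α := ℝ)
    have hraise := jacobi_raise_right_eval (by linarith : -1 < ν + 1) ν k t
    have hJ := jacobi_succ_succ_sign (ν := ν) (by linarith) k ht
    refine pos_of_mul_pos_right (a := 2 * ((k : ℝ) + 1 + (ν + 1))) ?_ (by linarith)
    calc (0 : ℝ) < (2 * k + (ν + 1) + ν + 2) * (-t - 1) *
          ((-1) ^ k * (jacobi (ν + 1) (ν + 1) k).eval t) +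
        2 * (k + ν + 1) * ((-1) ^ k * (jacobi (ν + 1) ν k).eval t) :=
          add_pos_of_nonneg_of_pos
            (mul_nonneg (mul_nonneg (by linarith) (by linarith)) hJ.le)
            (mul_pos (by linarith) ih)
      _ = 2 * (k + 1 + (ν + 1)) * ((-1) ^ (k + 1) * (jacobi (ν + 1) ν (k + 1)).eval t) := by
          rw [pow_succ]
          linear_combination -(-1) ^ k * hraise

lemma jacobi_succ_self_pos {ν : ℝ} (hν : -1 < ν) {s : ℝ} (k : ℕ)
    (h : ∀ t > s, 0 < (jacobi (ν + 1) (ν + 1) k).eval t) :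
    ∀ t ≥ s, 0 < (jacobi (ν + 1) ν k).eval t := by
  intro t ht
  rcases k with _ | k
  · simp [jacobi_zero]
  have := k.cast_nonneg (α := ℝ)
  have hnonneg := eval_nonneg_of_forall_gt_pos h
  have hpos := (jacobi_threeTerm (by linarith) (by linarith) (by linarith)).pos_of_succ_nonneg
    k hnonneg t ht
  have hlower := jacobi_lower_right_eval (ν + 1) ν (k + 1) t
  rw [Nat.add_sub_cancel] at hlower
  push_cast at hlower
  refine pos_of_mul_pos_right (a := 2 * ((k : ℝ) + 1) + (ν + 1) + ν + 1) ?_ (by linarith)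
  rw [hlower]
  exact add_pos_of_nonneg_of_pos (mul_nonneg (by linarith) (hnonneg t ht))
    (mul_pos (by linarith) hpos)

lemma jacobi_succ_succ_pos {ν : ℝ} (hν : -1 < ν) {s : ℝ} (hs : -1 ≤ s) (k : ℕ)
    (h : ∀ t > s, 0 < (jacobi (ν + 1) ν (k + 1)).eval t) :
    -1 < s ∧ ∀ t ≥ s, 0 < (jacobi (ν + 1) (ν + 1) k).eval t := by
  have := k.cast_nonneg (α := ℝ)
  have hnonneg := eval_nonneg_of_forall_gt_pos h
  have key : ∀ t ≥ s, 0 < (t + 1) * (jacobi (ν + 1) (ν + 1) k).eval t := by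
    intro t ht
    have hpos := (jacobi_threeTerm (by linarith) hν (by linarith)).pos_of_succ_nonneg
      k hnonneg t ht
    refine pos_of_mul_pos_right (a := 2 * (k : ℝ) + (ν + 1) + ν + 2) ?_ (by linarith)
    rw [jacobi_raise_right_eval (by linarith)]
    exact add_pos_of_nonneg_of_pos (mul_nonneg (by linarith) (hnonneg t ht))
      (mul_pos (by linarith) hpos)
  have hs' : s ≠ -1 := by
    rintro rfl
    simpa using key (-1) le_rfl
  exact ⟨hs.lt_of_ne' hs', fun t ht => pos_of_mul_pos_right (key t ht) (by linarith)⟩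

/-- The parameter `(n - 3) / 2` of the Gegenbauer polynomials in dimension `n`. -/
def gegParam (n : ℕ) : ℝ := ((n : ℝ) - 3) / 2

lemma gegParam_ge {n : ℕ} (hn : 2 ≤ n) : -1 / 2 ≤ gegParam n := by
  have : (2 : ℝ) ≤ n := by exact_mod_cast hn
  unfold gegParam
  linarith

lemma adjacent_eq (n a b k : ℕ) :
    adjacent n a b k = jacobi (gegParam n + a) (gegParam n + b) k := by
  rw [adjacent, gegParam, add_comm, add_comm (b : ℝ)]

lemma gegenbauer_eq (n k : ℕ) : gegenbauer n k = jacobi (gegParam n) (gegParam n) k := by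
  simp [gegenbauer, adjacent_eq]

lemma gegenbauer_threeTerm {n : ℕ} (hn : 2 ≤ n) :
    ThreeTerm (gegenbauer n) (fun k => 1 - ultraDown (gegParam n) k) 0 (ultraDown (gegParam n))
      (ultraWeight (gegParam n)) := by
  rw [funext (gegenbauer_eq n)]
  exact ultraspherical_threeTerm (gegParam_ge hn)

lemma adjacent_one_threeTerm {n : ℕ} (hn : 2 ≤ n) (b : ℕ) :
    ThreeTerm (adjacent n 1 b) (jacobiUp (gegParam n + 1) (gegParam n + b))
      (fun k => 1 - jacobiUp (gegParam n + 1) (gegParam n + b) k -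
        jacobiDown (gegParam n + 1) (gegParam n + b) k)
      (jacobiDown (gegParam n + 1) (gegParam n + b))
      (jacobiInvNormSq (gegParam n + 1) (gegParam n + b)) := by
  have hν := gegParam_ge hn
  have := b.cast_nonneg (α := ℝ)
  rw [funext (adjacent_eq n 1 b), Nat.cast_one]
  exact jacobi_threeTerm (by linarith) (by linarith) (by linarith)

lemma eval_pos_of_sSup_lt {p : ℝ[X]} (hp : 0 < p.leadingCoeff) {t : ℝ}
    (ht : sSup {x | p.IsRoot x} < t) : 0 < p.eval t := by
  by_contra hc
  obtain ⟨x, htx, hx, -⟩ := exists_root_forall_gt_pos hp (not_lt.mp hc)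
  have hfin := finite_setOfPred_isRoot (leadingCoeff_ne_zero.mp hp.ne')
  exact (le_csSup hfin.bddAbove hx).not_gt (ht.trans_le htx)

lemma adjacent_pos_of_largestZero_le {n b k : ℕ} (hn : 2 ≤ n) {s : ℝ}
    (hs : largestZero n 1 b k ≤ s) : ∀ t > s, 0 < (adjacent n 1 b k).eval t := by
  intro t ht
  have h := adjacent_one_threeTerm hn b
  rcases eq_or_ne k 0 with rfl | hk
  · simp [h.zero]
  · rw [largestZero, if_neg hk] at hs
    exact eval_pos_of_sSup_lt (h.leadingCoeff_pos k) (hs.trans_lt ht)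

lemma isRoot_largestZero {n b k : ℕ} (hn : 2 ≤ n) :
    (adjacent n 1 b (k + 1)).IsRoot (largestZero n 1 b (k + 1)) := by
  have h := adjacent_one_threeTerm hn b
  rw [largestZero, if_neg k.succ_ne_zero]
  exact Set.Nonempty.csSup_mem (h.exists_isRoot k) (finite_setOfPred_isRoot (h.ne_zero _))

variable {n ε k : ℕ} {s : ℝ}

lemma adjacent_one_sign (hn : 2 ≤ n) (hε : ε ≤ 1) (k : ℕ) {t : ℝ} (ht : t ≤ -1) :
    0 < (-1) ^ k * (adjacent n 1 ε k).eval t := by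
  have hν := gegParam_ge hn
  rw [adjacent_eq]
  interval_cases ε
  · simpa using jacobi_succ_self_sign (by linarith) k ht
  · simpa using jacobi_succ_succ_sign (by linarith) k ht

lemma adjacent_pos_of_mem (hn : 2 ≤ n) (hε : ε ≤ 1) (hs : -1 ≤ s)
    (hl : largestZero n 1 (1 - ε) (k + ε) ≤ s) :
    (∀ t ≥ s, 0 < (adjacent n 1 ε k).eval t) ∧ (ε = 1 → -1 < s) := by
  have hν := gegParam_ge hn
  have h := adjacent_pos_of_largestZero_le hn hl
  interval_cases ε
  · simp only [adjacent_eq, Nat.sub_zero, Nat.cast_one, Nat.cast_zero, add_zero] at h ⊢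
    exact ⟨jacobi_succ_self_pos (by linarith) k h, by simp⟩
  · simp only [adjacent_eq, Nat.sub_self, Nat.cast_one, Nat.cast_zero, add_zero] at h ⊢
    exact (jacobi_succ_succ_pos (by linarith) hs k h).symm.imp_right fun h _ => h

lemma adjacent_succ_nonpos (hn : 2 ≤ n) (hpos : ∀ t ≥ s, 0 < (adjacent n 1 ε k).eval t)
    (hu : s ≤ largestZero n 1 ε (k + 1)) : (adjacent n 1 ε (k + 1)).eval s ≤ 0 :=
  (adjacent_one_threeTerm hn ε).succ_eval_nonpos hpos (isRoot_largestZero hn) hu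

end Signs

/-! ### The zeros of the Levenshtein kernel -/

section LevenshteinKernel

variable {n ε k : ℕ} {s t : ℝ}

lemma levenshteinKernel_eq (n ε k : ℕ) (s : ℝ) :
    levenshteinKernel n ε k s =
      cdKernel (adjacent n 1 ε) (jacobiInvNormSq (gegParam n + 1) (gegParam n + ε)) k s := by
  rw [levenshteinKernel, cdKernel, gegParam, add_comm 1, add_comm (ε : ℝ)]

lemma levenshteinKernel_eval_pos (hn : 2 ≤ n) (hε : ε ≤ 1) (hs : -1 ≤ s)
    (hl : largestZero n 1 (1 - ε) (k + ε) ≤ s) (hst : s ≤ t) :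
    0 < (levenshteinKernel n ε (k + 1) s).eval t := by
  rw [levenshteinKernel_eq]
  exact (adjacent_one_threeTerm hn ε).cdKernel_eval_pos (adjacent_pos_of_mem hn hε hs hl).1 hst

lemma levenshteinKernel_splits (hn : 2 ≤ n) (hk : (adjacent n 1 ε k).eval s ≠ 0) :
    (levenshteinKernel n ε (k + 1) s).Splits := by
  rw [levenshteinKernel_eq]
  exact (adjacent_one_threeTerm hn ε).cdKernel_splits hk

lemma natDegree_levenshteinKernel (hn : 2 ≤ n) (hk : (adjacent n 1 ε k).eval s ≠ 0) :
    (levenshteinKernel n ε (k + 1) s).natDegree = k := by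
  rw [levenshteinKernel_eq]
  exact (adjacent_one_threeTerm hn ε).natDegree_cdKernel hk

lemma levenshteinKernel_ne_zero (hn : 2 ≤ n) (ε k : ℕ) (s : ℝ) :
    levenshteinKernel n ε (k + 1) s ≠ 0 := by
  rw [levenshteinKernel_eq]
  exact (adjacent_one_threeTerm hn ε).cdKernel_ne_zero k s

-- The pencil of `P_{k+1}^{1,0}` and `P_k^{1,0}` that is a multiple of `(t + 1) P_k^{1,1}` changes
-- sign between `s` and `t`, unlike `P_k^{1,0}` up to the factor `(-1)^k`.
lemma levenshteinKernel_zero_eval_ne_zero (hn : 2 ≤ n) (hs : -1 ≤ s)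
    (hl : largestZero n 1 1 k ≤ s) (ht : t ≤ -1)
    (hne : t < -1 ∨ (adjacent n 1 1 k).eval s ≠ 0) :
    (levenshteinKernel n 0 (k + 1) s).eval t ≠ 0 := by
  intro h0
  have hν := gegParam_ge hn
  have hst : t < s := not_le.mp fun hst =>
    (levenshteinKernel_eval_pos hn zero_le_one hs hl hst).ne' h0
  have hpos := (adjacent_pos_of_mem hn zero_le_one hs hl).1 s le_rfl
  have hnonneg := eval_nonneg_of_forall_gt_pos (adjacent_pos_of_largestZero_le hn hl) s le_rfl
  have hJ := adjacent_one_sign hn le_rfl k ht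
  have hraise : ∀ x, (2 * (k : ℝ) + (gegParam n + 1) + gegParam n + 2) *
      ((x + 1) * (adjacent n 1 1 k).eval x) =
      2 * (k + 1 + (gegParam n + 1)) * (adjacent n 1 0 (k + 1)).eval x +
        2 * (k + gegParam n + 1) * (adjacent n 1 0 k).eval x := fun x => by
    simpa [adjacent_eq] using
      jacobi_raise_right_eval (α := gegParam n + 1) (by linarith) (gegParam n) k x
  have hc : 0 < 2 * (k : ℝ) + (gegParam n + 1) + gegParam n + 2 := by
    linarith [k.cast_nonneg (α := ℝ)]
  rw [levenshteinKernel_eq] at h0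
  obtain ⟨hws, hwt⟩ := (adjacent_one_threeTerm hn 0).pencil_eq_zero_of_cdKernel_eval_eq_zero h0
    hpos (adjacent_one_sign hn zero_le_one k ht) (a := 2 * (k + 1 + (gegParam n + 1)))
    (b := 2 * (k + gegParam n + 1))
    (by rw [← hraise]; exact mul_nonneg hc.le (mul_nonneg (by linarith) hnonneg))
    (by
      rw [← hraise, mul_left_comm]
      refine mul_nonpos_of_nonneg_of_nonpos hc.le ?_
      rw [mul_left_comm]
      exact mul_nonpos_of_nonpos_of_nonneg (by linarith) hJ.le)
  rw [← hraise] at hws hwt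
  rcases ht.lt_or_eq with hlt | heq
  · exact mul_ne_zero hc.ne' (mul_ne_zero (by linarith) (right_ne_zero_of_mul hJ.ne')) hwt
  · exact mul_ne_zero hc.ne' (mul_ne_zero (by linarith) (hne.resolve_left heq.not_lt)) hws

-- As before, with the pencil of `P_{k+1}^{1,1}` and `P_k^{1,1}` that is a multiple of
-- `P_{k+1}^{1,0}`.
lemma levenshteinKernel_one_eval_ne_zero (hn : 2 ≤ n) (hs : -1 ≤ s)
    (hl : largestZero n 1 0 (k + 1) ≤ s) (ht : t ≤ -1) :
    (levenshteinKernel n 1 (k + 1) s).eval t ≠ 0 := by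
  intro h0
  have hν := gegParam_ge hn
  have hpos := (adjacent_pos_of_mem hn le_rfl hs hl).1 s le_rfl
  have hnonneg := eval_nonneg_of_forall_gt_pos (adjacent_pos_of_largestZero_le hn hl) s le_rfl
  have hJ := adjacent_one_sign hn zero_le_one (k + 1) ht
  have hlower : ∀ x, (2 * ((k : ℝ) + 1) + (gegParam n + 1) + gegParam n + 1) *
      (adjacent n 1 0 (k + 1)).eval x =
      (k + 1 + (gegParam n + 1) + gegParam n + 1) * (adjacent n 1 1 (k + 1)).eval x +
        (k + 1) * (adjacent n 1 1 k).eval x := fun x => by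
    simpa [adjacent_eq] using jacobi_lower_right_eval (gegParam n + 1) (gegParam n) (k + 1) x
  have hc : 0 < 2 * ((k : ℝ) + 1) + (gegParam n + 1) + gegParam n + 1 := by
    linarith [k.cast_nonneg (α := ℝ)]
  rw [levenshteinKernel_eq] at h0
  obtain ⟨-, hwt⟩ := (adjacent_one_threeTerm hn 1).pencil_eq_zero_of_cdKernel_eval_eq_zero h0
    hpos (adjacent_one_sign hn le_rfl k ht) (a := k + 1 + (gegParam n + 1) + gegParam n + 1)
    (b := k + 1)
    (by rw [← hlower]; exact mul_nonneg hc.le hnonneg)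
    (by
      rw [← hlower, mul_left_comm]
      refine mul_nonpos_of_nonneg_of_nonpos hc.le ?_
      rw [pow_succ] at hJ
      linarith)
  rw [← hlower] at hwt
  exact mul_ne_zero hc.ne' (right_ne_zero_of_mul hJ.ne') hwt

lemma mem_Ico_of_mem_roots_levenshteinKernel (hn : 2 ≤ n) (hε : ε ≤ 1) (hs : -1 ≤ s)
    (hl : largestZero n 1 (1 - ε) (k + ε) ≤ s)
    (ht : t ∈ (levenshteinKernel n ε (k + 1) s).roots) : t ∈ Set.Ico (-1) s := by
  have h0 := isRoot_of_mem_roots ht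
  refine ⟨not_lt.mp fun hlt => ?_, not_le.mp fun hst =>
    (levenshteinKernel_eval_pos hn hε hs hl hst).ne' h0⟩
  interval_cases ε
  · exact levenshteinKernel_zero_eval_ne_zero hn hs hl hlt.le (Or.inl hlt) h0
  · exact levenshteinKernel_one_eval_ne_zero hn hs hl hlt.le h0

end LevenshteinKernel

/-! ### Gegenbauer coefficients -/

section GegenbauerCoeff

variable {n : ℕ} (hn : 2 ≤ n)

include hn

lemma gegenbauerCoeff_add (p q : ℝ[X]) (i : ℕ) :
    gegenbauerCoeff hn (p + q) i = gegenbauerCoeff hn p i + gegenbauerCoeff hn q i :=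
  map_add ((gegenbauerBasis hn).coord i) p q

lemma gegenbauerCoeff_sub (p q : ℝ[X]) (i : ℕ) :
    gegenbauerCoeff hn (p - q) i = gegenbauerCoeff hn p i - gegenbauerCoeff hn q i :=
  map_sub ((gegenbauerBasis hn).coord i) p q

lemma gegenbauerCoeff_C_mul (c : ℝ) (p : ℝ[X]) (i : ℕ) :
    gegenbauerCoeff hn (C c * p) i = c * gegenbauerCoeff hn p i := by
  rw [← smul_eq_C_mul]
  exact map_smul ((gegenbauerBasis hn).coord i) c p

lemma gegenbauerCoeff_sum {ι : Type*} (S : Finset ι) (p : ι → ℝ[X]) (i : ℕ) :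
    gegenbauerCoeff hn (∑ j ∈ S, p j) i = ∑ j ∈ S, gegenbauerCoeff hn (p j) i :=
  map_sum ((gegenbauerBasis hn).coord i) p S

lemma gegenbauerCoeff_gegenbauer (i j : ℕ) :
    gegenbauerCoeff hn (gegenbauer n j) i = if j = i then 1 else 0 := by
  rw [gegenbauerCoeff, ← gegenbauerBasis_apply hn, Module.Basis.repr_self, Finsupp.single_apply]

lemma gegenbauerCoeff_one : gegenbauerCoeff hn 1 0 = 1 := by
  have h := gegenbauerCoeff_gegenbauer hn 0 0
  rwa [gegenbauer_eq, jacobi_zero, if_pos rfl] at h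

lemma gegenbauerCoeff_X_pow_succ_mul (d i j : ℕ) :
    gegenbauerCoeff hn (X ^ (d + 1) * gegenbauer n j) i =
      (1 - ultraDown (gegParam n) j) * gegenbauerCoeff hn (X ^ d * gegenbauer n (j + 1)) i +
        ultraDown (gegParam n) j * gegenbauerCoeff hn (X ^ d * gegenbauer n (j - 1)) i := by
  rw [pow_succ, mul_assoc, (gegenbauer_threeTerm hn).recurrence j, ← gegenbauerCoeff_C_mul,
    ← gegenbauerCoeff_C_mul, ← gegenbauerCoeff_add, Pi.zero_apply, C_0]
  exact congrArg (gegenbauerCoeff hn · i) (by ring)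

lemma gegenbauerCoeff_X_pow_mul_eq_zero {d i j : ℕ} (h : i + d < j ∨ j + d < i) :
    gegenbauerCoeff hn (X ^ d * gegenbauer n j) i = 0 := by
  induction d generalizing j with
  | zero => rw [pow_zero, one_mul, gegenbauerCoeff_gegenbauer, if_neg (by omega)]
  | succ d ih =>
    rw [gegenbauerCoeff_X_pow_succ_mul, ih (by omega), ih (by omega), mul_zero, mul_zero, add_zero]

lemma gegenbauerCoeff_zero_mul_gegenbauer {q : ℝ[X]} {j : ℕ} (hq : q.degree < j) :
    gegenbauerCoeff hn (q * gegenbauer n j) 0 = 0 := by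
  rw [q.as_sum_range_C_mul_X_pow, Finset.sum_mul, gegenbauerCoeff_sum]
  refine Finset.sum_eq_zero fun d hd => ?_
  rcases eq_or_ne q 0 with rfl | hq0
  · rw [coeff_zero, mul_assoc, gegenbauerCoeff_C_mul, zero_mul]
  have hdj : d < j :=
    (Nat.lt_succ_iff.mp (Finset.mem_range.mp hd)).trans_lt
      ((natDegree_lt_iff_degree_lt hq0).mpr hq)
  rw [mul_assoc, gegenbauerCoeff_C_mul, gegenbauerCoeff_X_pow_mul_eq_zero hn (by omega), mul_zero]

end GegenbauerCoeff

section AdjacentMean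

/-! ### Means of the adjacent polynomials -/

variable {n ε : ℕ}

lemma X_add_one_pow_mul_adjacent_zero (hn : 2 ≤ n) (hε : ε ≤ 1) (j : ℕ) :
    (X + 1) ^ ε * adjacent n 0 ε j = gegenbauer n (j + ε) + C (ε : ℝ) * gegenbauer n j := by
  have hν := gegParam_ge hn
  refine Polynomial.funext fun t => ?_
  simp only [adjacent_eq, gegenbauer_eq, eval_add, eval_mul, eval_pow, eval_X, eval_one, eval_C]
  interval_cases ε
  · simp
  · have h := jacobi_raise_right_eval (by linarith : -1 < gegParam n) (gegParam n) j t
    have hj : 2 * (j : ℝ) + gegParam n + gegParam n + 2 ≠ 0 := by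
      linarith [j.cast_nonneg (α := ℝ)]
    simp only [Nat.cast_zero, Nat.cast_one, add_zero, pow_one, one_mul]
    refine mul_left_cancel₀ hj ?_
    linear_combination h

lemma one_sub_mul_adjacent_one (hn : 2 ≤ n) (b j : ℕ) :
    ∃ c : ℝ, (1 - X) * adjacent n 1 b j = C c * (adjacent n 0 b j - adjacent n 0 b (j + 1)) := by
  have hν := gegParam_ge hn
  have hj : 2 * (j : ℝ) + gegParam n + (gegParam n + b) + 2 ≠ 0 := by
    linarith [j.cast_nonneg (α := ℝ), b.cast_nonneg (α := ℝ)]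
  refine ⟨2 * (gegParam n + 1) / (2 * j + gegParam n + (gegParam n + b) + 2),
    Polynomial.funext fun t => ?_⟩
  have h := jacobi_raise_left_eval (by linarith : -1 < gegParam n) (gegParam n + b) j t
  simp only [adjacent_eq, eval_mul, eval_sub, eval_one, eval_X, eval_C, Nat.cast_zero,
    Nat.cast_one, add_zero]
  rw [div_mul_eq_mul_div, eq_div_iff hj]
  linear_combination h

lemma gegenbauerCoeff_zero_mul_adjacent (hn : 2 ≤ n) (hε : ε ≤ 1) {q : ℝ[X]} {j : ℕ}
    (hq : q.degree < j) :
    gegenbauerCoeff hn (q * ((1 - X) * ((X + 1) ^ ε * adjacent n 1 ε j))) 0 = 0 := by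
  obtain ⟨c, hc⟩ := one_sub_mul_adjacent_one hn ε j
  have hweight : (1 - X) * ((X + 1) ^ ε * adjacent n 1 ε j) =
      C c * (gegenbauer n (j + ε) + C (ε : ℝ) * gegenbauer n j -
        (gegenbauer n (j + 1 + ε) + C (ε : ℝ) * gegenbauer n (j + 1))) := by
    rw [← X_add_one_pow_mul_adjacent_zero hn hε, ← X_add_one_pow_mul_adjacent_zero hn hε,
      ← mul_sub, mul_left_comm, hc, mul_left_comm]
  have horth : ∀ i ≥ j, gegenbauerCoeff hn (q * gegenbauer n i) 0 = 0 := fun i hi =>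
    gegenbauerCoeff_zero_mul_gegenbauer hn (hq.trans_le (Nat.cast_le.mpr hi))
  rw [hweight, mul_left_comm, gegenbauerCoeff_C_mul, mul_sub, mul_add, mul_add, mul_left_comm,
    mul_left_comm q, gegenbauerCoeff_sub, gegenbauerCoeff_add, gegenbauerCoeff_add,
    gegenbauerCoeff_C_mul, gegenbauerCoeff_C_mul, horth _ (by omega), horth _ (by omega),
    horth _ (by omega), horth _ (by omega)]
  ring

/-- The mean of `(1 + t)^ε P_j^{1,ε}(t)` with respect to the orthogonality measure of the
Gegenbauer polynomials, that is, its zeroth Gegenbauer coefficient. -/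
def adjacentMean (hn : 2 ≤ n) (ε j : ℕ) : ℝ :=
  gegenbauerCoeff hn ((X + 1) ^ ε * adjacent n 1 ε j) 0

/-- Up to a factor, the coefficient of `P_{k+1}^{1,ε}` in the expansion of `P_{k+1}^{0,ε}`. -/
def lowerUp (n ε k : ℕ) : ℝ := (k + 2 * gegParam n + ε + 2) * (k + gegParam n + 2)

/-- Up to a factor, the coefficient of `-P_k^{1,ε}` in the expansion of `P_{k+1}^{0,ε}`. -/
def lowerDown (n ε k : ℕ) : ℝ := (k + gegParam n + ε + 1) * (k + 1)

lemma lowerDown_pos (hn : 2 ≤ n) (ε k : ℕ) : 0 < lowerDown n ε k := by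
  have hν := gegParam_ge hn
  have := k.cast_nonneg (α := ℝ)
  have := ε.cast_nonneg (α := ℝ)
  exact mul_pos (by linarith) (by linarith)

lemma lowerDown_lt_lowerUp (hn : 2 ≤ n) (ε k : ℕ) : lowerDown n ε k < lowerUp n ε k := by
  have hν := gegParam_ge hn
  have := k.cast_nonneg (α := ℝ)
  have := ε.cast_nonneg (α := ℝ)
  exact mul_lt_mul'' (by linarith) (by linarith) (by linarith) (by linarith)

lemma adjacent_zero_succ_eval (hn : 2 ≤ n) (ε k : ℕ) (t : ℝ) :
    (lowerUp n ε k - lowerDown n ε k) * (adjacent n 0 ε (k + 1)).eval t =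
      lowerUp n ε k * (adjacent n 1 ε (k + 1)).eval t -
        lowerDown n ε k * (adjacent n 1 ε k).eval t := by
  have hν := gegParam_ge hn
  have h := jacobi_lower_left_eval (by linarith : -1 < gegParam n) (gegParam n + ε) (k + 1) t
  simp only [lowerUp, lowerDown, adjacent_eq, Nat.cast_zero, Nat.cast_one, add_zero,
    Nat.add_sub_cancel] at h ⊢
  push_cast at h
  linear_combination h

lemma adjacent_zero_succ_eval_neg (hn : 2 ≤ n) {k : ℕ} {s : ℝ}
    (hpos : 0 < (adjacent n 1 ε k).eval s) (hnp : (adjacent n 1 ε (k + 1)).eval s ≤ 0) :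
    (adjacent n 0 ε (k + 1)).eval s < 0 := by
  have hlt := lowerDown_lt_lowerUp hn ε k
  have hdown := lowerDown_pos hn ε k
  refine neg_of_mul_neg_right ?_ (sub_pos.mpr hlt).le
  rw [adjacent_zero_succ_eval hn]
  exact sub_neg.mpr ((mul_nonpos_of_nonneg_of_nonpos (hdown.trans hlt).le hnp).trans_lt
    (mul_pos hdown hpos))

-- `(1 + t)^ε P_{k+1}^{0,ε}(t)` is a combination of nonconstant Gegenbauer polynomials.
lemma lowerUp_mul_adjacentMean_succ (hn : 2 ≤ n) (hε : ε ≤ 1) (k : ℕ) :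
    lowerUp n ε k * adjacentMean hn ε (k + 1) = lowerDown n ε k * adjacentMean hn ε k := by
  have hexp : C (lowerUp n ε k - lowerDown n ε k) * ((X + 1) ^ ε * adjacent n 0 ε (k + 1)) =
      C (lowerUp n ε k) * ((X + 1) ^ ε * adjacent n 1 ε (k + 1)) -
        C (lowerDown n ε k) * ((X + 1) ^ ε * adjacent n 1 ε k) := by
    refine Polynomial.funext fun t => ?_
    simp only [eval_mul, eval_C, eval_sub, eval_pow, eval_add, eval_X, eval_one]
    linear_combination (t + 1) ^ ε * adjacent_zero_succ_eval hn ε k t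
  have hmean := congrArg (gegenbauerCoeff hn · 0) hexp
  simp only [X_add_one_pow_mul_adjacent_zero hn hε, gegenbauerCoeff_add, gegenbauerCoeff_sub,
    gegenbauerCoeff_C_mul, gegenbauerCoeff_gegenbauer] at hmean
  rw [if_neg (by omega), if_neg (by omega)] at hmean
  simp only [adjacentMean]
  linear_combination -hmean

lemma adjacentMean_one_eq (hn : 2 ≤ n) (k : ℕ) :
    ((k : ℝ) + 1) * adjacentMean hn 1 k =
      2 * (k + 2 + gegParam n) * adjacentMean hn 0 (k + 1) := by
  have hν := gegParam_ge hn
  have hexp : C (2 * (k : ℝ) + 2 * gegParam n + 3) * ((X + 1) * adjacent n 1 1 k) =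
      C (2 * (k + 2 + gegParam n)) * adjacent n 1 0 (k + 1) +
        C (2 * (k + gegParam n + 1)) * adjacent n 1 0 k := by
    refine Polynomial.funext fun t => ?_
    have h := jacobi_raise_right_eval (by linarith : -1 < gegParam n + 1) (gegParam n) k t
    simp only [adjacent_eq, eval_mul, eval_C, eval_add, eval_X, eval_one, Nat.cast_one,
      Nat.cast_zero, add_zero]
    linear_combination h
  have hmean := congrArg (gegenbauerCoeff hn · 0) hexp
  have hsucc := lowerUp_mul_adjacentMean_succ hn zero_le_one k
  simp only [gegenbauerCoeff_add, gegenbauerCoeff_C_mul, lowerUp, lowerDown, adjacentMean,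
    pow_zero, one_mul, pow_one, Nat.cast_zero, add_zero] at hmean hsucc ⊢
  refine mul_left_cancel₀ (by linarith [k.cast_nonneg (α := ℝ)] :
    2 * (k : ℝ) + 2 * gegParam n + 3 ≠ 0) ?_
  linear_combination (k + 1 : ℝ) * hmean - 2 * hsucc

lemma adjacentMean_zero_mul_choose (n : ℕ) (hn : 2 ≤ n + 2) (j : ℕ) :
    adjacentMean hn 0 j * (((n + j).choose n : ℝ) * ((2 * j + n + 1) / (n + 1))) = 1 := by
  have hn' : (n : ℝ) + 1 ≠ 0 := by positivity
  induction j with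
  | zero =>
    simp [adjacentMean, adjacent_eq, jacobi_zero, gegenbauerCoeff_one, hn']
  | succ j ih =>
    have hsucc := lowerUp_mul_adjacentMean_succ hn zero_le_one j
    have hchoose : ((n + j).choose n : ℝ) * (n + j + 1) = (n + j + 1).choose n * (j + 1) := by
      have h := Nat.choose_mul_succ_eq (n + j) n
      rw [show n + j + 1 - n = j + 1 by omega] at h
      exact_mod_cast h
    have hj : (n + j + 1 : ℝ) * (j + 1) ≠ 0 := by positivity
    rw [← mul_div_assoc, ← mul_div_assoc, div_eq_one_iff_eq hn'] at ih ⊢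
    simp only [lowerUp, lowerDown, gegParam, ← add_assoc] at hsucc ⊢
    push_cast at hsucc ⊢
    refine mul_left_cancel₀ hj ?_
    linear_combination 2 * (n + j + 1).choose n * (j + 1) * hsucc -
      adjacentMean hn 0 j * (2 * j + n + 1) * (j + 1) * hchoose + (n + j + 1) * (j + 1) * ih

end AdjacentMean

/-! ### The value at one of the Levenshtein polynomial -/

section ValueAtOne

variable {n m ε k : ℕ} {s : ℝ}

lemma gegenbauer_sub_succ_eval (hn : 2 ≤ n) (j : ℕ) (s : ℝ) :
    (gegParam n + 1) * ((gegenbauer n j).eval s - (gegenbauer n (j + 1)).eval s) =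
      (j + gegParam n + 1) * ((1 - s) * (adjacent n 1 0 j).eval s) := by
  have hν := gegParam_ge hn
  have h := jacobi_raise_left_eval (by linarith : -1 < gegParam n) (gegParam n) j s
  simp only [adjacent_eq, gegenbauer_eq, Nat.cast_one, Nat.cast_zero, add_zero]
  linear_combination -h / 2

lemma adjacentMean_mul_levenshteinBound (hn : 2 ≤ n) (hm : halfIdx m = k + 1) (hs : s ≠ 1)
    (hs1 : (s + 1) ^ parity m ≠ 0) (hA : (adjacent n 0 (parity m) (k + 1)).eval s ≠ 0) :
    adjacentMean hn 0 (k + parity m) *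
        (levenshteinBound n m s * (adjacent n 0 (parity m) (k + 1)).eval s) =
      (adjacent n 0 (parity m) (k + 1)).eval s - (adjacent n 1 0 (k + parity m)).eval s := by
  obtain ⟨n, rfl⟩ := Nat.exists_eq_add_of_le' hn
  have hε := (halfIdx_parity m).2
  rw [levenshteinBound, hm]
  generalize parity m = ε at *
  have hB := adjacentMean_zero_mul_choose n hn (k + ε)
  have hnum := gegenbauer_sub_succ_eval hn (k + ε) s
  have hden := congrArg (eval s) (X_add_one_pow_mul_adjacent_zero hn hε (k + 1))
  have hn' : (n : ℝ) + 1 ≠ 0 := by positivity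
  have hs' : 1 - s ≠ 0 := sub_ne_zero.mpr hs.symm
  simp only [eval_mul, eval_pow, eval_add, eval_X, eval_one, eval_C] at hden
  rw [show k + 1 + (n + 2) - 3 + ε = n + (k + ε) by omega, show n + 2 - 2 = n by omega,
    show k + 1 - 1 + ε = k + ε by omega, show k + 1 + ε = k + ε + 1 by omega]
  rw [show k + 1 + ε = k + ε + 1 by omega] at hden
  simp only [gegParam] at hnum
  push_cast at hnum hB ⊢
  rw [show (n : ℝ) + 2 - 1 = n + 1 by ring, add_comm 1 s,
    add_comm (_ * _) (eval s (gegenbauer (n + 2) (k + ε + 1))), ← hden]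
  have hdiff : eval s (gegenbauer (n + 2) (k + ε)) - eval s (gegenbauer (n + 2) (k + ε + 1)) =
      (2 * (k + ε) + n + 1) / (n + 1) * ((1 - s) * eval s (adjacent (n + 2) 1 0 (k + ε))) := by
    rw [div_mul_eq_mul_div, eq_div_iff hn']
    linear_combination 2 * hnum
  rw [hdiff]
  field_simp at hB ⊢
  linear_combination ((adjacent (n + 2) 0 ε (k + 1)).eval s -
    (adjacent (n + 2) 1 0 (k + ε)).eval s) * hB

lemma lowerUp_mul_adjacent_sub_succ (hn : 2 ≤ n) (hε : ε ≤ 1) (k : ℕ) (s : ℝ) :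
    adjacentMean hn 0 (k + ε) * 2 ^ ε * (lowerUp n ε k *
        ((adjacent n 1 ε k).eval s - (adjacent n 1 ε (k + 1)).eval s)) =
      adjacentMean hn ε k * ((lowerUp n ε k - lowerDown n ε k) *
        ((adjacent n 1 0 (k + ε)).eval s - (adjacent n 0 ε (k + 1)).eval s)) := by
  have hA := adjacent_zero_succ_eval hn ε k s
  interval_cases ε
  · simp only [add_zero, pow_zero, mul_one]
    linear_combination adjacentMean hn 0 k * hA
  · have hlower : (2 * ((k : ℝ) + 1) + (gegParam n + 1) + gegParam n + 1) *
        (adjacent n 1 0 (k + 1)).eval s =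
        (k + 1 + (gegParam n + 1) + gegParam n + 1) * (adjacent n 1 1 (k + 1)).eval s +
          (k + 1) * (adjacent n 1 1 k).eval s := by
      simpa [adjacent_eq] using jacobi_lower_right_eval (gegParam n + 1) (gegParam n) (k + 1) s
    have hμ := adjacentMean_one_eq hn k
    have hν := gegParam_ge hn
    have hw : 2 * ((k : ℝ) + 2 + gegParam n) ≠ 0 := by linarith [k.cast_nonneg (α := ℝ)]
    simp only [lowerUp, lowerDown, Nat.cast_one, pow_one] at hA ⊢
    refine mul_left_cancel₀ hw ?_
    linear_combination -2 * (k + 2 * gegParam n + 3) * (k + gegParam n + 2) *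
        ((adjacent n 1 1 k).eval s - (adjacent n 1 1 (k + 1)).eval s) * hμ -
      adjacentMean hn 1 k * (k + gegParam n + 2) * (2 * gegParam n + 2) * hlower +
      adjacentMean hn 1 k * (2 * (k + 2 + gegParam n)) * hA

lemma adjacentMean_zero_ne_zero (hn : 2 ≤ n) (j : ℕ) : adjacentMean hn 0 j ≠ 0 := by
  obtain ⟨n, rfl⟩ := Nat.exists_eq_add_of_le' hn
  exact left_ne_zero_of_mul_eq_one (adjacentMean_zero_mul_choose n hn j)

lemma pencil_adjacentMean_mul_levenshteinBound (hn : 2 ≤ n) (hm : halfIdx m = k + 1) (hs : s ≠ 1)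
    (hs1 : (s + 1) ^ parity m ≠ 0) (hA : (adjacent n 0 (parity m) (k + 1)).eval s ≠ 0) :
    ((adjacent n 1 (parity m) k).eval s * adjacentMean hn (parity m) (k + 1) -
        (adjacent n 1 (parity m) (k + 1)).eval s * adjacentMean hn (parity m) k) *
        levenshteinBound n m s =
      2 ^ parity m *
        ((adjacent n 1 (parity m) k).eval s - (adjacent n 1 (parity m) (k + 1)).eval s) := by
  have hε := (halfIdx_parity m).2
  have hL := adjacentMean_mul_levenshteinBound hn hm hs hs1 hA
  have hmean := lowerUp_mul_adjacentMean_succ hn hε k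
  have hsub := lowerUp_mul_adjacent_sub_succ hn hε k s
  have hlower := adjacent_zero_succ_eval hn (parity m) k s
  have hup := (lowerDown_pos hn (parity m) k).trans (lowerDown_lt_lowerUp hn (parity m) k)
  generalize parity m = ε at *
  refine mul_left_cancel₀ (mul_ne_zero hup.ne' (adjacentMean_zero_ne_zero hn (k + ε))) ?_
  linear_combination adjacentMean hn 0 (k + ε) * (adjacent n 1 ε k).eval s *
      levenshteinBound n m s * hmean - adjacentMean hn ε k *
      (lowerUp n ε k - lowerDown n ε k) * hL + adjacentMean hn 0 (k + ε) *
      adjacentMean hn ε k * levenshteinBound n m s * hlower - hsub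

lemma exists_X_sub_C_mul_levenshteinKernel (hn : 2 ≤ n) (ε k : ℕ) (s : ℝ) :
    ∃ c > 0, (X - C s) * levenshteinKernel n ε (k + 1) s =
      C (c * (adjacent n 1 ε k).eval s) * adjacent n 1 ε (k + 1) +
        C (-(c * (adjacent n 1 ε (k + 1)).eval s)) * adjacent n 1 ε k := by
  rw [levenshteinKernel_eq]
  have h := adjacent_one_threeTerm hn ε
  exact ⟨_, mul_pos (h.weight_pos k) (h.up_pos k), h.X_sub_C_mul_cdKernel k s⟩

lemma exists_levenshteinKernel_eq_eval_one_add (hn : 2 ≤ n) (hk : (adjacent n 1 ε k).eval s ≠ 0) :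
    ∃ q : ℝ[X], q.degree < k ∧ levenshteinKernel n ε (k + 1) s =
      C ((levenshteinKernel n ε (k + 1) s).eval 1) + q * (1 - X) := by
  set T := levenshteinKernel n ε (k + 1) s
  obtain ⟨q, hq⟩ : X - C 1 ∣ T - C (T.eval 1) := X_sub_C_dvd_sub_C_eval
  have hT : T = C (T.eval 1) + -q * (1 - X) := by
    rw [C_1] at hq
    linear_combination hq
  refine ⟨-q, ?_, hT⟩
  rcases eq_or_ne q 0 with rfl | hq0
  · rw [neg_zero, degree_zero]
    exact WithBot.bot_lt_coe k
  have hdeg : 1 + q.natDegree = k := by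
    rw [← natDegree_X_sub_C (1 : ℝ), ← natDegree_mul (X_sub_C_ne_zero 1) hq0, ← hq,
      natDegree_sub_C, natDegree_levenshteinKernel hn hk]
  rw [degree_neg]
  exact (natDegree_lt_iff_degree_lt hq0).mp (by omega)

lemma gegenbauerCoeff_zero_mul_levenshteinKernel_sq (hn : 2 ≤ n) (hε : ε ≤ 1)
    (hk : (adjacent n 1 ε k).eval s ≠ 0) {c : ℝ}
    (hc : (X - C s) * levenshteinKernel n ε (k + 1) s =
      C (c * (adjacent n 1 ε k).eval s) * adjacent n 1 ε (k + 1) +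
        C (-(c * (adjacent n 1 ε (k + 1)).eval s)) * adjacent n 1 ε k) :
    gegenbauerCoeff hn ((X - C s) * (X + 1) ^ ε * levenshteinKernel n ε (k + 1) s ^ 2) 0 =
      c * (levenshteinKernel n ε (k + 1) s).eval 1 *
        ((adjacent n 1 ε k).eval s * adjacentMean hn ε (k + 1) -
          (adjacent n 1 ε (k + 1)).eval s * adjacentMean hn ε k) := by
  obtain ⟨q, hq, hT⟩ := exists_levenshteinKernel_eq_eval_one_add hn hk
  set T := levenshteinKernel n ε (k + 1) s
  set a := c * (adjacent n 1 ε k).eval s with ha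
  set b := -(c * (adjacent n 1 ε (k + 1)).eval s) with hb
  have hsplit : (X - C s) * (X + 1) ^ ε * T ^ 2 =
      C (T.eval 1) * (C a * ((X + 1) ^ ε * adjacent n 1 ε (k + 1)) +
        C b * ((X + 1) ^ ε * adjacent n 1 ε k)) +
      (C a * (q * ((1 - X) * ((X + 1) ^ ε * adjacent n 1 ε (k + 1)))) +
        C b * (q * ((1 - X) * ((X + 1) ^ ε * adjacent n 1 ε k)))) := by
    linear_combination (X + 1) ^ ε * T * hc +
      (X + 1) ^ ε * (C a * adjacent n 1 ε (k + 1) + C b * adjacent n 1 ε k) * hT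
  have hq' : q.degree < (k + 1 : ℕ) := hq.trans (Nat.cast_lt.mpr k.lt_succ_self)
  rw [hsplit]
  simp only [gegenbauerCoeff_add, gegenbauerCoeff_C_mul, gegenbauerCoeff_zero_mul_adjacent hn hε hq,
    gegenbauerCoeff_zero_mul_adjacent hn hε hq', adjacentMean]
  rw [ha, hb]
  ring

lemma exists_halfIdx_eq_succ (hm : 1 ≤ m) : ∃ k, halfIdx m = k + 1 := by
  have := halfIdx_parity m
  exact Nat.exists_eq_succ_of_ne_zero (by omega)

lemma largestZero_le_of_mem (hk : halfIdx m = k + 1) (hsm : s ∈ levenshteinInterval n m) :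
    largestZero n 1 (1 - parity m) (k + parity m) ≤ s := by
  simpa [hk] using hsm.1

lemma adjacent_eval_pos_of_mem (hn : 2 ≤ n) (hk : halfIdx m = k + 1) (hs : -1 ≤ s)
    (hsm : s ∈ levenshteinInterval n m) : 0 < (adjacent n 1 (parity m) k).eval s :=
  (adjacent_pos_of_mem hn (halfIdx_parity m).2 hs (largestZero_le_of_mem hk hsm)).1 s le_rfl

lemma adjacent_zero_eval_neg_of_mem (hn : 2 ≤ n) (hk : halfIdx m = k + 1) (hs : -1 ≤ s)
    (hsm : s ∈ levenshteinInterval n m) : (adjacent n 0 (parity m) (k + 1)).eval s < 0 := by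
  have hpos :=
    (adjacent_pos_of_mem hn (halfIdx_parity m).2 hs (largestZero_le_of_mem hk hsm)).1
  exact adjacent_zero_succ_eval_neg hn (hpos s le_rfl)
    (adjacent_succ_nonpos hn hpos (hk ▸ hsm.2))

lemma add_one_pow_parity_pos (hn : 2 ≤ n) (hk : halfIdx m = k + 1) (hs : -1 ≤ s)
    (hsm : s ∈ levenshteinInterval n m) : 0 < (s + 1) ^ parity m := by
  have hε := (halfIdx_parity m).2
  have hlt := (adjacent_pos_of_mem hn hε hs (largestZero_le_of_mem hk hsm)).2
  rcases Nat.le_one_iff_eq_zero_or_eq_one.mp hε with h | h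
  · rw [h, pow_zero]
    exact one_pos
  · exact pow_pos (by linarith [hlt h]) _

lemma levenshteinPoly_eval_one (hn : 2 ≤ n) (hm : 1 ≤ m) (hs : s ∈ Set.Ico (-1) 1)
    (hsm : s ∈ levenshteinInterval n m) :
    (levenshteinPoly n m s).eval 1 =
      gegenbauerCoeff hn (levenshteinPoly n m s) 0 * levenshteinBound n m s := by
  obtain ⟨k, hk⟩ := exists_halfIdx_eq_succ hm
  obtain ⟨c, -, hc⟩ := exists_X_sub_C_mul_levenshteinKernel hn (parity m) k s
  have hbound := pencil_adjacentMean_mul_levenshteinBound hn hk hs.2.ne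
    (add_one_pow_parity_pos hn hk hs.1 hsm).ne' (adjacent_zero_eval_neg_of_mem hn hk hs.1 hsm).ne
  have hone := congrArg (eval 1) hc
  simp only [adjacent_eq, eval_mul, eval_sub, eval_add, eval_X, eval_C, jacobi_eval_one,
    mul_one] at hone
  simp only [← adjacent_eq] at hone
  rw [levenshteinPoly, hk, gegenbauerCoeff_zero_mul_levenshteinKernel_sq hn (halfIdx_parity m).2
    (adjacent_eval_pos_of_mem hn hk hs.1 hsm).ne' hc]
  simp only [eval_mul, eval_pow, eval_sub, eval_add, eval_X, eval_C, eval_one]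
  rw [one_add_one_eq_two]
  linear_combination 2 ^ parity m * (levenshteinKernel n (parity m) (k + 1) s).eval 1 * hone -
    c * (levenshteinKernel n (parity m) (k + 1) s).eval 1 * hbound

end ValueAtOne

/-! ### Nonnegativity of the linearization coefficients -/

section Linearization

/-- The sum of `(1 - d_{a+j} - d_j) v_{a+j,j}` over the first `m + 1` points of the diagonal through
`(a, 0)`. -/
def diagonalSum (d : ℕ → ℝ) (v : ℕ → ℕ → ℝ) (a m : ℕ) : ℝ :=
  ∑ j ∈ Finset.range (m + 1), (1 - d (a + j) - d j) * v (a + j) j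

/-- The sum of `(d_{a-j} - d_j) v_{a-j,j}` over the first `m + 1` points of the antidiagonal through
`(a, 0)`. It is only used for `m ≤ a`, so that the subtraction is not truncated. -/
def antidiagonalSum (d : ℕ → ℝ) (v : ℕ → ℕ → ℝ) (a m : ℕ) : ℝ :=
  ∑ j ∈ Finset.range (m + 1), (d (a - j) - d j) * v (a - j) j

lemma diagonalSum_succ (d : ℕ → ℝ) (v : ℕ → ℕ → ℝ) (a m : ℕ) :
    diagonalSum d v a (m + 1) =
      diagonalSum d v a m + (1 - d (a + m + 1) - d (m + 1)) * v (a + m + 1) (m + 1) :=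
  Finset.sum_range_succ _ _

lemma antidiagonalSum_succ (d : ℕ → ℝ) (v : ℕ → ℕ → ℝ) {a b m : ℕ} (h : b + (m + 1) = a) :
    antidiagonalSum d v a (m + 1) =
      antidiagonalSum d v a m + (d b - d (m + 1)) * v b (m + 1) := by
  rw [← h, antidiagonalSum, Finset.sum_range_succ, Nat.add_sub_cancel]
  rfl

variable {d : ℕ → ℝ} {v : ℕ → ℕ → ℝ}

-- The recurrence summed over the triangle below `(a + m + 1, m + 1)`: only the boundary survives.
lemma apex_eq_diagonalSum_add_antidiagonalSum (h0 : d 0 = 0)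
    (hv0 : ∀ a, d (a + 2) * v (a + 2) 0 + (1 - d a) * v a 0 = d 1 * v (a + 1) 1)
    (hv : ∀ a b, d (a + 2) * v (a + 2) (b + 1) + (1 - d a) * v a (b + 1) =
      d (b + 2) * v (a + 1) (b + 2) + (1 - d b) * v (a + 1) b) (m : ℕ) :
    (∀ a, d (m + 1) * v (a + m + 1) (m + 1) =
      diagonalSum d v a m + antidiagonalSum d v (a + 2 * m + 2) m) ∧
    ∀ a, (1 - d m) * v (a + m + 2) m =
      diagonalSum d v (a + 2) m + antidiagonalSum d v (a + 2 * m + 2) m := by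
  induction m with
  | zero =>
    simp only [diagonalSum, antidiagonalSum, zero_add, Finset.range_one, Finset.sum_singleton,
      add_zero, mul_zero, Nat.sub_zero, h0, sub_zero]
    exact ⟨fun a => by linarith [hv0 a], fun a => by ring⟩
  | succ m ih =>
    have hdiag : ∀ a, (1 - d (m + 1)) * v (a + (m + 1) + 2) (m + 1) =
        diagonalSum d v (a + 2) (m + 1) + antidiagonalSum d v (a + 2 * (m + 1) + 2) (m + 1) := by
      intro a
      have h := ih.1 (a + 2)
      rw [show a + 2 + 2 * m + 2 = a + 2 * (m + 1) + 2 by ring] at h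
      rw [diagonalSum_succ, antidiagonalSum_succ d v (b := a + 2 + m + 1) (by ring),
        show a + (m + 1) + 2 = a + 2 + m + 1 by ring]
      linear_combination h
    refine ⟨fun a => ?_, hdiag⟩
    have happ := ih.1 a
    have hdiag' := ih.2 a
    have happ' := ih.1 (a + 2)
    have hrec := hv (a + m + 1) m
    rw [show a + 2 + 2 * m + 2 = a + 2 * (m + 1) + 2 by ring,
      show a + 2 + m + 1 = a + m + 3 by ring] at happ'
    rw [diagonalSum_succ, antidiagonalSum_succ d v (b := a + m + 3) (by ring),
      show a + (m + 1) + 1 = a + m + 2 by ring]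
    linear_combination happ + happ' - hdiag' - hrec

lemma nonneg_of_hyperbolic (h0 : d 0 = 0) (hd : Monotone d) (hpos : ∀ i, 0 < d (i + 1))
    (hhalf : ∀ i, d i ≤ 1 / 2)
    (hv0 : ∀ a, d (a + 2) * v (a + 2) 0 + (1 - d a) * v a 0 = d 1 * v (a + 1) 1)
    (hv : ∀ a b, d (a + 2) * v (a + 2) (b + 1) + (1 - d a) * v a (b + 1) =
      d (b + 2) * v (a + 1) (b + 2) + (1 - d b) * v (a + 1) b)
    (hbd : ∀ a, 0 ≤ v a 0) {a b : ℕ} (hab : b ≤ a) : 0 ≤ v a b := by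
  induction b using Nat.strong_induction_on generalizing a with
  | _ b ih =>
    rcases b with _ | m
    · exact hbd a
    obtain ⟨c, rfl⟩ : ∃ c, a = c + m + 1 := ⟨a - m - 1, by omega⟩
    refine nonneg_of_mul_nonneg_right (?_ : 0 ≤ d (m + 1) * v (c + m + 1) (m + 1)) (hpos m)
    rw [(apex_eq_diagonalSum_add_antidiagonalSum h0 hv0 hv m).1]
    refine add_nonneg (Finset.sum_nonneg fun j hj => ?_) (Finset.sum_nonneg fun j hj => ?_)
    all_goals have hj' := Finset.mem_range.mp hj
    · exact mul_nonneg (by linarith [hhalf (c + j), hhalf j]) (ih j (by omega) (by omega))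
    · exact mul_nonneg (sub_nonneg.mpr (hd (by omega))) (ih j (by omega) (by omega))

variable {p : ℕ → ℝ[X]} {r : ℕ → ℝ}

namespace ThreeTerm

lemma map_mul_nonneg (h : ThreeTerm p (fun k => 1 - d k) 0 d r) (hd : Monotone d)
    (hhalf : ∀ i, d i ≤ 1 / 2) (φ : ℝ[X] →ₗ[ℝ] ℝ) (hφ : ∀ a, 0 ≤ φ (p a)) (a b : ℕ) :
    0 ≤ φ (p a * p b) := by
  wlog hab : b ≤ a generalizing a b
  · rw [mul_comm]
    exact this b a (not_le.mp hab).le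
  have hX : ∀ a q, φ (X * p a * q) = (1 - d a) * φ (p (a + 1) * q) + d a * φ (p (a - 1) * q) :=
    fun a q => by
    rw [h.recurrence, Pi.zero_apply, C_0, zero_mul, add_zero, add_mul, mul_assoc, mul_assoc,
      map_add, ← smul_eq_C_mul, ← smul_eq_C_mul, map_smul, map_smul, smul_eq_mul, smul_eq_mul]
  have hXX : ∀ a b, (1 - d a) * φ (p (a + 1) * p b) + d a * φ (p (a - 1) * p b) =
      (1 - d b) * φ (p a * p (b + 1)) + d b * φ (p a * p (b - 1)) := fun a b => by
    rw [← hX, mul_comm (p a), mul_comm (p a), ← hX]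
    exact congrArg φ (by ring)
  have hsymm := h.symm
  refine nonneg_of_mul_nonneg_right (nonneg_of_hyperbolic (d := d)
    (v := fun a b => r a * r b * φ (p a * p b)) h.down_zero hd h.down_succ_pos hhalf
    (fun a => ?_) (fun a b => ?_) (fun a => ?_) hab) (mul_pos (h.weight_pos a) (h.weight_pos b))
  · have hX0 := hXX (a + 1) 0
    have hsymm0 := h.symm 0
    simp only [h.down_zero, Nat.add_sub_cancel, zero_add, sub_zero, zero_mul, add_zero] at *
    linear_combination r (a + 1) * r 0 * hX0 - r 0 * φ (p (a + 2) * p 0) * hsymm (a + 1) +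
      r 0 * φ (p a * p 0) * hsymm a + r (a + 1) * φ (p (a + 1) * p 1) * hsymm0
  · have hX1 := hXX (a + 1) (b + 1)
    simp only [Nat.add_sub_cancel] at hX1
    linear_combination r (a + 1) * r (b + 1) * hX1 -
      r (b + 1) * φ (p (a + 2) * p (b + 1)) * hsymm (a + 1) +
      r (b + 1) * φ (p a * p (b + 1)) * hsymm a +
      r (a + 1) * φ (p (a + 1) * p (b + 2)) * hsymm (b + 1) -
      r (a + 1) * φ (p (a + 1) * p b) * hsymm b
  · rw [h.zero, mul_one]
    exact mul_nonneg (mul_pos (h.weight_pos a) (h.weight_pos 0)).le (hφ a)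

end ThreeTerm

lemma ultraDown_le_half {ν : ℝ} (hν : -1 / 2 ≤ ν) (k : ℕ) : ultraDown ν k ≤ 1 / 2 := by
  rcases k with _ | k
  · rw [ultraDown_zero]
    positivity
  have hk : 0 < 2 * ((k + 1 : ℕ) : ℝ) + 2 * ν + 1 := by
    push_cast
    linarith [k.cast_nonneg (α := ℝ)]
  rw [ultraDown, div_le_div_iff₀ hk two_pos]
  linarith

lemma ultraDown_monotone {ν : ℝ} (hν : -1 / 2 ≤ ν) : Monotone (ultraDown ν) := by
  refine monotone_nat_of_le_succ fun k => ?_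
  rcases k with _ | k
  · rw [ultraDown_zero]
    exact (ultraDown_succ_pos hν 0).le
  have := k.cast_nonneg (α := ℝ)
  unfold ultraDown
  push_cast
  rw [div_le_div_iff₀ (by linarith) (by linarith)]
  nlinarith

lemma gegenbauerCoeff_mul_gegenbauer_nonneg {n : ℕ} (hn : 2 ≤ n) (a b i : ℕ) :
    0 ≤ gegenbauerCoeff hn (gegenbauer n a * gegenbauer n b) i := by
  have hν := gegParam_ge hn
  refine (gegenbauer_threeTerm hn).map_mul_nonneg (ultraDown_monotone hν) (ultraDown_le_half hν)
    ((gegenbauerBasis hn).coord i) (fun a => ?_) a b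
  have h := gegenbauerCoeff_gegenbauer hn i a
  change 0 ≤ gegenbauerCoeff hn (gegenbauer n a) i
  rw [h]
  split_ifs
  exacts [zero_le_one, le_rfl]

end Linearization

/-! ### Positivity of the coefficients of the Levenshtein polynomial -/

section CoefficientPositivity

variable {n : ℕ}

lemma gegenbauerCoeff_eq_zero_of_natDegree_lt (hn : 2 ≤ n) {p : ℝ[X]} {i : ℕ}
    (h : p.natDegree < i) : gegenbauerCoeff hn p i = 0 := by
  rw [p.as_sum_range_C_mul_X_pow, gegenbauerCoeff_sum]
  refine Finset.sum_eq_zero fun d hd => ?_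
  have hd' := Finset.mem_range.mp hd
  have hzero := gegenbauerCoeff_X_pow_mul_eq_zero hn (d := d) (i := i) (j := 0) (Or.inr (by omega))
  rw [(gegenbauer_threeTerm hn).zero, mul_one] at hzero
  rw [gegenbauerCoeff_C_mul, hzero, mul_zero]

lemma eq_sum_gegenbauerCoeff_mul (hn : 2 ≤ n) {p : ℝ[X]} {d : ℕ} (h : p.natDegree < d) :
    p = ∑ i ∈ Finset.range d, C (gegenbauerCoeff hn p i) * gegenbauer n i := by
  have hrepr := (gegenbauerBasis hn).linearCombination_repr p
  rw [Finsupp.linearCombination_apply, Finsupp.sum_of_support_subset (s := Finset.range d)] at hrepr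
  · simp only [gegenbauerBasis_apply, smul_eq_C_mul] at hrepr
    exact hrepr.symm
  · refine fun i hi => Finset.mem_range.mpr (not_le.mp fun hdi => ?_)
    refine Finsupp.mem_support_iff.mp hi ?_
    exact gegenbauerCoeff_eq_zero_of_natDegree_lt hn (h.trans_le hdi)
  · simp

lemma gegenbauerCoeff_natDegree_pos (hn : 2 ≤ n) {p : ℝ[X]} (hp : 0 < p.leadingCoeff) :
    0 < gegenbauerCoeff hn p p.natDegree := by
  have hP := gegenbauer_threeTerm hn
  have hcoeff := congrArg (coeff · p.natDegree)
    (eq_sum_gegenbauerCoeff_mul hn p.natDegree.lt_succ_self)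
  simp only [finsetSum_coeff, coeff_C_mul] at hcoeff
  rw [Finset.sum_range_succ, Finset.sum_eq_zero, zero_add, coeff_natDegree] at hcoeff
  · exact pos_of_mul_pos_left (hcoeff ▸ hp) (hP.coeff_self_pos _).le
  · intro i hi
    rw [coeff_eq_zero_of_natDegree_lt, mul_zero]
    rw [hP.natDegree_eq]
    exact Finset.mem_range.mp hi

lemma gegenbauerCoeff_mul_le_map (hn : 2 ≤ n) {p : ℝ[X]} (hp : ∀ i, 0 ≤ gegenbauerCoeff hn p i)
    (φ : ℝ[X] →ₗ[ℝ] ℝ) (hφ : ∀ j, 0 ≤ φ (gegenbauer n j)) (a : ℕ) :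
    gegenbauerCoeff hn p a * φ (gegenbauer n a) ≤ φ p := by
  have hd : p.natDegree < max p.natDegree a + 1 := Nat.lt_succ_of_le (le_max_left _ _)
  conv_rhs => rw [eq_sum_gegenbauerCoeff_mul hn hd, map_sum]
  simp only [← smul_eq_C_mul, map_smul, smul_eq_mul]
  exact Finset.single_le_sum (f := fun i => gegenbauerCoeff hn p i * φ (gegenbauer n i))
    (fun i _ => mul_nonneg (hp i) (hφ i))
    (Finset.mem_range.mpr (Nat.lt_succ_of_le (le_max_right _ _)))

lemma gegenbauerCoeff_mul_le (hn : 2 ≤ n) {p q : ℝ[X]} (hp : ∀ i, 0 ≤ gegenbauerCoeff hn p i)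
    (hq : ∀ i, 0 ≤ gegenbauerCoeff hn q i) (a b i : ℕ) :
    gegenbauerCoeff hn p a * (gegenbauerCoeff hn q b *
      gegenbauerCoeff hn (gegenbauer n a * gegenbauer n b) i) ≤ gegenbauerCoeff hn (p * q) i := by
  have hright : ∀ a b, gegenbauerCoeff hn q b *
      gegenbauerCoeff hn (gegenbauer n a * gegenbauer n b) i ≤
        gegenbauerCoeff hn (gegenbauer n a * q) i := fun a => gegenbauerCoeff_mul_le_map hn hq
    ((gegenbauerBasis hn).coord i ∘ₗ LinearMap.mulLeft ℝ (gegenbauer n a))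
    fun j => gegenbauerCoeff_mul_gegenbauer_nonneg hn a j i
  refine (mul_le_mul_of_nonneg_left (hright a b) (hp a)).trans ?_
  exact gegenbauerCoeff_mul_le_map hn hp
    ((gegenbauerBasis hn).coord i ∘ₗ LinearMap.mulRight ℝ q)
    (fun j => (mul_nonneg (hq 0) (gegenbauerCoeff_mul_gegenbauer_nonneg hn j 0 i)).trans
      (hright j 0)) a

lemma gegenbauerCoeff_mul_nonneg (hn : 2 ≤ n) {p q : ℝ[X]}
    (hp : ∀ i, 0 ≤ gegenbauerCoeff hn p i) (hq : ∀ i, 0 ≤ gegenbauerCoeff hn q i) (i : ℕ) :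
    0 ≤ gegenbauerCoeff hn (p * q) i :=
  (mul_nonneg (hp 0) (mul_nonneg (hq 0) (gegenbauerCoeff_mul_gegenbauer_nonneg hn 0 0 i))).trans
    (gegenbauerCoeff_mul_le hn hp hq 0 0 i)

lemma gegenbauerCoeff_mul_pos (hn : 2 ≤ n) {p q : ℝ[X]}
    (hp : ∀ i, 0 ≤ gegenbauerCoeff hn p i) (hq : ∀ i, 0 ≤ gegenbauerCoeff hn q i) {a b : ℕ}
    (ha : 0 < gegenbauerCoeff hn p a) (hb : 0 < gegenbauerCoeff hn q b) :
    0 < gegenbauerCoeff hn (p * q) (a + b) := by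
  have hP := gegenbauer_threeTerm hn
  have hdeg : (gegenbauer n a * gegenbauer n b).natDegree = a + b := by
    rw [natDegree_mul (hP.ne_zero a) (hP.ne_zero b), hP.natDegree_eq, hP.natDegree_eq]
  have htop := gegenbauerCoeff_natDegree_pos hn (p := gegenbauer n a * gegenbauer n b)
    (by rw [leadingCoeff_mul]; exact mul_pos (hP.leadingCoeff_pos a) (hP.leadingCoeff_pos b))
  rw [hdeg] at htop
  exact (mul_pos ha (mul_pos hb htop)).trans_le (gegenbauerCoeff_mul_le hn hp hq a b _)

-- Both sides are, up to a factor, `(P_{k+1} - P_k) / (X - 1)`.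
lemma exists_adjacent_one_zero_eq_cdKernel (hn : 2 ≤ n) (k : ℕ) :
    ∃ c > 0, adjacent n 1 0 k =
      C c * cdKernel (gegenbauer n) (ultraWeight (gegParam n)) (k + 1) 1 := by
  have hP := gegenbauer_threeTerm hn
  obtain ⟨c, hc⟩ := one_sub_mul_adjacent_one hn 0 k
  have hcd := hP.X_sub_C_mul_cdKernel k 1
  have hone : ∀ j, (gegenbauer n j).eval 1 = 1 := fun j => by
    rw [gegenbauer_eq, jacobi_eval_one]
  have hw := mul_pos (hP.weight_pos k) (hP.up_pos k)
  simp only [hone, mul_one, C_neg, C_1] at hcd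
  set w := ultraWeight (gegParam n) k * (1 - ultraDown (gegParam n) k)
  have hinv : C (c / w) * C w = C c := by rw [← C_mul, div_mul_cancel₀ _ hw.ne']
  have heq : adjacent n 1 0 k =
      C (c / w) * cdKernel (gegenbauer n) (ultraWeight (gegParam n)) (k + 1) 1 := by
    refine mul_left_cancel₀ (X_sub_C_ne_zero (1 : ℝ)) ?_
    change _ = C c * (gegenbauer n k - gegenbauer n (k + 1)) at hc
    rw [C_1]
    linear_combination -hc - C (c / w) * hcd +
      (gegenbauer n k - gegenbauer n (k + 1)) * hinv
  refine ⟨c / w, ?_, heq⟩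
  have heval := congrArg (eval 1) heq
  rw [eval_mul, eval_C, adjacent_eq, jacobi_eval_one] at heval
  have hker : 0 < (cdKernel (gegenbauer n) (ultraWeight (gegParam n)) (k + 1) 1).eval 1 := by
    rw [eval_cdKernel]
    simp only [hone, mul_one]
    exact Finset.sum_pos (fun i _ => hP.weight_pos i) (by simp)
  exact pos_of_mul_pos_left (heval ▸ one_pos) hker.le

lemma gegenbauerCoeff_adjacent_one_zero (hn : 2 ≤ n) (k : ℕ) :
    ∃ c > 0, ∀ i, gegenbauerCoeff hn (adjacent n 1 0 k) i =
      if i ≤ k then c * ultraWeight (gegParam n) i else 0 := by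
  obtain ⟨c, hc, heq⟩ := exists_adjacent_one_zero_eq_cdKernel hn k
  refine ⟨c, hc, fun i => ?_⟩
  simp only [heq, gegenbauerCoeff_C_mul, cdKernel, gegenbauerCoeff_sum, gegenbauerCoeff_gegenbauer,
    mul_ite, mul_zero, Finset.sum_ite_eq', Finset.mem_range, Nat.lt_succ_iff, mul_one]
  rw [gegenbauer_eq, jacobi_eval_one, mul_one]

lemma gegenbauerCoeff_adjacent_one_zero_pos (hn : 2 ≤ n) {i k : ℕ} (h : i ≤ k) :
    0 < gegenbauerCoeff hn (adjacent n 1 0 k) i := by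
  obtain ⟨c, hc, heq⟩ := gegenbauerCoeff_adjacent_one_zero hn k
  rw [heq, if_pos h]
  exact mul_pos hc ((gegenbauer_threeTerm hn).weight_pos i)

lemma gegenbauerCoeff_adjacent_one_zero_nonneg (hn : 2 ≤ n) (i k : ℕ) :
    0 ≤ gegenbauerCoeff hn (adjacent n 1 0 k) i := by
  obtain ⟨c, hc, heq⟩ := gegenbauerCoeff_adjacent_one_zero hn k
  rw [heq]
  split_ifs
  · exact (mul_pos hc ((gegenbauer_threeTerm hn).weight_pos i)).le
  · exact le_rfl

lemma gegenbauer_succ_eval (hn : 2 ≤ n) (k : ℕ) (t : ℝ) :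
    2 * (gegParam n + 1) * (2 * k + 2 * gegParam n + 3) * (gegenbauer n (k + 1)).eval t =
      (k + 2 * gegParam n + 2) * (k + 2 * gegParam n + 3) * (adjacent n 1 1 (k + 1)).eval t -
        (k + 1) * k * (adjacent n 1 1 (k - 1)).eval t := by
  have hν := gegParam_ge hn
  have := k.cast_nonneg (α := ℝ)
  rw [gegenbauer_eq, adjacent_eq, adjacent_eq, Nat.cast_one]
  generalize gegParam n = ν at *
  have hlower := jacobi_lower_right_eval ν ν (k + 1) t
  have hlower_succ := jacobi_lower_left_eval (α := ν) (by linarith) (ν + 1) (k + 1) t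
  have hlower_self := jacobi_lower_left_eval (α := ν) (by linarith) (ν + 1) k t
  rw [Nat.add_sub_cancel, Nat.cast_add_one] at hlower hlower_succ
  have hsucc : 2 * (ν + 1) * (jacobi ν (ν + 1) (k + 1)).eval t =
      (k + 2 * ν + 3) * (jacobi (ν + 1) (ν + 1) (k + 1)).eval t -
        (k + 1) * (jacobi (ν + 1) (ν + 1) k).eval t :=
    mul_left_cancel₀ (by linarith : (k : ℝ) + ν + 2 ≠ 0) (by linear_combination hlower_succ)
  have hself : 2 * (ν + 1) * (jacobi ν (ν + 1) k).eval t =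
      (k + 2 * ν + 2) * (jacobi (ν + 1) (ν + 1) k).eval t -
        k * (jacobi (ν + 1) (ν + 1) (k - 1)).eval t :=
    mul_left_cancel₀ (by linarith : (k : ℝ) + ν + 1 ≠ 0) (by linear_combination hlower_self)
  linear_combination 2 * (ν + 1) * hlower + (k + 2 * ν + 2) * hsucc + (k + 1) * hself

lemma exists_adjacent_one_one_succ_eq (hn : 2 ≤ n) (k : ℕ) :
    ∃ a > 0, ∃ b ≥ 0, adjacent n 1 1 (k + 1) =
      C a * gegenbauer n (k + 1) + C b * adjacent n 1 1 (k - 1) := by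
  have hν := gegParam_ge hn
  have := k.cast_nonneg (α := ℝ)
  have hc : 0 < (k + 2 * gegParam n + 2) * (k + 2 * gegParam n + 3) :=
    mul_pos (by linarith) (by linarith)
  refine ⟨_, div_pos (mul_pos (mul_pos two_pos (by linarith : 0 < gegParam n + 1))
    (by linarith : 0 < 2 * (k : ℝ) + 2 * gegParam n + 3)) hc, _,
    div_nonneg (by positivity : 0 ≤ ((k : ℝ) + 1) * k) hc.le, Polynomial.funext fun t => ?_⟩
  have h := gegenbauer_succ_eval hn k t
  simp only [eval_add, eval_mul, eval_C]
  rw [div_mul_eq_mul_div, div_mul_eq_mul_div, ← add_div, eq_div_iff hc.ne']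
  linear_combination -h

lemma gegenbauerCoeff_adjacent_one_one_nonneg (hn : 2 ≤ n) (i k : ℕ) :
    0 ≤ gegenbauerCoeff hn (adjacent n 1 1 k) i := by
  induction k using Nat.strong_induction_on with
  | _ k ih =>
    have hgeg : ∀ j, 0 ≤ gegenbauerCoeff hn (gegenbauer n j) i := fun j => by
      rw [gegenbauerCoeff_gegenbauer]
      split_ifs
      exacts [zero_le_one, le_rfl]
    rcases k with _ | k
    · have h := hgeg 0
      rwa [(gegenbauer_threeTerm hn).zero, ← (adjacent_one_threeTerm hn 1).zero] at h
    obtain ⟨a, ha, b, hb, heq⟩ := exists_adjacent_one_one_succ_eq hn k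
    rw [heq, gegenbauerCoeff_add, gegenbauerCoeff_C_mul, gegenbauerCoeff_C_mul]
    exact add_nonneg (mul_nonneg ha.le (hgeg _)) (mul_nonneg hb (ih _ (by omega)))

lemma exists_X_add_one_mul_adjacent_one_one (hn : 2 ≤ n) (k : ℕ) :
    ∃ a > 0, ∃ b > 0, (X + 1) * adjacent n 1 1 k =
      C a * adjacent n 1 0 (k + 1) + C b * adjacent n 1 0 k := by
  have hν := gegParam_ge hn
  have := k.cast_nonneg (α := ℝ)
  have hc : 0 < 2 * (k : ℝ) + 2 * gegParam n + 3 := by linarith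
  refine ⟨_, div_pos (mul_pos two_pos (by linarith : 0 < (k : ℝ) + gegParam n + 2)) hc, _,
    div_pos (mul_pos two_pos (by linarith : 0 < (k : ℝ) + gegParam n + 1)) hc,
    Polynomial.funext fun t => ?_⟩
  have h := jacobi_raise_right_eval (α := gegParam n + 1) (by linarith) (gegParam n) k t
  simp only [adjacent_eq, Nat.cast_zero, Nat.cast_one, add_zero, eval_add, eval_mul, eval_C, eval_X,
    eval_one]
  rw [div_mul_eq_mul_div, div_mul_eq_mul_div, ← add_div, eq_div_iff hc.ne']
  linear_combination h

variable {ε : ℕ}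

lemma gegenbauerCoeff_adjacent_one_nonneg (hn : 2 ≤ n) (hε : ε ≤ 1) (i k : ℕ) :
    0 ≤ gegenbauerCoeff hn (adjacent n 1 ε k) i := by
  interval_cases ε
  · exact gegenbauerCoeff_adjacent_one_zero_nonneg hn i k
  · exact gegenbauerCoeff_adjacent_one_one_nonneg hn i k

lemma gegenbauerCoeff_adjacent_one_self_pos (hn : 2 ≤ n) (ε k : ℕ) :
    0 < gegenbauerCoeff hn (adjacent n 1 ε k) k := by
  have h := adjacent_one_threeTerm hn ε
  have hpos := gegenbauerCoeff_natDegree_pos hn (h.leadingCoeff_pos k)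
  rwa [h.natDegree_eq] at hpos

lemma gegenbauerCoeff_weight_mul_adjacent_nonneg (hn : 2 ≤ n) (hε : ε ≤ 1) (i k : ℕ) :
    0 ≤ gegenbauerCoeff hn ((X + 1) ^ ε * adjacent n 1 ε k) i := by
  interval_cases ε
  · rw [pow_zero, one_mul]
    exact gegenbauerCoeff_adjacent_one_zero_nonneg hn i k
  · obtain ⟨a, ha, b, hb, heq⟩ := exists_X_add_one_mul_adjacent_one_one hn k
    rw [pow_one, heq, gegenbauerCoeff_add, gegenbauerCoeff_C_mul, gegenbauerCoeff_C_mul]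
    exact add_nonneg (mul_nonneg ha.le (gegenbauerCoeff_adjacent_one_zero_nonneg hn i _))
      (mul_nonneg hb.le (gegenbauerCoeff_adjacent_one_zero_nonneg hn i _))

lemma gegenbauerCoeff_weight_mul_adjacent_pos (hn : 2 ≤ n) (hε : ε ≤ 1) {i k : ℕ}
    (h : i ≤ k + ε) : 0 < gegenbauerCoeff hn ((X + 1) ^ ε * adjacent n 1 ε k) i := by
  interval_cases ε
  · rw [pow_zero, one_mul]
    exact gegenbauerCoeff_adjacent_one_zero_pos hn h
  · obtain ⟨a, ha, b, hb, heq⟩ := exists_X_add_one_mul_adjacent_one_one hn k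
    rw [pow_one, heq, gegenbauerCoeff_add, gegenbauerCoeff_C_mul, gegenbauerCoeff_C_mul]
    exact add_pos_of_pos_of_nonneg (mul_pos ha (gegenbauerCoeff_adjacent_one_zero_pos hn h))
      (mul_nonneg hb.le (gegenbauerCoeff_adjacent_one_zero_nonneg hn i _))

variable {k : ℕ} {s : ℝ}

lemma gegenbauerCoeff_levenshteinKernel_nonneg (hn : 2 ≤ n) (hε : ε ≤ 1)
    (hpos : ∀ t ≥ s, 0 < (adjacent n 1 ε k).eval t) (i : ℕ) :
    0 ≤ gegenbauerCoeff hn (levenshteinKernel n ε (k + 1) s) i := by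
  have h := adjacent_one_threeTerm hn ε
  rw [levenshteinKernel_eq, cdKernel, gegenbauerCoeff_sum]
  refine Finset.sum_nonneg fun j hj => ?_
  have hj' := h.pos_of_le (Nat.lt_succ_iff.mp (Finset.mem_range.mp hj)) hpos s le_rfl
  rw [gegenbauerCoeff_C_mul]
  exact mul_nonneg (mul_pos (h.weight_pos j) hj').le
    (gegenbauerCoeff_adjacent_one_nonneg hn hε i j)

lemma gegenbauerCoeff_levenshteinKernel_pos (hn : 2 ≤ n) (hε : ε ≤ 1)
    (hpos : ∀ t ≥ s, 0 < (adjacent n 1 ε k).eval t) {i : ℕ} (hi : i ≤ k) :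
    0 < gegenbauerCoeff hn (levenshteinKernel n ε (k + 1) s) i := by
  have h := adjacent_one_threeTerm hn ε
  have hs : ∀ {j}, j ∈ Finset.range (k + 1) →
      0 < jacobiInvNormSq (gegParam n + 1) (gegParam n + ε) j * (adjacent n 1 ε j).eval s :=
    fun hj => mul_pos (h.weight_pos _)
      (h.pos_of_le (Nat.lt_succ_iff.mp (Finset.mem_range.mp hj)) hpos s le_rfl)
  have hi' := Finset.mem_range.mpr (Nat.lt_succ_iff.mpr hi)
  rw [levenshteinKernel_eq, cdKernel, gegenbauerCoeff_sum]
  simp only [gegenbauerCoeff_C_mul]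
  exact Finset.sum_pos'
    (fun j hj => mul_nonneg (hs hj).le (gegenbauerCoeff_adjacent_one_nonneg hn hε i j))
    ⟨i, hi', mul_pos (hs hi') (gegenbauerCoeff_adjacent_one_self_pos hn ε i)⟩

lemma gegenbauerCoeff_levenshteinPoly_pos {m : ℕ} (hn : 2 ≤ n) (hm : 1 ≤ m) (hs : -1 ≤ s)
    (hsm : s ∈ levenshteinInterval n m) {i : ℕ} (hi : i ≤ m) :
    0 < gegenbauerCoeff hn (levenshteinPoly n m s) i := by
  obtain ⟨k, hk⟩ := exists_halfIdx_eq_succ hm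
  obtain ⟨hmk, hε⟩ := halfIdx_parity m
  have hpos := (adjacent_pos_of_mem hn hε hs (largestZero_le_of_mem hk hsm)).1
  have hnp := adjacent_succ_nonpos hn hpos (hk ▸ hsm.2)
  obtain ⟨c, hc, hcd⟩ := exists_X_sub_C_mul_levenshteinKernel hn (parity m) k s
  have hweight := gegenbauerCoeff_weight_mul_adjacent_nonneg hn hε
  have hker := gegenbauerCoeff_levenshteinKernel_nonneg hn hε hpos
  rw [levenshteinPoly, hk]
  obtain ⟨a, b, ha, hb, rfl⟩ : ∃ a b, a ≤ k + 1 + parity m ∧ b ≤ k ∧ i = a + b :=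
    ⟨min i (k + 1 + parity m), i - min i (k + 1 + parity m), by omega, by omega, by omega⟩
  generalize parity m = ε at *
  set T := levenshteinKernel n ε (k + 1) s
  have hsplit : (X - C s) * (X + 1) ^ ε * T ^ 2 =
      C (c * (adjacent n 1 ε k).eval s) * ((X + 1) ^ ε * adjacent n 1 ε (k + 1) * T) +
        C (-(c * (adjacent n 1 ε (k + 1)).eval s)) * ((X + 1) ^ ε * adjacent n 1 ε k * T) := by
    linear_combination (X + 1) ^ ε * T * hcd
  rw [hsplit, gegenbauerCoeff_add, gegenbauerCoeff_C_mul, gegenbauerCoeff_C_mul]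
  refine add_pos_of_pos_of_nonneg (mul_pos (mul_pos hc (hpos s le_rfl)) ?_) (mul_nonneg ?_ ?_)
  · exact gegenbauerCoeff_mul_pos hn (fun j => hweight j _) hker
      (gegenbauerCoeff_weight_mul_adjacent_pos hn hε ha)
      (gegenbauerCoeff_levenshteinKernel_pos hn hε hpos hb)
  · exact neg_nonneg.mpr (mul_nonpos_of_nonneg_of_nonpos hc.le hnp)
  · exact gegenbauerCoeff_mul_nonneg hn (fun j => hweight j _) hker _

end CoefficientPositivity

/-! ### Positive definiteness of the Gegenbauer polynomials -/

section ZonalHarmonics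

variable {σ : Type*} [Fintype σ]

/-- The factorial `d! = ∏ i, (d i)!` of a multi-index. -/
def multiFactorial (d : σ →₀ ℕ) : ℝ := ∏ i, ((d i).factorial : ℝ)

lemma multiFactorial_pos (d : σ →₀ ℕ) : 0 < multiFactorial d :=
  Finset.prod_pos fun _ _ => Nat.cast_pos.mpr (Nat.factorial_pos _)

lemma multiFactorial_add_single (d : σ →₀ ℕ) (i : σ) :
    multiFactorial (d + Finsupp.single i 1) = multiFactorial d * (d i + 1) := by
  classical
  rw [← Fintype.prod_ite_eq' i fun j => (d j + 1 : ℝ), multiFactorial, multiFactorial,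
    ← Finset.prod_mul_distrib]
  refine Finset.prod_congr rfl fun j _ => ?_
  rcases eq_or_ne j i with rfl | hj
  · simp [Nat.factorial_succ, mul_comm]
  · simp [hj]

/-- The Fischer inner product `⟨p, q⟩ = (p(∂) q)(0)`, for which multiplication by a variable is
adjoint to the partial derivative. The monomials are orthogonal, and `⟨x^d, x^d⟩ = d!`. -/
def fischer : MvPolynomial σ ℝ →ₗ[ℝ] MvPolynomial σ ℝ →ₗ[ℝ] ℝ :=
  (MvPolynomial.basisMonomials σ ℝ).constr ℝ
    fun d => multiFactorial d • MvPolynomial.lcoeff ℝ d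

lemma fischer_monomial (d : σ →₀ ℕ) (a : ℝ) (q : MvPolynomial σ ℝ) :
    fischer (MvPolynomial.monomial d a) q = a * (multiFactorial d * q.coeff d) := by
  have h := (MvPolynomial.basisMonomials σ ℝ).constr_basis ℝ
    (fun d => multiFactorial d • MvPolynomial.lcoeff ℝ d) d
  rw [MvPolynomial.coe_basisMonomials] at h
  rw [← mul_one a, ← smul_eq_mul, ← MvPolynomial.smul_monomial, map_smul, fischer, h]
  simp

lemma fischer_self_nonneg (p : MvPolynomial σ ℝ) : 0 ≤ fischer p p := by
  have h : fischer p p = ∑ d ∈ p.support, multiFactorial d * (p.coeff d * p.coeff d) :=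
    calc fischer p p
      _ = fischer (∑ d ∈ p.support, MvPolynomial.monomial d (p.coeff d)) p := by rw [← p.as_sum]
      _ = _ := by
        simp only [map_sum, LinearMap.sum_apply, fischer_monomial, mul_left_comm (p.coeff _)]
  rw [h]
  exact Finset.sum_nonneg fun d _ => mul_nonneg (multiFactorial_pos d).le (mul_self_nonneg _)

lemma fischer_X_mul (i : σ) (p q : MvPolynomial σ ℝ) :
    fischer (MvPolynomial.X i * p) q = fischer p (MvPolynomial.pderiv i q) := by
  induction p using MvPolynomial.induction_on' with
  | monomial d a =>
    rw [mul_comm, MvPolynomial.X, MvPolynomial.monomial_mul, mul_one, fischer_monomial,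
      fischer_monomial, multiFactorial_add_single, MvPolynomial.coeff_pderiv]
    ring
  | add p₁ p₂ h₁ h₂ =>
    rw [mul_add, map_add, map_add, LinearMap.add_apply, LinearMap.add_apply, h₁, h₂]

/-- The linear form `x ↦ x ⬝ y`. -/
def linForm (y : σ → ℝ) : MvPolynomial σ ℝ := ∑ i, y i • MvPolynomial.X i

/-- The quadratic form `x ↦ x ⬝ x`. -/
def normSqForm : MvPolynomial σ ℝ := ∑ i, MvPolynomial.X i * MvPolynomial.X i

/-- The derivative in the direction `y`. -/
def dirDeriv (y : σ → ℝ) : Derivation ℝ (MvPolynomial σ ℝ) (MvPolynomial σ ℝ) :=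
  ∑ i, y i • MvPolynomial.pderiv i

/-- The Laplace operator. -/
def laplacian : MvPolynomial σ ℝ →ₗ[ℝ] MvPolynomial σ ℝ :=
  ∑ i, (MvPolynomial.pderiv i).toLinearMap ∘ₗ (MvPolynomial.pderiv i).toLinearMap

lemma dirDeriv_apply (y : σ → ℝ) (p : MvPolynomial σ ℝ) :
    dirDeriv y p = ∑ i, y i • MvPolynomial.pderiv i p := by
  rw [dirDeriv, ← Derivation.coeFnAddMonoidHom_apply, map_sum, Finset.sum_apply]
  rfl

lemma laplacian_apply (p : MvPolynomial σ ℝ) :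
    laplacian p = ∑ i, MvPolynomial.pderiv i (MvPolynomial.pderiv i p) := by
  simp [laplacian]

lemma fischer_linForm_mul (y : σ → ℝ) (p q : MvPolynomial σ ℝ) :
    fischer (linForm y * p) q = fischer p (dirDeriv y q) := by
  simp only [linForm, dirDeriv_apply, Finset.sum_mul, map_sum, LinearMap.sum_apply, smul_mul_assoc,
    map_smul, LinearMap.smul_apply, fischer_X_mul]

lemma fischer_normSqForm_mul (p q : MvPolynomial σ ℝ) :
    fischer (normSqForm * p) q = fischer p (laplacian q) := by
  simp only [normSqForm, laplacian_apply, Finset.sum_mul, map_sum, LinearMap.sum_apply, mul_assoc,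
    fischer_X_mul]

lemma pderiv_linForm (y : σ → ℝ) (i : σ) :
    MvPolynomial.pderiv i (linForm y) = MvPolynomial.C (y i) := by
  classical
  simp [linForm, MvPolynomial.pderiv_X, Pi.single_apply, MvPolynomial.smul_eq_C_mul]

lemma pderiv_normSqForm (i : σ) :
    MvPolynomial.pderiv i (normSqForm : MvPolynomial σ ℝ) = 2 * MvPolynomial.X i := by
  classical
  simp [normSqForm, MvPolynomial.pderiv_X, Pi.single_apply, Finset.sum_add_distrib, two_mul]

lemma dirDeriv_linForm (y : σ → ℝ) : dirDeriv y (linForm y) = MvPolynomial.C (y ⬝ᵥ y) := by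
  simp [dirDeriv_apply, pderiv_linForm, dotProduct, MvPolynomial.smul_eq_C_mul]

lemma dirDeriv_normSqForm (y : σ → ℝ) : dirDeriv y normSqForm = 2 * linForm y := by
  simp [dirDeriv_apply, pderiv_normSqForm, linForm, Finset.mul_sum]

lemma pderiv_dirDeriv (y : σ → ℝ) (i : σ) (p : MvPolynomial σ ℝ) :
    MvPolynomial.pderiv i (dirDeriv y p) = dirDeriv y (MvPolynomial.pderiv i p) := by
  classical
  have h : ⁅MvPolynomial.pderiv i, dirDeriv y⁆ = 0 := MvPolynomial.derivation_ext fun j => by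
    rw [Derivation.commutator_apply, dirDeriv_apply, dirDeriv_apply]
    simp [MvPolynomial.pderiv_X, Pi.single_apply, apply_ite]
  have hp := DFunLike.congr_fun h p
  rwa [Derivation.commutator_apply, Derivation.zero_apply, sub_eq_zero] at hp

lemma laplacian_dirDeriv (y : σ → ℝ) (p : MvPolynomial σ ℝ) :
    laplacian (dirDeriv y p) = dirDeriv y (laplacian p) := by
  simp only [laplacian_apply, pderiv_dirDeriv, map_sum]

lemma laplacian_mul (p q : MvPolynomial σ ℝ) :
    laplacian (p * q) = laplacian p * q +
      2 * ∑ i, MvPolynomial.pderiv i p * MvPolynomial.pderiv i q + p * laplacian q := by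
  simp only [laplacian_apply, MvPolynomial.pderiv_mul, map_add, Finset.sum_mul, Finset.mul_sum,
    ← Finset.sum_add_distrib]
  exact Finset.sum_congr rfl fun i _ => by ring

lemma laplacian_linForm_mul (y : σ → ℝ) (p : MvPolynomial σ ℝ) :
    laplacian (linForm y * p) = 2 * dirDeriv y p + linForm y * laplacian p := by
  rw [laplacian_mul, laplacian_apply (linForm y), dirDeriv_apply]
  simp only [pderiv_linForm, MvPolynomial.pderiv_C, Finset.sum_const_zero, zero_mul, zero_add,
    MvPolynomial.smul_eq_C_mul]

lemma laplacian_normSqForm_mul {d : ℕ} {p : MvPolynomial σ ℝ} (hp : p.IsHomogeneous d) :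
    laplacian (normSqForm * p) = MvPolynomial.C (2 * Fintype.card σ + 4 * d : ℝ) * p +
      normSqForm * laplacian p := by
  have hEuler := hp.sum_X_mul_pderiv
  rw [nsmul_eq_mul] at hEuler
  have hcard : laplacian (normSqForm : MvPolynomial σ ℝ) =
      2 * (Fintype.card σ : MvPolynomial σ ℝ) := by
    simp only [laplacian_apply, pderiv_normSqForm, two_mul, map_add, MvPolynomial.pderiv_X_self,
      Finset.sum_const, Finset.card_univ, nsmul_eq_mul]
    ring
  rw [laplacian_mul, hcard]
  simp only [pderiv_normSqForm, mul_assoc, ← Finset.mul_sum, hEuler, map_add, map_mul, map_natCast,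
    map_ofNat]
  ring

lemma dirDeriv_isHomogeneous (y : σ → ℝ) {p : MvPolynomial σ ℝ} {d : ℕ}
    (hp : p.IsHomogeneous (d + 1)) : (dirDeriv y p).IsHomogeneous d := by
  rw [dirDeriv_apply]
  refine MvPolynomial.IsHomogeneous.sum _ _ _ fun i _ => ?_
  rw [MvPolynomial.smul_eq_C_mul]
  exact hp.pderiv.C_mul _

lemma eval_dirDeriv_self (y : σ → ℝ) {p : MvPolynomial σ ℝ} {d : ℕ} (hp : p.IsHomogeneous d) :
    MvPolynomial.eval y (dirDeriv y p) = d * MvPolynomial.eval y p := by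
  have h := congrArg (MvPolynomial.eval y) hp.sum_X_mul_pderiv
  simpa [dirDeriv_apply] using h

/-- The homogeneous polynomial of degree `k` which restricts to `x ↦ P_k(x ⬝ y)` on the unit sphere,
where `P_k` is the ultraspherical polynomial with parameter `ν` and `y` is a unit vector: the
recurrence is that of `P_k`, made homogeneous. -/
def zonal (ν : ℝ) (y : σ → ℝ) : ℕ → MvPolynomial σ ℝ
  | 0 => 1
  | 1 => linForm y
  | k + 2 => MvPolynomial.C (1 - ultraDown ν (k + 1))⁻¹ * (linForm y * zonal ν y (k + 1) -
      MvPolynomial.C (ultraDown ν (k + 1)) * (normSqForm * zonal ν y k))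

variable {ν : ℝ} {y : σ → ℝ}

lemma zonal_succ (ν : ℝ) (y : σ → ℝ) (k : ℕ) :
    zonal ν y (k + 1) = MvPolynomial.C (1 - ultraDown ν k)⁻¹ * (linForm y * zonal ν y k -
      MvPolynomial.C (ultraDown ν k) * (normSqForm * zonal ν y (k - 1))) := by
  rcases k with _ | k
  · simp [zonal, ultraDown_zero]
  · rfl

lemma zonal_recurrence (hν : -1 / 2 ≤ ν) (y : σ → ℝ) (k : ℕ) :
    MvPolynomial.C (1 - ultraDown ν k) * zonal ν y (k + 1) = linForm y * zonal ν y k -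
      MvPolynomial.C (ultraDown ν k) * (normSqForm * zonal ν y (k - 1)) := by
  have h : 1 - ultraDown ν k ≠ 0 := (sub_pos.mpr (ultraDown_lt_one hν k)).ne'
  rw [zonal_succ, ← mul_assoc, ← MvPolynomial.C_mul, mul_inv_cancel₀ h, MvPolynomial.C_1, one_mul]

lemma linForm_isHomogeneous (y : σ → ℝ) : (linForm y).IsHomogeneous 1 :=
  (MvPolynomial.homogeneousSubmodule σ ℝ 1).sum_mem fun i _ =>
    Submodule.smul_mem _ _ (MvPolynomial.isHomogeneous_X ℝ i)

lemma normSqForm_isHomogeneous : (normSqForm : MvPolynomial σ ℝ).IsHomogeneous 2 :=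
  MvPolynomial.IsHomogeneous.sum _ _ _ fun i _ =>
    (MvPolynomial.isHomogeneous_X ℝ i).mul (MvPolynomial.isHomogeneous_X ℝ i)

lemma zonal_isHomogeneous (ν : ℝ) (y : σ → ℝ) (k : ℕ) : (zonal ν y k).IsHomogeneous k := by
  induction k using zonal.induct with
  | case1 => exact MvPolynomial.isHomogeneous_one _ _
  | case2 => exact linForm_isHomogeneous y
  | case3 k ih₁ ih₀ =>
    have h₁ : (linForm y * zonal ν y (k + 1)).IsHomogeneous (k + 2) :=
      add_comm 1 (k + 1) ▸ (linForm_isHomogeneous y).mul ih₁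
    have h₀ : (normSqForm * zonal ν y k).IsHomogeneous (k + 2) :=
      add_comm 2 k ▸ normSqForm_isHomogeneous.mul ih₀
    rw [zonal]
    exact (h₁.sub (h₀.C_mul _)).C_mul _

lemma eval_zonal (hν : -1 / 2 ≤ ν) (y : σ → ℝ) {x : σ → ℝ} (hx : x ⬝ᵥ x = 1) (k : ℕ) :
    MvPolynomial.eval x (zonal ν y k) = (jacobi ν ν k).eval (y ⬝ᵥ x) := by
  have hlin : MvPolynomial.eval x (linForm y) = y ⬝ᵥ x := by simp [linForm, dotProduct]
  have hnorm : MvPolynomial.eval x (normSqForm : MvPolynomial σ ℝ) = 1 := by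
    rw [← hx]; simp [normSqForm, dotProduct]
  induction k using Nat.strong_induction_on with
  | _ k ih =>
    rcases k with _ | k
    · simp [zonal, jacobi_zero]
    have hup := sub_pos.mpr (ultraDown_lt_one hν k)
    have hrec := (ultraspherical_threeTerm hν).recurrence_eval (y ⬝ᵥ x) k
    rw [zonal_succ]
    simp only [map_mul, map_sub, MvPolynomial.eval_C, hlin, hnorm, one_mul, ih k (by omega),
      ih (k - 1) (by omega), hrec, Pi.zero_apply, zero_mul, add_zero, add_sub_cancel_right]
    exact inv_mul_cancel_left₀ hup.ne' _

lemma ultraDown_mul (hν : -1 / 2 ≤ ν) (k : ℕ) : ultraDown ν k * (2 * k + 2 * ν + 1) = k := by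
  rcases k with _ | k
  · simp [ultraDown_zero]
  · have := k.cast_nonneg (α := ℝ)
    rw [ultraDown, div_mul_cancel₀]
    push_cast
    linarith

lemma ultraDown_mul_ultraDown_succ (hν : -1 / 2 ≤ ν) (k : ℕ) :
    (k + 1 - 2 * ultraDown ν (k + 1)) * ultraDown ν k = ultraDown ν (k + 1) * k := by
  have h₀ := ultraDown_mul hν k
  have h₁ := ultraDown_mul hν (k + 1)
  push_cast at h₁
  linear_combination ultraDown ν (k + 1) * h₀ - ultraDown ν k * h₁

lemma dirDeriv_C_mul (y : σ → ℝ) (c : ℝ) (p : MvPolynomial σ ℝ) :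
    dirDeriv y (MvPolynomial.C c * p) = MvPolynomial.C c * dirDeriv y p := by
  rw [← MvPolynomial.smul_eq_C_mul, Derivation.map_smul, MvPolynomial.smul_eq_C_mul]

lemma dirDeriv_zonal (hν : -1 / 2 ≤ ν) (hy : y ⬝ᵥ y = 1) (k : ℕ) :
    dirDeriv y (zonal ν y k) = MvPolynomial.C (k : ℝ) * zonal ν y (k - 1) := by
  induction k using Nat.strong_induction_on with
  | _ k ih =>
    rcases k with _ | k
    · simp [zonal]
    have hup : (MvPolynomial.C (1 - ultraDown ν k) : MvPolynomial σ ℝ) ≠ 0 :=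
      MvPolynomial.C_ne_zero.mpr (sub_pos.mpr (ultraDown_lt_one hν k)).ne'
    apply mul_left_cancel₀ hup
    rw [← dirDeriv_C_mul, zonal_recurrence hν, map_sub, dirDeriv_C_mul, Derivation.leibniz,
      Derivation.leibniz, dirDeriv_linForm, hy, dirDeriv_normSqForm, ih k (by omega),
      ih (k - 1) (by omega)]
    rcases k with _ | k
    · simp [ultraDown_zero]
    · have hrec := zonal_recurrence hν y k
      have hcoeff := congrArg (MvPolynomial.C (σ := σ)) (ultraDown_mul_ultraDown_succ hν k)
      simp only [map_mul, map_sub, map_add, MvPolynomial.C_1, map_ofNat] at hcoeff hrec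
      simp only [Nat.add_sub_cancel, smul_eq_mul, Nat.cast_add, Nat.cast_one, map_sub, map_add,
        MvPolynomial.C_1]
      linear_combination (MvPolynomial.C (k : ℝ) + 1 - 2 * MvPolynomial.C (ultraDown ν (k + 1))) *
        (-hrec) + (normSqForm * zonal ν y (k - 1) - zonal ν y (k + 1)) * hcoeff

lemma laplacian_C_mul (c : ℝ) (p : MvPolynomial σ ℝ) :
    laplacian (MvPolynomial.C c * p) = MvPolynomial.C c * laplacian p := by
  rw [← MvPolynomial.smul_eq_C_mul, map_smul, MvPolynomial.smul_eq_C_mul]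

lemma laplacian_zonal (hcard : (Fintype.card σ : ℝ) = 2 * ν + 3) (hν : -1 / 2 ≤ ν)
    (hy : y ⬝ᵥ y = 1) (k : ℕ) : laplacian (zonal ν y k) = 0 := by
  induction k using Nat.strong_induction_on with
  | _ k ih =>
    rcases k with _ | k
    · simp [zonal, laplacian_apply]
    rw [zonal_succ, laplacian_C_mul, map_sub, laplacian_C_mul, laplacian_linForm_mul,
      laplacian_normSqForm_mul (zonal_isHomogeneous ν y (k - 1)), ih k (by omega),
      ih (k - 1) (by omega), dirDeriv_zonal hν hy]
    rcases k with _ | k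
    · simp [ultraDown_zero]
    · have hcoeff := congrArg (MvPolynomial.C (σ := σ)) (ultraDown_mul hν (k + 1))
      rw [hcard]
      push_cast at hcoeff ⊢
      simp only [map_mul, map_add, MvPolynomial.C_1, map_ofNat] at hcoeff ⊢
      linear_combination -2 * MvPolynomial.C (1 - ultraDown ν (k + 1))⁻¹ * zonal ν y k * hcoeff

/-- The constant in the reproducing property of `zonal`. -/
def zonalConst (ν : ℝ) (k : ℕ) : ℝ := ∏ i ∈ Finset.range k, (i + 1) / (1 - ultraDown ν i)

lemma zonalConst_pos (hν : -1 / 2 ≤ ν) (k : ℕ) : 0 < zonalConst ν k :=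
  Finset.prod_pos fun i _ => div_pos i.cast_add_one_pos (sub_pos.mpr (ultraDown_lt_one hν i))

lemma fischer_zonal (y : σ → ℝ) {k : ℕ} {q : MvPolynomial σ ℝ} (hq : q.IsHomogeneous k)
    (hΔ : laplacian q = 0) :
    fischer (zonal ν y k) q = zonalConst ν k * MvPolynomial.eval y q := by
  induction k generalizing q with
  | zero =>
    obtain ⟨c, rfl⟩ : ∃ c, q = MvPolynomial.C c :=
      ⟨_, MvPolynomial.totalDegree_eq_zero_iff_eq_C.mp (Nat.le_zero.mp hq.totalDegree_le)⟩
    rw [zonal, ← MvPolynomial.C_1, MvPolynomial.C_apply, fischer_monomial]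
    simp [multiFactorial, zonalConst]
  | succ k ih =>
    have hdir := ih (dirDeriv_isHomogeneous y hq) (by rw [laplacian_dirDeriv, hΔ, map_zero])
    rw [zonal_succ, ← MvPolynomial.smul_eq_C_mul, ← MvPolynomial.smul_eq_C_mul, map_smul, map_sub,
      map_smul, LinearMap.smul_apply, LinearMap.sub_apply, LinearMap.smul_apply,
      fischer_linForm_mul, fischer_normSqForm_mul, hΔ, map_zero, hdir, eval_dirDeriv_self y hq,
      zonalConst, zonalConst, Finset.prod_range_succ, smul_eq_mul, smul_zero, sub_zero]
    push_cast
    ring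

-- The zonal polynomials are harmonic, so by the reproducing property their Gram matrix for the
-- Fischer inner product is a positive multiple of the matrix of the values of `P_k`.
lemma ultraspherical_posDef {ι : Type*} [Fintype ι] (hcard : (Fintype.card σ : ℝ) = 2 * ν + 3)
    (hν : -1 / 2 ≤ ν) {y : ι → σ → ℝ} (hy : ∀ i, y i ⬝ᵥ y i = 1) (w : ι → ℝ) (k : ℕ) :
    0 ≤ ∑ i, ∑ j, w i * w j * (jacobi ν ν k).eval (y i ⬝ᵥ y j) := by
  have hfischer (i j : ι) : fischer (zonal ν (y i) k) (zonal ν (y j) k) =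
      zonalConst ν k * (jacobi ν ν k).eval (y i ⬝ᵥ y j) := by
    rw [fischer_zonal _ (zonal_isHomogeneous ν _ k) (laplacian_zonal hcard hν (hy j) k),
      eval_zonal hν _ (hy i), dotProduct_comm]
  have hgram : fischer (∑ i, w i • zonal ν (y i) k) (∑ i, w i • zonal ν (y i) k) =
      zonalConst ν k * ∑ i, ∑ j, w i * w j * (jacobi ν ν k).eval (y i ⬝ᵥ y j) := by
    rw [LinearMap.map_sum₂]
    simp only [map_sum, map_smul, LinearMap.smul_apply, hfischer, smul_eq_mul, Finset.mul_sum]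
    exact Finset.sum_congr rfl fun i _ => Finset.sum_congr rfl fun j _ => by ring
  exact nonneg_of_mul_nonneg_right (hgram ▸ fischer_self_nonneg _) (zonalConst_pos hν k)

lemma gegenbauer_posDef {n : ℕ} {ι : Type*} [Fintype ι] (hn : 2 ≤ n)
    (x : ι → Metric.sphere (0 : EuclideanSpace ℝ (Fin n)) 1) (w : ι → ℝ) (k : ℕ) :
    0 ≤ ∑ i, ∑ j, w i * w j *
      (gegenbauer n k).eval (inner ℝ (x i : EuclideanSpace ℝ (Fin n)) (x j)) := by
  have hcard : (Fintype.card (Fin n) : ℝ) = 2 * gegParam n + 3 := by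
    rw [Fintype.card_fin, gegParam]; ring
  have hinner (i j : ι) : inner ℝ (x i : EuclideanSpace ℝ (Fin n)) (x j) =
      (x i : EuclideanSpace ℝ (Fin n)).ofLp ⬝ᵥ (x j : EuclideanSpace ℝ (Fin n)).ofLp := by
    rw [EuclideanSpace.inner_eq_star_dotProduct, star_trivial, dotProduct_comm]
  have hunit (i : ι) : (x i : EuclideanSpace ℝ (Fin n)).ofLp ⬝ᵥ
      (x i : EuclideanSpace ℝ (Fin n)).ofLp = 1 := by
    rw [← hinner, real_inner_self_eq_norm_sq, norm_eq_of_mem_sphere, one_pow]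
  simpa only [hinner, gegenbauer_eq] using ultraspherical_posDef hcard (gegParam_ge hn) hunit w k

end ZonalHarmonics

/-! ### The error of Hermite interpolation -/

section HermiteInterpolation

lemma exists_finset_zeros_deriv {φ φ' : ℝ → ℝ} {S : Set ℝ} (hS : S.OrdConnected)
    (hc : ContinuousOn φ S) (hd : ∀ x ∈ interior S, HasDerivAt φ (φ' x) x) {A : Finset ℝ}
    (hAS : ∀ a ∈ A, a ∈ S) (hA : ∀ a ∈ A, φ a = 0) :
    ∃ B : Finset ℝ, A.card ≤ B.card + 1 ∧ Disjoint A B ∧ ∀ b ∈ B, b ∈ interior S ∧ φ' b = 0 := by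
  have hRolle (x y : ℝ) (hx : x ∈ A) (hy : y ∈ A) (hxy : x < y) :
      ∃ z, (x < z ∧ z < y) ∧ z ∈ interior S ∧ φ' z = 0 := by
    have hsub : Set.Icc x y ⊆ S := hS.out (hAS x hx) (hAS y hy)
    have hint : Set.Ioo x y ⊆ interior S :=
      interior_maximal (Set.Ioo_subset_Icc_self.trans hsub) isOpen_Ioo
    obtain ⟨z, hz, hz0⟩ := exists_hasDerivAt_eq_zero hxy (hc.mono hsub)
      ((hA x hx).trans (hA y hy).symm) fun t ht => hd t (hint ht)
    exact ⟨z, hz, hint hz, hz0⟩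
  choose! z hz using hRolle
  let B := ((A ×ˢ A).filter fun p => p.1 < p.2).image fun p => z p.1 p.2
  have hB : ∀ b ∈ B, b ∈ interior S ∧ φ' b = 0 := by
    intro b hb
    obtain ⟨⟨x, y⟩, hxy, rfl⟩ := Finset.mem_image.mp hb
    obtain ⟨hxyA, hlt⟩ := Finset.mem_filter.mp hxy
    obtain ⟨hx, hy⟩ := Finset.mem_product.mp hxyA
    exact (hz x y hx hy hlt).2
  refine ⟨B \ A, Finset.card_le_sdiff_of_interleaved fun x hx y hy hxy _ => ?_,
    Finset.disjoint_sdiff, fun b hb => hB b (Finset.mem_sdiff.mp hb).1⟩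
  exact ⟨z x y, Finset.mem_image.mpr ⟨(x, y),
    Finset.mem_filter.mpr ⟨Finset.mk_mem_product hx hy, hxy⟩, rfl⟩, (hz x y hx hy hxy).1⟩

-- Each multiple zero loses one multiplicity, and Rolle's theorem adds the zeros in between.
lemma exists_multiset_zeros_deriv {ψ : ℕ → ℝ → ℝ} {S : Set ℝ} (hS : S.OrdConnected)
    (hc : ContinuousOn (ψ 0) S) (hd : ∀ x ∈ interior S, HasDerivAt (ψ 0) (ψ 1 x) x)
    {Z : Multiset ℝ} (hZS : ∀ a ∈ Z, a ∈ S) (hZ2 : ∀ a, 2 ≤ Z.count a → a ∈ interior S)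
    (hZ0 : ∀ a, ∀ j < Z.count a, ψ j a = 0) :
    ∃ Z' : Multiset ℝ, Z.card ≤ Z'.card + 1 ∧ (∀ a ∈ Z', a ∈ interior S) ∧
      ∀ a, ∀ j < Z'.count a, ψ (j + 1) a = 0 := by
  classical
  obtain ⟨B, hcard, hdisj, hB⟩ := exists_finset_zeros_deriv (A := Z.toFinset) hS hc hd
    (fun a ha => hZS a (Multiset.mem_toFinset.mp ha))
    fun a ha => hZ0 a 0 (Multiset.count_pos.mpr (Multiset.mem_toFinset.mp ha))
  have hcases (a : ℝ) (j : ℕ) (hj : j < (Z - Z.dedup + B.val).count a) :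
      j + 1 < Z.count a ∨ a ∈ B ∧ j = 0 := by
    rw [Multiset.count_add, Multiset.count_sub, Multiset.count_dedup] at hj
    by_cases haB : a ∈ B
    · have haZ : a ∉ Z := fun h => Finset.disjoint_left.mp hdisj (Multiset.mem_toFinset.mpr h) haB
      rw [Multiset.count_eq_zero_of_notMem haZ, Multiset.count_eq_one_of_mem B.nodup haB] at hj
      exact Or.inr ⟨haB, by omega⟩
    · rw [Multiset.count_eq_zero_of_notMem (s := B.val) haB] at hj
      split_ifs at hj with haZ
      · exact Or.inl (by omega)
      · rw [Multiset.count_eq_zero_of_notMem haZ] at hj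
        omega
  refine ⟨Z - Z.dedup + B.val, ?_, fun a ha => ?_, fun a j hj => ?_⟩
  · have hle := Multiset.card_le_card Z.dedup_le
    rw [Multiset.card_add, Multiset.card_sub Z.dedup_le, Finset.card_val]
    rw [Multiset.card_toFinset] at hcard
    omega
  · obtain h | ⟨h, -⟩ := hcases a 0 (Multiset.count_pos.mpr ha)
    exacts [hZ2 a h, (hB a h).1]
  · obtain h | ⟨h, rfl⟩ := hcases a j hj
    exacts [hZ0 a (j + 1) h, (hB a h).2]

lemma exists_zero_of_card_lt {m : ℕ} (hm : 1 ≤ m) {ψ : ℕ → ℝ → ℝ} {S : Set ℝ}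
    (hS : S.OrdConnected) (hc : ContinuousOn (ψ 0) S)
    (hd : ∀ i < m, ∀ x ∈ interior S, HasDerivAt (ψ i) (ψ (i + 1) x) x) {Z : Multiset ℝ}
    (hcard : m < Z.card) (hZS : ∀ a ∈ Z, a ∈ S) (hZ2 : ∀ a, 2 ≤ Z.count a → a ∈ interior S)
    (hZ0 : ∀ a, ∀ j < Z.count a, ψ j a = 0) : ∃ ξ ∈ interior S, ψ m ξ = 0 := by
  induction m, hm using Nat.le_induction generalizing ψ S Z with
  | base =>
    obtain ⟨Z', hcard', hZ', hZ'0⟩ :=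
      exists_multiset_zeros_deriv hS hc (hd 0 Nat.one_pos) hZS hZ2 hZ0
    obtain ⟨a, ha⟩ := Multiset.card_pos_iff_exists_mem.mp (by omega : 0 < Z'.card)
    exact ⟨a, hZ' a ha, hZ'0 a 0 (Multiset.count_pos.mpr ha)⟩
  | succ m hm ih =>
    obtain ⟨Z', hcard', hZ', hZ'0⟩ :=
      exists_multiset_zeros_deriv hS hc (hd 0 m.succ_pos) hZS hZ2 hZ0
    have hd' (i : ℕ) (hi : i < m) (x : ℝ) (hx : x ∈ interior (interior S)) :
        HasDerivAt (ψ (i + 1)) (ψ (i + 1 + 1) x) x := hd (i + 1) (by omega) x (interior_subset hx)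
    have hc' : ContinuousOn (ψ 1) (interior S) := fun x hx =>
      (hd 1 (by omega) x hx).continuousAt.continuousWithinAt
    obtain ⟨ξ, hξ, hξ0⟩ := ih (ψ := fun i => ψ (i + 1)) hS.interior hc' hd' (by omega) hZ'
      (fun a ha => (interior_interior (s := S)).symm ▸ hZ' a (Multiset.count_pos.mp (by omega)))
      hZ'0
    exact ⟨ξ, interior_subset hξ, hξ0⟩

/-- The monic polynomial whose zeros are the nodes `T`, counted with multiplicity. -/
def nodal (T : Multiset ℝ) : ℝ[X] := (T.map fun a => X - C a).prod

lemma nodal_monic (T : Multiset ℝ) : (nodal T).Monic :=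
  monic_multiset_prod_of_monic _ _ fun a _ => monic_X_sub_C a

lemma iterate_derivative_nodal_eval {T : Multiset ℝ} {a : ℝ} {j : ℕ} (hj : j < T.count a) :
    (derivative^[j] (nodal T)).eval a = 0 := by
  rw [← roots_multiset_prod_X_sub_C T, count_roots] at hj
  exact (lt_rootMultiplicity_iff_isRoot_iterate_derivative (nodal_monic T).ne_zero).mp hj j le_rfl

lemma iterate_derivative_card_nodal (T : Multiset ℝ) :
    derivative^[T.card] (nodal T) = C (T.card.factorial : ℝ) := by
  have hdeg : (nodal T).natDegree = T.card := natDegree_multiset_prod_X_sub_C_eq_card T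
  have hdeg0 : (derivative^[T.card] (nodal T)).natDegree = 0 := by
    have := natDegree_iterate_derivative (nodal T) T.card
    omega
  have hlead : (nodal T).coeff T.card = 1 := hdeg ▸ nodal_monic T
  rw [eq_C_of_natDegree_eq_zero hdeg0, coeff_iterate_derivative, zero_add, hlead,
    Nat.descFactorial_self, nsmul_one]

variable {h : ℝ → ℝ} {T : Multiset ℝ} {g : ℝ[X]} {S : Set ℝ} {t : ℝ}

-- The error minus the multiple of the nodal polynomial which makes it vanish at `t` has
-- `T.card + 1` zeros, so its derivative of order `T.card` has a zero.
lemma IsHermiteInterpolant.exists_sub_eval_eq (hg : IsHermiteInterpolant h T g)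
    (hS : S.OrdConnected) (hT : T ≠ 0) (hTS : ∀ a ∈ T, a ∈ S)
    (hT2 : ∀ a, 2 ≤ T.count a → a ∈ interior S) (hcont : ContinuousOn h S)
    (hdiff : ∀ i < T.card, DifferentiableOn ℝ (iteratedDeriv i h) (interior S))
    (ht : t ∈ S) (htT : t ∉ T) :
    ∃ ξ ∈ interior S, h t - g.eval t =
      iteratedDeriv T.card h ξ / T.card.factorial * (nodal T).eval t := by
  have hnodal : (nodal T).eval t ≠ 0 := fun h0 => htT <| by
    rw [← roots_multiset_prod_X_sub_C T]
    exact (mem_roots (nodal_monic T).ne_zero).mpr h0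
  set c := (h t - g.eval t) / (nodal T).eval t with hc
  have hct : h t - g.eval t = c * (nodal T).eval t := (div_mul_cancel₀ _ hnodal).symm
  let ψ (i : ℕ) (x : ℝ) : ℝ := iteratedDeriv i h x - (derivative^[i] (g + C c * nodal T)).eval x
  have hψ_deriv (i : ℕ) (hi : i < T.card) (x : ℝ) (hx : x ∈ interior S) :
      HasDerivAt (ψ i) (ψ (i + 1) x) x := by
    have hhi := ((hdiff i hi).differentiableAt (isOpen_interior.mem_nhds hx)).hasDerivAt
    simp only [ψ, iteratedDeriv_succ, Function.iterate_succ_apply']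
    exact hhi.sub (Polynomial.hasDerivAt _ x)
  have hcount (a : ℝ) (j : ℕ) (hj : j < (t ::ₘ T).count a) : j < T.count a ∨ a = t ∧ j = 0 := by
    rcases eq_or_ne a t with rfl | hat
    · rw [Multiset.count_cons_self, Multiset.count_eq_zero_of_notMem htT] at hj
      exact Or.inr ⟨rfl, by omega⟩
    · exact Or.inl (Multiset.count_cons_of_ne hat T ▸ hj)
  have hψ_zero (a : ℝ) (j : ℕ) (hj : j < (t ::ₘ T).count a) : ψ j a = 0 := by
    obtain hj | ⟨rfl, rfl⟩ := hcount a j hj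
    · have hga := hg.2 a (Multiset.count_pos.mp (by omega)) j hj
      simp [ψ, iterate_map_add, iterate_derivative_C_mul, iterate_derivative_nodal_eval hj, hga]
    · simp [ψ, ← sub_sub, hct]
  obtain ⟨ξ, hξ, hξ0⟩ := exists_zero_of_card_lt (Multiset.card_pos.mpr hT) (ψ := ψ)
    (Z := t ::ₘ T) hS (hcont.sub (Polynomial.continuous _).continuousOn) hψ_deriv (by simp)
    (Multiset.forall_mem_cons.mpr ⟨ht, hTS⟩)
    (fun a ha => hT2 a ((hcount a 1 ha).resolve_right fun h => one_ne_zero h.2)) hψ_zero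
  simp only [ψ, iterate_map_add, iterate_derivative_C_mul, iterate_derivative_card_nodal,
    iterate_derivative_eq_zero_of_degree_lt hg.1, zero_add, eval_mul, eval_C, sub_eq_zero] at hξ0
  refine ⟨ξ, hξ, ?_⟩
  rw [hct, hξ0, mul_div_cancel_right₀ _ (Nat.cast_ne_zero.mpr (Nat.factorial_ne_zero _))]

lemma IsHermiteInterpolant.le_eval (hg : IsHermiteInterpolant h T g) (hS : S.OrdConnected)
    (hT : T ≠ 0) (hTS : ∀ a ∈ T, a ∈ S) (hT2 : ∀ a, 2 ≤ T.count a → a ∈ interior S)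
    (hcont : ContinuousOn h S)
    (hdiff : ∀ i < T.card, DifferentiableOn ℝ (iteratedDeriv i h) (interior S))
    (hpos : ∀ x ∈ interior S, 0 ≤ iteratedDeriv T.card h x) (ht : t ∈ S)
    (hnodal : (nodal T).eval t ≤ 0) : h t ≤ g.eval t := by
  by_cases htT : t ∈ T
  · exact (hg.2 t htT 0 (Multiset.count_pos.mpr htT)).ge
  · obtain ⟨ξ, hξ, herr⟩ := hg.exists_sub_eval_eq hS hT hTS hT2 hcont hdiff ht htT
    rw [← sub_nonpos, herr]
    exact mul_nonpos_of_nonneg_of_nonpos (div_nonneg (hpos ξ hξ) (Nat.cast_nonneg _)) hnodal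

end HermiteInterpolation

/-! ### The zeros of the Levenshtein polynomial -/

section LevenshteinRoots

variable {n m k : ℕ} {s t : ℝ}

lemma roots_levenshteinPoly (hn : 2 ≤ n) (hk : halfIdx m = k + 1) (s : ℝ) :
    (levenshteinPoly n m s).roots =
      {s} + parity m • {-1} + 2 • (levenshteinKernel n (parity m) (k + 1) s).roots := by
  have hX : (X + 1 : ℝ[X]) = X - C (-1) := by simp
  have hX0 : (X + 1 : ℝ[X]) ≠ 0 := hX ▸ X_sub_C_ne_zero _
  have hleft : (X - C s) * (X + 1) ^ parity m ≠ 0 :=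
    mul_ne_zero (X_sub_C_ne_zero s) (pow_ne_zero _ hX0)
  have hker := pow_ne_zero 2 (levenshteinKernel_ne_zero hn (parity m) k s)
  rw [levenshteinPoly, hk, roots_mul (mul_ne_zero hleft hker), roots_mul hleft, roots_pow,
    roots_pow, roots_X_sub_C, hX, roots_X_sub_C]

lemma card_roots_levenshteinPoly (hn : 2 ≤ n) (hm : 1 ≤ m) (hs : -1 ≤ s)
    (hsm : s ∈ levenshteinInterval n m) : (levenshteinPoly n m s).roots.card = m := by
  obtain ⟨k, hk⟩ := exists_halfIdx_eq_succ hm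
  have hmk := (halfIdx_parity m).1
  have hpos := (adjacent_eval_pos_of_mem hn hk hs hsm).ne'
  rw [roots_levenshteinPoly hn hk, Multiset.card_add, Multiset.card_add, Multiset.card_nsmul,
    Multiset.card_nsmul, Multiset.card_singleton, Multiset.card_singleton,
    ← (levenshteinKernel_splits hn hpos).natDegree_eq_card_roots,
    natDegree_levenshteinKernel hn hpos]
  omega

lemma natDegree_levenshteinPoly_le (hn : 2 ≤ n) (hm : 1 ≤ m) (hs : -1 ≤ s)
    (hsm : s ∈ levenshteinInterval n m) : (levenshteinPoly n m s).natDegree ≤ m := by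
  obtain ⟨k, hk⟩ := exists_halfIdx_eq_succ hm
  have hmk := (halfIdx_parity m).1
  have hker := natDegree_levenshteinKernel hn (adjacent_eval_pos_of_mem hn hk hs hsm).ne'
  rw [levenshteinPoly, hk]
  compute_degree
  rw [hker]
  omega

lemma mem_Icc_of_mem_roots_levenshteinPoly (hn : 2 ≤ n) (hm : 1 ≤ m) (hs : -1 ≤ s)
    (hsm : s ∈ levenshteinInterval n m) (ht : t ∈ (levenshteinPoly n m s).roots) :
    t ∈ Set.Icc (-1) s := by
  obtain ⟨k, hk⟩ := exists_halfIdx_eq_succ hm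
  rw [roots_levenshteinPoly hn hk, Multiset.mem_add, Multiset.mem_add] at ht
  rcases ht with (ht | ht) | ht
  · rw [Multiset.mem_singleton.mp ht]
    exact Set.right_mem_Icc.mpr hs
  · rw [Multiset.mem_singleton.mp (Multiset.mem_of_mem_nsmul ht)]
    exact Set.left_mem_Icc.mpr hs
  · exact Set.Ico_subset_Icc_self <| mem_Ico_of_mem_roots_levenshteinKernel hn
      (halfIdx_parity m).2 hs (largestZero_le_of_mem hk hsm) (Multiset.mem_of_mem_nsmul ht)

lemma mul_sq_eval_nonpos (ht : t ∈ Set.Icc (-1) s) (d : ℕ) (p : ℝ[X]) :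
    ((X - C s) * (X + 1) ^ d * p ^ 2).eval t ≤ 0 := by
  simp only [eval_mul, eval_sub, eval_X, eval_C, eval_pow, eval_add, eval_one]
  exact mul_nonpos_of_nonpos_of_nonneg (mul_nonpos_of_nonpos_of_nonneg (sub_nonpos.mpr ht.2)
    (pow_nonneg (by linarith [ht.1]) d)) (sq_nonneg _)

lemma nodal_roots_levenshteinPoly_eval_nonpos (hn : 2 ≤ n) (hm : 1 ≤ m)
    (ht : t ∈ Set.Icc (-1) s) : (nodal (levenshteinPoly n m s).roots).eval t ≤ 0 := by
  obtain ⟨k, hk⟩ := exists_halfIdx_eq_succ hm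
  have hfactor : nodal (levenshteinPoly n m s).roots = (X - C s) * (X + 1) ^ parity m *
      nodal (levenshteinKernel n (parity m) (k + 1) s).roots ^ 2 := by
    simp [roots_levenshteinPoly hn hk, nodal, Multiset.map_nsmul, Multiset.prod_nsmul, mul_assoc]
  rw [hfactor]
  exact mul_sq_eval_nonpos ht _ _

lemma adjacent_one_zero_eval_of_adjacent_one_one_eval_eq_zero (hn : 2 ≤ n)
    (h0 : (adjacent n 1 1 k).eval s = 0) :
    (k + gegParam n + 1) * (adjacent n 1 0 k).eval s =
      -((gegParam n + 1) * (adjacent n 0 0 (k + 1)).eval s) := by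
  have hν := gegParam_ge hn
  have hraise := jacobi_raise_right_eval (α := gegParam n + 1) (by linarith) (gegParam n) k s
  have hlower := adjacent_zero_succ_eval hn 0 k s
  simp only [adjacent_eq, Nat.cast_one, Nat.cast_zero, add_zero, lowerUp, lowerDown]
    at h0 hlower hraise ⊢
  rw [h0] at hraise
  refine mul_left_cancel₀ (by linarith [k.cast_nonneg (α := ℝ)] :
    2 * (k : ℝ) + 2 * gegParam n + 3 ≠ 0) ?_
  linear_combination hlower - (k + 2 * gegParam n + 2) / 2 * hraise

lemma levenshteinBound_eq_dgs (hn : 2 ≤ n) (hk : halfIdx m = k + 1) (hε : parity m = 0)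
    (hs : s ≠ 1) (hA : (adjacent n 0 0 (k + 1)).eval s ≠ 0)
    (h0 : (adjacent n 1 1 k).eval s = 0) : levenshteinBound n m s = dgs n m := by
  have hL := adjacentMean_mul_levenshteinBound hn hk hs (by simp [hε]) (hε ▸ hA)
  have hadj := adjacent_one_zero_eval_of_adjacent_one_one_eval_eq_zero hn h0
  obtain ⟨n, rfl⟩ := Nat.exists_eq_add_of_le' hn
  have hmean := adjacentMean_zero_mul_choose n hn k
  have hchoose : ((n : ℝ) + k + 1) * (n + k).choose n = (n + k + 1).choose (n + 1) * (n + 1) :=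
    mod_cast Nat.add_one_mul_choose_eq (n + k) n
  have hn' : (n : ℝ) + 1 ≠ 0 := by positivity
  rw [dgs, hε, hk, add_zero, show n + 2 + (k + 1) - 2 = n + k + 1 by omega,
    show n + 2 - 1 = n + 1 by omega]
  simp only [hε, add_zero, gegParam] at hL hadj
  push_cast at hadj ⊢
  refine mul_left_cancel₀ (left_ne_zero_of_mul_eq_one hmean) (mul_right_cancel₀ hA ?_)
  rw [← mul_div_assoc, ← mul_div_assoc, div_eq_one_iff_eq hn'] at hmean
  have hk' : 2 * (k : ℝ) + n + 1 ≠ 0 := by positivity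
  refine mul_left_cancel₀ (mul_ne_zero hn' hk') ?_
  linear_combination (n + 1 : ℝ) * (2 * k + n + 1) * hL - 2 * (n + 1 : ℝ) * hadj -
    2 * (n + k + 1) * (adjacent (n + 2) 0 0 (k + 1)).eval s * hmean +
    2 * (2 * k + n + 1) * adjacentMean hn 0 k * (adjacent (n + 2) 0 0 (k + 1)).eval s * hchoose

lemma count_neg_one_roots_levenshteinPoly_le (hn : 2 ≤ n) (hm : 1 ≤ m) (hs : s ∈ Set.Ico (-1) 1)
    (hsm : s ∈ levenshteinInterval n m) (hD : (dgs n m : ℝ) < levenshteinBound n m s) :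
    (levenshteinPoly n m s).roots.count (-1) ≤ 1 := by
  obtain ⟨k, hk⟩ := exists_halfIdx_eq_succ hm
  obtain ⟨-, hε⟩ := halfIdx_parity m
  have hl := largestZero_le_of_mem hk hsm
  have hA := (adjacent_zero_eval_neg_of_mem hn hk hs.1 hsm).ne
  have hlt := (adjacent_pos_of_mem hn hε hs.1 hl).2
  have hker : (levenshteinKernel n (parity m) (k + 1) s).eval (-1) ≠ 0 := by
    rcases Nat.le_one_iff_eq_zero_or_eq_one.mp hε with h | h <;> rw [h] at hl hA ⊢
    · exact levenshteinKernel_zero_eval_ne_zero hn hs.1 hl le_rfl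
        (Or.inr fun h0 => hD.ne' (levenshteinBound_eq_dgs hn hk h hs.2.ne hA h0))
    · exact levenshteinKernel_one_eval_ne_zero hn hs.1 hl le_rfl
  rw [roots_levenshteinPoly hn hk, Multiset.count_add, Multiset.count_add, Multiset.count_nsmul,
    Multiset.count_nsmul, Multiset.count_eq_zero_of_notMem (s := roots _)
      fun h => hker (isRoot_of_mem_roots h), Multiset.count_singleton,
    Multiset.count_singleton_self]
  split_ifs with h1
  · have : parity m ≠ 1 := fun h => (hlt h).ne h1
    omega
  · omega

variable {h : ℝ → ℝ}

lemma le_gT_eval (hn : 2 ≤ n) (hm : 1 ≤ m) (hs : s ∈ Set.Ico (-1) 1)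
    (hsm : s ∈ levenshteinInterval n m) (hD : (dgs n m : ℝ) < levenshteinBound n m s)
    (hcont : ContinuousOn h (Set.Ico (-1) 1))
    (hdiff : ∀ i < m, DifferentiableOn ℝ (iteratedDeriv i h) (Set.Ioo (-1) 1))
    (hpos : ∀ t ∈ Set.Ioo (-1 : ℝ) 1, 0 ≤ iteratedDeriv m h t) (ht : t ∈ Set.Icc (-1) s) :
    h t ≤ (gT n m s h).eval t := by
  have hcard := card_roots_levenshteinPoly hn hm hs.1 hsm
  have hsub : Set.Icc (-1) s ⊆ Set.Ico (-1) 1 := Set.Icc_subset_Ico_right hs.2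
  have hroots : ∀ a ∈ (levenshteinPoly n m s).roots, a ∈ Set.Ico (-1) 1 := fun a ha =>
    hsub (mem_Icc_of_mem_roots_levenshteinPoly hn hm hs.1 hsm ha)
  have hmult : ∀ a, 2 ≤ (levenshteinPoly n m s).roots.count a → a ∈ Set.Ioo (-1) 1 := by
    intro a ha
    obtain ⟨hle, hlt⟩ := hroots a (Multiset.count_pos.mp (by omega))
    refine ⟨hle.lt_of_ne ?_, hlt⟩
    rintro rfl
    exact absurd (count_neg_one_roots_levenshteinPoly_le hn hm hs hsm hD) (by omega)
  rw [← hcard] at hdiff hpos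
  rw [← interior_Ico] at hmult hdiff hpos
  exact (hermiteInterp_spec h _).le_eval Set.ordConnected_Ico
    (Multiset.card_pos.mp (hcard.symm ▸ hm)) hroots hmult hcont hdiff hpos (hsub ht)
    (nodal_roots_levenshteinPoly_eval_nonpos hn hm ht)

lemma natDegree_gT_le (hn : 2 ≤ n) (hm : 1 ≤ m) (hs : -1 ≤ s)
    (hsm : s ∈ levenshteinInterval n m) (h : ℝ → ℝ) : (gT n m s h).natDegree ≤ m := by
  have hcard := card_roots_levenshteinPoly hn hm hs hsm
  have hdeg := (hermiteInterp_spec h (levenshteinPoly n m s).roots).1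
  rw [hcard] at hdeg
  exact natDegree_le_of_degree_le hdeg.le

end LevenshteinRoots

/-! ### The linear programming bound -/

section LinearProgramming

variable {n N : ℕ} {s : ℝ} {w : Fin N → ℝ}
  {x : Fin N → Metric.sphere (0 : EuclideanSpace ℝ (Fin n)) 1}

lemma inner_mem_Icc_of_isMaxInner (hx : IsMaxInner x s) {i j : Fin N} (hij : i ≠ j) :
    inner ℝ (x i : EuclideanSpace ℝ (Fin n)) (x j) ∈ Set.Icc (-1) s :=
  ⟨neg_one_le_real_inner_of_norm_eq_one (norm_eq_of_mem_sphere _) (norm_eq_of_mem_sphere _),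
    hx.2 ⟨i, j, hij, rfl⟩⟩

lemma energy_le_energy {h h' : ℝ → ℝ} (hw : ∀ i, 0 ≤ w i) (hx : IsMaxInner x s)
    (hh : ∀ t ∈ Set.Icc (-1) s, h t ≤ h' t) : energy h x w ≤ energy h' x w :=
  Finset.sum_le_sum fun i _ => Finset.sum_le_sum fun j hj =>
    mul_le_mul_of_nonneg_left
      (hh _ (inner_mem_Icc_of_isMaxInner hx (Finset.ne_of_mem_erase hj).symm))
      (mul_nonneg (hw i) (hw j))

lemma energy_eq_sum_sub (h : ℝ → ℝ) (x : Fin N → Metric.sphere (0 : EuclideanSpace ℝ (Fin n)) 1)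
    (w : Fin N → ℝ) :
    energy h x w = (∑ i, ∑ j, w i * w j *
      h (inner ℝ (x i : EuclideanSpace ℝ (Fin n)) (x j))) - h 1 * ∑ i, w i ^ 2 := by
  rw [energy, Finset.mul_sum, ← Finset.sum_sub_distrib]
  refine Finset.sum_congr rfl fun i _ => ?_
  rw [← Finset.add_sum_erase _ _ (Finset.mem_univ i), real_inner_self_eq_norm_sq,
    norm_eq_of_mem_sphere, one_pow]
  ring

lemma sum_eval_inner_le (hn : 2 ≤ n) {ι : Type*} [Fintype ι]
    (x : ι → Metric.sphere (0 : EuclideanSpace ℝ (Fin n)) 1) (w : ι → ℝ) {F : ℝ[X]}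
    (hF : ∀ i, 1 ≤ i → gegenbauerCoeff hn F i ≤ 0) :
    ∑ i, ∑ j, w i * w j * F.eval (inner ℝ (x i : EuclideanSpace ℝ (Fin n)) (x j)) ≤
      gegenbauerCoeff hn F 0 * (∑ i, w i) ^ 2 := by
  let G (l : ℕ) : ℝ := ∑ i, ∑ j, w i * w j *
    (gegenbauer n l).eval (inner ℝ (x i : EuclideanSpace ℝ (Fin n)) (x j))
  have hG0 : G 0 = (∑ i, w i) ^ 2 := by
    simp only [G, gegenbauer_eq, jacobi_zero, eval_one, mul_one, sq, Finset.sum_mul_sum]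
  calc ∑ i, ∑ j, w i * w j * F.eval (inner ℝ (x i : EuclideanSpace ℝ (Fin n)) (x j))
    _ = ∑ l ∈ Finset.range (F.natDegree + 1), gegenbauerCoeff hn F l * G l := by
      conv_lhs => rw [eq_sum_gegenbauerCoeff_mul hn F.natDegree.lt_succ_self]
      simp only [G, eval_finsetSum, eval_mul, eval_C, Finset.mul_sum]
      rw [eq_comm, Finset.sum_comm]
      refine Finset.sum_congr rfl fun i _ => ?_
      rw [Finset.sum_comm]
      exact Finset.sum_congr rfl fun j _ => Finset.sum_congr rfl fun l _ => by ring
    _ ≤ gegenbauerCoeff hn F 0 * G 0 := by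
      rw [Finset.sum_range_succ', add_le_iff_nonpos_left]
      exact Finset.sum_nonpos fun l _ => mul_nonpos_of_nonpos_of_nonneg (hF _ l.succ_pos)
        (gegenbauer_posDef hn x w _)
    _ = gegenbauerCoeff hn F 0 * (∑ i, w i) ^ 2 := by rw [hG0]

lemma energy_le_of_gegenbauerCoeff_nonpos (hn : 2 ≤ n) (hw : IsWeight w) (hx : IsMaxInner x s)
    {h : ℝ → ℝ} {F : ℝ[X]} (hF : ∀ i, 1 ≤ i → gegenbauerCoeff hn F i ≤ 0)
    (hhF : ∀ t ∈ Set.Icc (-1) s, h t ≤ F.eval t) :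
    energy h x w ≤ gegenbauerCoeff hn F 0 - F.eval 1 / effSize w := by
  have hsum := sum_eval_inner_le hn x w hF
  rw [hw.2, one_pow, mul_one] at hsum
  calc energy h x w
    _ ≤ energy (F.eval ·) x w := energy_le_energy (fun i => (hw.1 i).le) hx hhF
    _ ≤ gegenbauerCoeff hn F 0 - F.eval 1 * ∑ i, w i ^ 2 := by
      rw [energy_eq_sum_sub]
      exact sub_le_sub_right hsum _
    _ = gegenbauerCoeff hn F 0 - F.eval 1 / effSize w := by
      rw [effSize, div_div_eq_mul_div, div_one]

variable {m : ℕ} {h : ℝ → ℝ}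

lemma lambdaStar_nonneg (hn : 2 ≤ n) (hm : 1 ≤ m) (hs : -1 ≤ s) (hsm : s ∈ levenshteinInterval n m)
    (h : ℝ → ℝ) : 0 ≤ lambdaStar hn m s h := by
  rw [lambdaStar]
  split_ifs with hI
  · obtain ⟨i, hi⟩ := hI
    obtain ⟨him, hpos⟩ := Finset.mem_filter.mp hi
    have hf := gegenbauerCoeff_levenshteinPoly_pos hn hm hs hsm (Finset.mem_Icc.mp him).2
    exact (Finset.le_sup'_iff _).mpr ⟨i, hi, (div_pos hpos hf).le⟩
  · exact le_rfl

lemma gegenbauerCoeff_gT_le (hn : 2 ≤ n) (hm : 1 ≤ m) (hs : -1 ≤ s)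
    (hsm : s ∈ levenshteinInterval n m) (h : ℝ → ℝ) {i : ℕ} (hi : 1 ≤ i) (him : i ≤ m) :
    gegenbauerCoeff hn (gT n m s h) i ≤
      lambdaStar hn m s h * gegenbauerCoeff hn (levenshteinPoly n m s) i := by
  have hf := gegenbauerCoeff_levenshteinPoly_pos hn hm hs hsm him
  rcases le_or_gt (gegenbauerCoeff hn (gT n m s h) i) 0 with h0 | h0
  · exact h0.trans (mul_nonneg (lambdaStar_nonneg hn hm hs hsm h) hf.le)
  · have hmem : i ∈ posIndices hn m (gT n m s h) :=
      Finset.mem_filter.mpr ⟨Finset.mem_Icc.mpr ⟨hi, him⟩, h0⟩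
    rw [← div_le_iff₀ hf, lambdaStar, dif_pos ⟨i, hmem⟩]
    exact (Finset.le_sup'_iff _).mpr ⟨i, hmem, le_rfl⟩

/-- The test polynomial `g_T - λ* f_m` of the linear programming bound: `λ*` is the least
nonnegative factor for which its Gegenbauer coefficients of positive index are nonpositive. -/
def testPoly (hn : 2 ≤ n) (m : ℕ) (s : ℝ) (h : ℝ → ℝ) : ℝ[X] :=
  gT n m s h - C (lambdaStar hn m s h) * levenshteinPoly n m s

lemma gegenbauerCoeff_testPoly_nonpos (hn : 2 ≤ n) (hm : 1 ≤ m) (hs : -1 ≤ s)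
    (hsm : s ∈ levenshteinInterval n m) (h : ℝ → ℝ) {i : ℕ} (hi : 1 ≤ i) :
    gegenbauerCoeff hn (testPoly hn m s h) i ≤ 0 := by
  rw [testPoly, gegenbauerCoeff_sub, gegenbauerCoeff_C_mul]
  rcases le_or_gt i m with him | him
  · exact sub_nonpos.mpr (gegenbauerCoeff_gT_le hn hm hs hsm h hi him)
  · rw [gegenbauerCoeff_eq_zero_of_natDegree_lt hn ((natDegree_gT_le hn hm hs hsm h).trans_lt him),
      gegenbauerCoeff_eq_zero_of_natDegree_lt hn
        ((natDegree_levenshteinPoly_le hn hm hs hsm).trans_lt him), mul_zero, sub_zero]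

lemma le_testPoly_eval (hn : 2 ≤ n) (hm : 1 ≤ m) (hs : s ∈ Set.Ico (-1) 1)
    (hsm : s ∈ levenshteinInterval n m) (hD : (dgs n m : ℝ) < levenshteinBound n m s)
    (hcont : ContinuousOn h (Set.Ico (-1) 1))
    (hdiff : ∀ i < m, DifferentiableOn ℝ (iteratedDeriv i h) (Set.Ioo (-1) 1))
    (hpos : ∀ t ∈ Set.Ioo (-1 : ℝ) 1, 0 ≤ iteratedDeriv m h t) {t : ℝ}
    (ht : t ∈ Set.Icc (-1) s) : h t ≤ (testPoly hn m s h).eval t := by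
  have hf : (levenshteinPoly n m s).eval t ≤ 0 := mul_sq_eval_nonpos ht _ _
  have hlam := lambdaStar_nonneg hn hm hs.1 hsm h
  rw [testPoly, eval_sub, eval_mul, eval_C]
  linarith [le_gT_eval hn hm hs hsm hD hcont hdiff hpos ht, mul_nonpos_of_nonneg_of_nonpos hlam hf]

lemma gegenbauerCoeff_testPoly_zero_sub (hn : 2 ≤ n) (hm : 1 ≤ m) (hs : s ∈ Set.Ico (-1) 1)
    (hsm : s ∈ levenshteinInterval n m) (h : ℝ → ℝ) (M : ℝ) :
    gegenbauerCoeff hn (testPoly hn m s h) 0 - (testPoly hn m s h).eval 1 / M =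
      -lambdaStar hn m s h * gegenbauerCoeff hn (levenshteinPoly n m s) 0 *
          (1 - levenshteinBound n m s / M) +
        gegenbauerCoeff hn (gT n m s h) 0 - (gT n m s h).eval 1 / M := by
  rw [testPoly, gegenbauerCoeff_sub, gegenbauerCoeff_C_mul, eval_sub, eval_mul, eval_C,
    levenshteinPoly_eval_one hn hm hs hsm]
  ring

end LinearProgramming

end

end WeightedCodes

theorem theorem4p2 {n : ℕ} (hn : 2 ≤ n) {m : ℕ} (hm : 1 ≤ m)
    {N : ℕ} (w : Fin N → ℝ) (hw : IsWeight w)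
    (s : ℝ) (hs : s ∈ Set.Ico (-1 : ℝ) 1) (hsm : s ∈ levenshteinInterval n m)
    (hN₁ : (dgs n m : ℝ) < levenshteinBound n m s ∧
      levenshteinBound n m s ≤ (dgs n (m + 1) : ℝ))
    (h : ℝ → ℝ) (hcont : ContinuousOn h (Set.Ico (-1) 1))
    (hdiff : ∀ i < m, DifferentiableOn ℝ (iteratedDeriv i h) (Set.Ioo (-1) 1))
    (hpos : ∀ t ∈ Set.Ioo (-1 : ℝ) 1, 0 ≤ iteratedDeriv m h t) :
    (levenshteinPoly n m s).roots.card = m ∧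
    (∀ a ∈ (levenshteinPoly n m s).roots, a ∈ Set.Icc (-1 : ℝ) s) ∧
    maxEnergy n h s w ≤
      ((-lambdaStar hn m s h * gegenbauerCoeff hn (levenshteinPoly n m s) 0 *
            (1 - levenshteinBound n m s / effSize w) +
          gegenbauerCoeff hn (gT n m s h) 0 - (gT n m s h).eval 1 / effSize w : ℝ) : EReal) := by
  refine ⟨card_roots_levenshteinPoly hn hm hs.1 hsm,
    fun a ha => mem_Icc_of_mem_roots_levenshteinPoly hn hm hs.1 hsm ha, sSup_le ?_⟩
  rintro _ ⟨x, -, hx, rfl⟩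
  rw [EReal.coe_le_coe_iff, ← gegenbauerCoeff_testPoly_zero_sub hn hm hs hsm]
  exact energy_le_of_gegenbauerCoeff_nonpos hn hw hx
    (fun i hi => gegenbauerCoeff_testPoly_nonpos hn hm hs.1 hsm h hi)
    fun t ht => le_testPoly_eval hn hm hs hsm hN₁.1 hcont hdiff hpos ht
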